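/- **Setting.** A pairwise Markov random field consists of a finite simple graph $G=(V,E)$ with $V=\{1,\dots,n\}$, a finite nonempty alphabet $\Sigma$, and nonnegative potentials $\phi_v:\Sigma\to\mathbb R_+$ ($v\in V$), $\psi_{uv}:\Sigma^2\to\mathbb R_+$ ($uv\in E$). Put $\mathcal H(x)=\sum_{v\in V}\phi_v(x_v)+\sum_{uv\in E}\psi_{uv}(x_u,x_v)$ for $x\in\Sigma^n$; a MAP assignment $x^*$ is a maximizer of $\Pr[x]\propto e^{\mathcal H(x)}$. Let $d^*$ be the maximum degree of $G$. *Minor-e*$(G,r,\Lambda)$: start with $B=\emptyset$. For $i=0,\dots,r-1$: in each connected component of $G_i=(V,E\setminus B)$ (with the current $B$) choose an arbitrary root (possibly depending on $i$ and $G_i$), draw $L$ uniformly from $\{0,\dots,\Lambda-1\}$, independently of all other draws, and after treating all components of $G_i$ add to $B$ all edges of these components at breadth-first-search levels $L,\Lambda+L,2\Lambda+L,\dots$, where the level of an edge is the distance in $G_i$ from the root of its component to its nearer endpoint. Output $B$. *Mode* with Minor-e: compute $B$ by Minor-e, and for each connected component of $(V,E\setminus B)$ find an exact MAP assignment of the field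 restricted to this component (arbitrary if there are several). The output $\hat x$ is the union of these assignments. **Theorem.** Let $\varepsilon>0$, let $G$ exclude $K_{r,r}$ as a minor, and let $\Lambda=\lceil r(d^*+1)/\varepsilon\rceil$. 1. For all choices of roots and of exact MAP assignments of the components, the output $\hat x$ of Mode with Minor-e$(G,r,\Lambda)$ satisfies $$\mathbb E\big[\mathcal H(x^*)-\mathcal H(\hat x)\big]\le\varepsilon\,\mathcal H(x^*).$$ 2. There is one program $P$ for a randomized real random access machine that, for all inputs with $n,|\Sigma|,\Lambda\ge1$ (field given by adjacency lists and tables of potentials, and numbers $r,\Lambda$), implements Mode with Minor-e$(G,r,\Lambda)$: for some choice of roots not depending on the random numbers, and for all values of the random numbers, it halts with a possible output of Mode. (Unit-cost instructions: addition and truncated subtraction of natural numbers, addition and comparison of reals, access to array cells, tests, and drawing a number from $\{0,\dots,\Lambda-1\}$.) It has the following running times for all values of the random numbers. (a) For every $r$ there is a constant $C$, depending only on $r$, such that for all $n\ge1$, all $\varepsilon>0$ and all fields with $n$ vertices whose graph excludes $K_{r,r}$ as a minor, with $\Lambda$ as above, $P$ takes at most $$C\,n\,D\,|\Sigma|^{D^{C\Lambda}}\quad\text{steps,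 where } D=\max\{d^*,2\}.$$ In particular this is $n\,d^*\,|\Sigma|^{{d^*}^{O(\Lambda)}}$ if $d^*\ge 2$. (b) Let $r$ and $|\Sigma|$ be fixed. For every sequence of such inputs with $n\to\infty$ and $\varepsilon^{-1}d^*\log d^*=o(\log\log n)$ ($\varepsilon>0$ and the field may vary along the sequence, and $0\log 0=0$), $P$ takes $o(n^{1+\delta})$ steps for every $\delta>0$. -/

import Mathlib

open Filter Asymptotics
open scoped BigOperators

/-! ### Graph minors -/

/-- `H` is a minor of `G`: there are pairwise disjoint, connected (in particular nonempty) branch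
sets in `G`, one for each vertex of `H`, with an edge of `G` between the branch sets of any two
adjacent vertices of `H`. -/
def IsMinor {W V : Type*} (H : SimpleGraph W) (G : SimpleGraph V) : Prop :=
  ∃ branch : W → Set V,
    (∀ w, (G.induce (branch w)).Connected) ∧
    (∀ w w', w ≠ w' → Disjoint (branch w) (branch w')) ∧
    (∀ w w', H.Adj w w' → ∃ a ∈ branch w, ∃ b ∈ branch w', G.Adj a b)

/-- `G` excludes `K_{r,r}` as a minor. -/
def ExcludesKrr {V : Type*} (G : SimpleGraph V) (r : ℕ) : Prop :=
  ¬ IsMinor (completeBipartiteGraph (Fin r) (Fin r)) G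

/-! ### Pairwise Markov random fields -/

/-- A pairwise Markov random field on the vertex set `V` with alphabet `S`: a graph with
nonnegative potentials. The values of `ψ` at non-adjacent pairs are never used. -/
structure MRF (V S : Type) where
  graph : SimpleGraph V
  φ : V → S → ℝ
  ψ : V → V → S → S → ℝ
  φ_nonneg : ∀ v x, 0 ≤ φ v x
  ψ_nonneg : ∀ u v x y, 0 ≤ ψ u v x y
  ψ_symm : ∀ u v x y, ψ u v x y = ψ v u y x

/-- The term `ψ_{uv}(x_u, x_v)` of an unordered pair `uv`. -/
def MRF.edgeTerm {V S : Type} (M : MRF V S) (x : V → S) : Sym2 V → ℝ :=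
  Sym2.lift ⟨fun u v => M.ψ u v (x u) (x v), fun u v => M.ψ_symm u v (x u) (x v)⟩

open Classical in
/-- `H(x)`, the sum of `φ_v(x_v)` over the vertices and of `ψ_{uv}(x_u, x_v)` over the edges. -/
noncomputable def MRF.energy {V S : Type} [Fintype V] (M : MRF V S) (x : V → S) : ℝ :=
  ∑ v, M.φ v (x v) + ∑ e ∈ Finset.univ.filter (fun e => e ∈ M.graph.edgeSet), M.edgeTerm x e

/-- The probability of the assignment `x`, proportional to `exp (H(x))`. -/
noncomputable def MRF.prob {V S : Type} [Fintype V] [DecidableEq V] [Fintype S]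
    (M : MRF V S) (x : V → S) : ℝ :=
  Real.exp (M.energy x) / ∑ y : V → S, Real.exp (M.energy y)

/-- `x` is a maximum a posteriori assignment. -/
def MRF.IsMAP {V S : Type} [Fintype V] [DecidableEq V] [Fintype S]
    (M : MRF V S) (x : V → S) : Prop :=
  ∀ y, M.prob y ≤ M.prob x

open Classical in
/-- The maximum vertex degree `d*`. -/
noncomputable def MRF.maxDeg {V S : Type} [Fintype V] (M : MRF V S) : ℕ :=
  M.graph.maxDegree

/-! ### The decomposition `Minor-e` -/

/-- A rule for the arbitrary choice of a root in each connected component `c` of the current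
graph `H` in round `i`. -/
structure RootRule (V : Type) where
  pick : ℕ → (H : SimpleGraph V) → H.ConnectedComponent → V
  pick_mem : ∀ i H c, pick i H c ∈ c.supp

/-- The level of an edge `uv` in the breadth-first search of `H` from `root`: the distance from
the root to the endpoint nearer to the root. Edges at the root have level `0`. -/
noncomputable def edgeLevel {V : Type} (H : SimpleGraph V) (root : V) : Sym2 V → ℕ :=
  Sym2.lift ⟨fun u v => min (H.dist root u) (H.dist root v), fun _ _ => min_comm _ _⟩

/-- One round: in each component `c` of `H`, with root `root c`, the edges at the levels
`L, Λ + L, 2Λ + L, …`, where `L = L (root c)` is the number drawn for this component. -/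
def bfsCut {V : Type} {Λ : ℕ} (H : SimpleGraph V) (root : H.ConnectedComponent → V)
    (L : V → Fin Λ) : Set (Sym2 V) :=
  {e | e ∈ H.edgeSet ∧ ∃ c : H.ConnectedComponent, (∀ v ∈ e, v ∈ c.supp) ∧
    ∃ k : ℕ, edgeLevel H (root c) e = k * Λ + L (root c)}

/-- The random numbers used in `r` rounds: `L i v` is used in round `i` for the component with
root `v` (if there is one). They are independent and uniform on `{0, …, Λ - 1}`, that is, the
family `L` is uniform on this finite type. -/
abbrev Draws (n r Λ : ℕ) : Type := Fin r → Fin n → Fin Λ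

/-- The set `B` of edges put out by `Minor-e (G, r, Λ)` for the root choices `ρ` and the random
numbers `L`: round `i` works on the graph `G_i = (V, E \ B)` with the current `B`. -/
def minorE {n Λ : ℕ} (G : SimpleGraph (Fin n)) (ρ : RootRule (Fin n)) :
    (r : ℕ) → Draws n r Λ → Set (Sym2 (Fin n))
  | 0, _ => ∅
  | i + 1, L =>
      minorE G ρ i (Fin.init L) ∪
        bfsCut (G.deleteEdges (minorE G ρ i (Fin.init L)))
          (ρ.pick i (G.deleteEdges (minorE G ρ i (Fin.init L)))) (L (Fin.last i))

/-! ### The algorithm `Mode` -/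

open Classical in
/-- The energy of the Markov random field restricted to a connected component `c` of
`(V, E \ B)`; it depends only on the values of `x` on `c`. -/
noncomputable def MRF.componentEnergy {V S : Type} [Fintype V] (M : MRF V S)
    (B : Set (Sym2 V)) (c : (M.graph.deleteEdges B).ConnectedComponent) (x : V → S) : ℝ :=
  ∑ v ∈ Finset.univ.filter (fun v => v ∈ c.supp), M.φ v (x v) +
    ∑ e ∈ Finset.univ.filter
        (fun e => e ∈ (M.graph.deleteEdges B).edgeSet ∧ ∀ v ∈ e, v ∈ c.supp), M.edgeTerm x e

/-- `x` is a possible output of `Mode` when the decomposition step has put out `B`: on every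
connected component of `(V, E \ B)` it is an exact MAP assignment of that component. -/
def MRF.IsModeOutput {V S : Type} [Fintype V] (M : MRF V S) (B : Set (Sym2 V))
    (x : V → S) : Prop :=
  ∀ (c : (M.graph.deleteEdges B).ConnectedComponent) (y : V → S),
    M.componentEnergy B c y ≤ M.componentEnergy B c x

/-! ### A randomized real random access machine with a step count -/

/-- Programs. The arguments `x y z` are names of integer registers, `u v w` names of real
registers, `a` names of arrays, and `idx` is the list of the integer registers that hold the
indices of the array cell. -/
inductive Cmd : Type
  | skip
  | set (x k : ℕ)
  | add (x y z : ℕ)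
  | sub (x y z : ℕ)
  | load (x a : ℕ) (idx : List ℕ)
  | store (a : ℕ) (idx : List ℕ) (x : ℕ)
  | draw (x y z : ℕ)
  | rload (u a : ℕ) (idx : List ℕ)
  | rstore (a : ℕ) (idx : List ℕ) (u : ℕ)
  | radd (u v w : ℕ)
  | seq (c d : Cmd)
  | ifLt (x y : ℕ) (c d : Cmd)
  | ifRLt (u v : ℕ) (c d : Cmd)
  | whileLt (x y : ℕ) (c : Cmd)

/-- Registers and arrays, holding natural numbers (`reg`, `mem`) or real numbers
(`rreg`, `rmem`). -/
structure MState where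
  reg : ℕ → ℕ
  rreg : ℕ → ℝ
  mem : ℕ → List ℕ → ℕ
  rmem : ℕ → List ℕ → ℝ

/-- The assignment `x := k`. -/
def MState.setReg (s : MState) (x k : ℕ) : MState :=
  { s with reg := Function.update s.reg x k }

/-- The assignment `u := t` of a real register. -/
def MState.setRReg (s : MState) (u : ℕ) (t : ℝ) : MState :=
  { s with rreg := Function.update s.rreg u t }

/-- The assignment `a[i] := k`, where `i` is a list of indices. -/
def MState.setMem (s : MState) (a : ℕ) (i : List ℕ) (k : ℕ) : MState :=
  { s with mem := Function.update s.mem a (Function.update (s.mem a) i k) }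

/-- The assignment `a[i] := t` in a real array. -/
def MState.setRMem (s : MState) (a : ℕ) (i : List ℕ) (t : ℝ) : MState :=
  { s with rmem := Function.update s.rmem a (Function.update (s.rmem a) i t) }

/-- `Exec ω c s t s'`: with the random source `ω`, the program `c` started in the state `s` halts
after exactly `t` steps, in the state `s'`. Each basic instruction and each test is one step. The
random source can be read only by `draw`, which puts the random number `ω i v` into a register. -/
inductive Exec (ω : ℕ → ℕ → ℕ) : Cmd → MState → ℕ → MState → Prop
  | skip (s : MState) : Exec ω .skip s 1 s
  | set (s : MState) (x k : ℕ) : Exec ω (.set x k) s 1 (s.setReg x k)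
  | add (s : MState) (x y z : ℕ) :
      Exec ω (.add x y z) s 1 (s.setReg x (s.reg y + s.reg z))
  | sub (s : MState) (x y z : ℕ) :
      Exec ω (.sub x y z) s 1 (s.setReg x (s.reg y - s.reg z))
  | load (s : MState) (x a : ℕ) (idx : List ℕ) :
      Exec ω (.load x a idx) s 1 (s.setReg x (s.mem a (idx.map s.reg)))
  | store (s : MState) (a : ℕ) (idx : List ℕ) (x : ℕ) :
      Exec ω (.store a idx x) s 1 (s.setMem a (idx.map s.reg) (s.reg x))
  | draw (s : MState) (x y z : ℕ) :
      Exec ω (.draw x y z) s 1 (s.setReg x (ω (s.reg y) (s.reg z)))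
  | rload (s : MState) (u a : ℕ) (idx : List ℕ) :
      Exec ω (.rload u a idx) s 1 (s.setRReg u (s.rmem a (idx.map s.reg)))
  | rstore (s : MState) (a : ℕ) (idx : List ℕ) (u : ℕ) :
      Exec ω (.rstore a idx u) s 1 (s.setRMem a (idx.map s.reg) (s.rreg u))
  | radd (s : MState) (u v w : ℕ) :
      Exec ω (.radd u v w) s 1 (s.setRReg u (s.rreg v + s.rreg w))
  | seq {c d : Cmd} {s s' s'' : MState} {t t' : ℕ} :
      Exec ω c s t s' → Exec ω d s' t' s'' → Exec ω (.seq c d) s (t + t') s''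
  | ifLt_true {x y : ℕ} {c d : Cmd} {s s' : MState} {t : ℕ} :
      s.reg x < s.reg y → Exec ω c s t s' → Exec ω (.ifLt x y c d) s (t + 1) s'
  | ifLt_false {x y : ℕ} {c d : Cmd} {s s' : MState} {t : ℕ} :
      ¬ s.reg x < s.reg y → Exec ω d s t s' → Exec ω (.ifLt x y c d) s (t + 1) s'
  | ifRLt_true {u v : ℕ} {c d : Cmd} {s s' : MState} {t : ℕ} :
      s.rreg u < s.rreg v → Exec ω c s t s' → Exec ω (.ifRLt u v c d) s (t + 1) s'
  | ifRLt_false {u v : ℕ} {c d : Cmd} {s s' : MState} {t : ℕ} :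
      ¬ s.rreg u < s.rreg v → Exec ω d s t s' → Exec ω (.ifRLt u v c d) s (t + 1) s'
  | whileLt_true {x y : ℕ} {c : Cmd} {s s' s'' : MState} {t t' : ℕ} :
      s.reg x < s.reg y → Exec ω c s t s' → Exec ω (.whileLt x y c) s' t' s'' →
      Exec ω (.whileLt x y c) s (t + t' + 1) s''
  | whileLt_false {x y : ℕ} {c : Cmd} {s : MState} :
      ¬ s.reg x < s.reg y → Exec ω (.whileLt x y c) s 1 s

/-! ### Input and output of programs -/

/-- `nbr` lists the neighbours of every vertex, without repetition and in any order. -/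
def IsAdjacencyList {n : ℕ} (G : SimpleGraph (Fin n)) (nbr : Fin n → List (Fin n)) : Prop :=
  ∀ v, (nbr v).Nodup ∧ ∀ u, u ∈ nbr v ↔ G.Adj v u

/-- The random source that holds the random numbers of `Minor-e`. -/
def drawSource {n r Λ : ℕ} (L : Draws n r Λ) (i v : ℕ) : ℕ :=
  if h : i < r ∧ v < n then (L ⟨i, h.1⟩ ⟨v, h.2⟩ : ℕ) else 0

/-- The `k`-th entry of the adjacency list of `v`, if there is one. -/
def nbrAt {n : ℕ} (nbr : Fin n → List (Fin n)) (v k : ℕ) : Option (Fin n) :=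
  if h : v < n then (nbr ⟨v, h⟩)[k]? else none

/-- The initial state. Integer registers `0, 1, 2, 3` hold `n`, `r`, `Λ` and `|Σ| = q`. Integer
array `0` holds the degrees (cell `[v]`) and integer array `1` the adjacency lists (cell `[v, k]`
is the `k`-th neighbour of `v`). Real array `0` holds `φ_v(x)` in cell `[v, x]`, and real array
`1` holds, in cell `[v, k, x, y]`, the value `ψ_{vu}(x, y)` for the `k`-th neighbour `u` of `v`.
Everything else is `0`. -/
def inputState {n q : ℕ} (M : MRF (Fin n) (Fin q)) (nbr : Fin n → List (Fin n)) (r Λ : ℕ) :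
    MState where
  reg
    | 0 => n
    | 1 => r
    | 2 => Λ
    | 3 => q
    | _ => 0
  rreg _ := 0
  mem
    | 0, [v] => if h : v < n then (nbr ⟨v, h⟩).length else 0
    | 1, [v, k] => ((nbrAt nbr v k).map Fin.val).getD 0
    | _, _ => 0
  rmem
    | 0, [v, x] => if h : v < n ∧ x < q then M.φ ⟨v, h.1⟩ ⟨x, h.2⟩ else 0
    | 1, [v, k, x, y] =>
        if h : v < n ∧ x < q ∧ y < q then
          ((nbrAt nbr v k).map fun u => M.ψ ⟨v, h.1⟩ u ⟨x, h.2.1⟩ ⟨y, h.2.2⟩).getD 0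
        else 0
    | _, _ => 0

/-- The final state `s` holds the assignment `x` in integer array `2`. -/
def Outputs {n q : ℕ} (s : MState) (x : Fin n → Fin q) : Prop :=
  ∀ v : Fin n, s.mem 2 [(v : ℕ)] = (x v : ℕ)

/-- The program `P` implements `Mode` with `Minor-e (G, r, Λ)`: on every input there is a choice
of roots, not depending on the random numbers, such that for all random numbers `P` halts and
puts out an assignment that `Mode` can produce from the edge set given by `Minor-e` for these
roots and these random numbers. -/
def ImplementsMode (P : Cmd) : Prop :=
  ∀ (n q r Λ : ℕ), 0 < n → 0 < q → 0 < Λ →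
  ∀ (M : MRF (Fin n) (Fin q)) (nbr : Fin n → List (Fin n)), IsAdjacencyList M.graph nbr →
    ∃ ρ : RootRule (Fin n), ∀ L : Draws n r Λ,
      ∃ (t : ℕ) (s : MState) (x : Fin n → Fin q),
        Exec (drawSource L) P (inputState M nbr r Λ) t s ∧ Outputs s x ∧
          M.IsModeOutput (minorE M.graph ρ r L) x

/-- The parameter `Λ = ⌈r (d* + 1) / ε⌉`. -/
noncomputable def lam {n q : ℕ} (M : MRF (Fin n) (Fin q)) (r : ℕ) (ε : ℝ) : ℕ :=
  ⌈(r : ℝ) * ((M.maxDeg : ℝ) + 1) / ε⌉₊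

/-! ### Reasoning about programs -/

/-! Approximation. On every component of `(V, E \ B)` the output is at least as good as `x*`, so
only edges of `B` can cause a loss: `H(x*) - H(x̂)` is at most the sum of `ψ_e(x*)` over `e ∈ B`
(`energy_sub_le`). Given the earlier rounds, the component of an edge, its root and its level are
fixed, and the edge is cut only if the draw of that root is the level modulo `Λ`. Each round thus
cuts it with probability at most `1/Λ`, and all rounds together with probability at most `r/Λ ≤ ε`
(`card_minorE_le`). Linearity of expectation finishes the argument.

Size of the components. In the style of Klein, Plotkin and Rao, two vertices of a component of the
output have distance below `15 r² Λ` in `G` (`ExcludesKrr.dist_lt`). Otherwise the component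
contains `r + 1` points that are pairwise far apart in `G`. Going back from the last round to the
first, each round supplies one left branch set, a ball around the root above the band of levels that
holds the component, and prolongs the right branch sets, which start at the far points, by paths
towards the root (`BandMinor.extend`). After `r` rounds this is a `K_{r,r}` minor. So a component
lies in a ball of `G` and has fewer than `max(2, d*) ^ (15 r² Λ)` vertices (`card_ball_lt`).

Running time. The program carries out the breadth-first searches and then tries all `q ^ m`
labelings of each component with `m` vertices. Correctness and step count are proved together
(`wp_mode`); as runs are unique, the bound holds for every run (`time_mode_le`). The size bound
gives (a). For (b), the hypothesis yields `d* ^ (15 r² Λ) ≤ √(log n)` for large `n`, so the time is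
`n · exp(O(√(log n)))`. Two cases escape this and are treated apart: `Λ = 1`, where `Λ` is not
bounded by a multiple of `d*/ε`, and `d* ≤ 1`, where `log d*` gives no control of `Λ`. In these
cases components have at most one and two vertices. -/

/-- A terminating run of a program is unique. -/
theorem Exec.deterministic {ω : ℕ → ℕ → ℕ} {c : Cmd} {s s' : MState} {t : ℕ}
    (h : Exec ω c s t s') : ∀ {t₂ : ℕ} {s₂ : MState}, Exec ω c s t₂ s₂ → t = t₂ ∧ s' = s₂ := by
  induction h with
  | seq _ _ ih1 ih2 =>
    intro t₂ s₂ h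
    cases h with
    | seq h1 h2 =>
      obtain ⟨rfl, rfl⟩ := ih1 h1
      obtain ⟨rfl, rfl⟩ := ih2 h2
      exact ⟨rfl, rfl⟩
  | ifLt_true hc _ ih =>
    intro t₂ s₂ h
    cases h with
    | ifLt_true _ h => obtain ⟨rfl, rfl⟩ := ih h; exact ⟨rfl, rfl⟩
    | ifLt_false hn _ => exact absurd hc hn
  | ifLt_false hc _ ih =>
    intro t₂ s₂ h
    cases h with
    | ifLt_true hn _ => exact absurd hn hc
    | ifLt_false _ h => obtain ⟨rfl, rfl⟩ := ih h; exact ⟨rfl, rfl⟩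
  | ifRLt_true hc _ ih =>
    intro t₂ s₂ h
    cases h with
    | ifRLt_true _ h => obtain ⟨rfl, rfl⟩ := ih h; exact ⟨rfl, rfl⟩
    | ifRLt_false hn _ => exact absurd hc hn
  | ifRLt_false hc _ ih =>
    intro t₂ s₂ h
    cases h with
    | ifRLt_true hn _ => exact absurd hn hc
    | ifRLt_false _ h => obtain ⟨rfl, rfl⟩ := ih h; exact ⟨rfl, rfl⟩
  | whileLt_true hc _ _ ih1 ih2 =>
    intro t₂ s₂ h
    cases h with
    | whileLt_true _ h1 h2 =>
      obtain ⟨rfl, rfl⟩ := ih1 h1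
      obtain ⟨rfl, rfl⟩ := ih2 h2
      exact ⟨rfl, rfl⟩
    | whileLt_false hn => exact absurd hc hn
  | whileLt_false hc =>
    intro t₂ s₂ h
    cases h with
    | whileLt_true hn _ _ => exact absurd hn hc
    | whileLt_false _ => exact ⟨rfl, rfl⟩
  | _ => intro t₂ s₂ h; cases h; exact ⟨rfl, rfl⟩

/-- The program `c`, started in `s`, halts, and its step count and final state satisfy `Q`. -/
def Wp (ω : ℕ → ℕ → ℕ) (c : Cmd) (s : MState) (Q : ℕ → MState → Prop) : Prop :=
  ∃ t s', Exec ω c s t s' ∧ Q t s'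

section Wp

variable {ω : ℕ → ℕ → ℕ} {Q : ℕ → MState → Prop} {s : MState}

theorem Wp.mono {c : Cmd} {R : ℕ → MState → Prop} (h : Wp ω c s Q)
    (hQR : ∀ t s', Q t s' → R t s') : Wp ω c s R := by
  obtain ⟨t, s', he, hq⟩ := h
  exact ⟨t, s', he, hQR _ _ hq⟩

@[simp] theorem wp_skip : Wp ω .skip s Q ↔ Q 1 s :=
  ⟨fun ⟨_, _, he, hq⟩ => by cases he; exact hq, fun h => ⟨_, _, .skip s, h⟩⟩

@[simp] theorem wp_set {x k : ℕ} : Wp ω (.set x k) s Q ↔ Q 1 (s.setReg x k) :=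
  ⟨fun ⟨_, _, he, hq⟩ => by cases he; exact hq, fun h => ⟨_, _, .set s x k, h⟩⟩

@[simp] theorem wp_add {x y z : ℕ} :
    Wp ω (.add x y z) s Q ↔ Q 1 (s.setReg x (s.reg y + s.reg z)) :=
  ⟨fun ⟨_, _, he, hq⟩ => by cases he; exact hq, fun h => ⟨_, _, .add s x y z, h⟩⟩

@[simp] theorem wp_sub {x y z : ℕ} :
    Wp ω (.sub x y z) s Q ↔ Q 1 (s.setReg x (s.reg y - s.reg z)) :=
  ⟨fun ⟨_, _, he, hq⟩ => by cases he; exact hq, fun h => ⟨_, _, .sub s x y z, h⟩⟩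

@[simp] theorem wp_load {x a : ℕ} {idx : List ℕ} :
    Wp ω (.load x a idx) s Q ↔ Q 1 (s.setReg x (s.mem a (idx.map s.reg))) :=
  ⟨fun ⟨_, _, he, hq⟩ => by cases he; exact hq, fun h => ⟨_, _, .load s x a idx, h⟩⟩

@[simp] theorem wp_store {x a : ℕ} {idx : List ℕ} :
    Wp ω (.store a idx x) s Q ↔ Q 1 (s.setMem a (idx.map s.reg) (s.reg x)) :=
  ⟨fun ⟨_, _, he, hq⟩ => by cases he; exact hq, fun h => ⟨_, _, .store s a idx x, h⟩⟩

@[simp] theorem wp_draw {x y z : ℕ} :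
    Wp ω (.draw x y z) s Q ↔ Q 1 (s.setReg x (ω (s.reg y) (s.reg z))) :=
  ⟨fun ⟨_, _, he, hq⟩ => by cases he; exact hq, fun h => ⟨_, _, .draw s x y z, h⟩⟩

@[simp] theorem wp_rload {u a : ℕ} {idx : List ℕ} :
    Wp ω (.rload u a idx) s Q ↔ Q 1 (s.setRReg u (s.rmem a (idx.map s.reg))) :=
  ⟨fun ⟨_, _, he, hq⟩ => by cases he; exact hq, fun h => ⟨_, _, .rload s u a idx, h⟩⟩


@[simp] theorem wp_radd {u v w : ℕ} :
    Wp ω (.radd u v w) s Q ↔ Q 1 (s.setRReg u (s.rreg v + s.rreg w)) :=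
  ⟨fun ⟨_, _, he, hq⟩ => by cases he; exact hq, fun h => ⟨_, _, .radd s u v w, h⟩⟩

@[simp] theorem wp_seq {c d : Cmd} :
    Wp ω (.seq c d) s Q ↔ Wp ω c s fun t s' => Wp ω d s' fun t' s'' => Q (t + t') s'' := by
  constructor
  · rintro ⟨_, _, he, hq⟩
    cases he with
    | seq h1 h2 => exact ⟨_, _, h1, _, _, h2, hq⟩
  · rintro ⟨_, _, h1, _, _, h2, hq⟩
    exact ⟨_, _, .seq h1 h2, hq⟩

@[simp] theorem wp_ifLt {x y : ℕ} {c d : Cmd} :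
    Wp ω (.ifLt x y c d) s Q ↔
      if s.reg x < s.reg y then Wp ω c s fun t s' => Q (t + 1) s'
      else Wp ω d s fun t s' => Q (t + 1) s' := by
  split_ifs with h
  · constructor
    · rintro ⟨_, _, he, hq⟩
      cases he with
      | ifLt_true _ he => exact ⟨_, _, he, hq⟩
      | ifLt_false hn _ => exact absurd h hn
    · rintro ⟨_, _, he, hq⟩
      exact ⟨_, _, .ifLt_true h he, hq⟩
  · constructor
    · rintro ⟨_, _, he, hq⟩
      cases he with
      | ifLt_true hn _ => exact absurd hn h
      | ifLt_false _ he => exact ⟨_, _, he, hq⟩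
    · rintro ⟨_, _, he, hq⟩
      exact ⟨_, _, .ifLt_false h he, hq⟩

open Classical in
@[simp] theorem wp_ifRLt {u v : ℕ} {c d : Cmd} :
    Wp ω (.ifRLt u v c d) s Q ↔
      if s.rreg u < s.rreg v then Wp ω c s fun t s' => Q (t + 1) s'
      else Wp ω d s fun t s' => Q (t + 1) s' := by
  split_ifs with h
  · constructor
    · rintro ⟨_, _, he, hq⟩
      cases he with
      | ifRLt_true _ he => exact ⟨_, _, he, hq⟩
      | ifRLt_false hn _ => exact absurd h hn
    · rintro ⟨_, _, he, hq⟩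
      exact ⟨_, _, .ifRLt_true h he, hq⟩
  · constructor
    · rintro ⟨_, _, he, hq⟩
      cases he with
      | ifRLt_true hn _ => exact absurd hn h
      | ifRLt_false _ he => exact ⟨_, _, he, hq⟩
    · rintro ⟨_, _, he, hq⟩
      exact ⟨_, _, .ifRLt_false h he, hq⟩

end Wp

namespace MState

variable (s : MState)

@[simp] theorem reg_setReg (x k y : ℕ) :
    (s.setReg x k).reg y = if y = x then k else s.reg y := by
  simp [setReg, Function.update_apply]

@[simp] theorem rreg_setReg (x k : ℕ) : (s.setReg x k).rreg = s.rreg := rfl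
@[simp] theorem mem_setReg (x k : ℕ) : (s.setReg x k).mem = s.mem := rfl
@[simp] theorem rmem_setReg (x k : ℕ) : (s.setReg x k).rmem = s.rmem := rfl

@[simp] theorem rreg_setRReg (x : ℕ) (k : ℝ) (y : ℕ) :
    (s.setRReg x k).rreg y = if y = x then k else s.rreg y := by
  simp [setRReg, Function.update_apply]
@[simp] theorem reg_setRReg (x : ℕ) (k : ℝ) : (s.setRReg x k).reg = s.reg := rfl
@[simp] theorem mem_setRReg (x : ℕ) (k : ℝ) : (s.setRReg x k).mem = s.mem := rfl

@[simp] theorem mem_setMem (a : ℕ) (i : List ℕ) (k b : ℕ) (j : List ℕ) :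
    (s.setMem a i k).mem b j = if b = a ∧ j = i then k else s.mem b j := by
  by_cases h : b = a
  · subst h; simp [setMem, Function.update_apply]
  · simp [setMem, h]
@[simp] theorem reg_setMem (a : ℕ) (i : List ℕ) (k : ℕ) : (s.setMem a i k).reg = s.reg := rfl

end MState

/-! ### Write sets of programs and the frame rule. -/

/-- `c` may write the integer register `x`. -/
def Cmd.wrReg (x : ℕ) : Cmd → Bool
  | .set y _ | .add y _ _ | .sub y _ _ | .load y _ _ | .draw y _ _ => x == y
  | .seq c d | .ifLt _ _ c d | .ifRLt _ _ c d => c.wrReg x || d.wrReg x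
  | .whileLt _ _ c => c.wrReg x
  | _ => false

/-- `c` may write the real register `x`. -/
def Cmd.wrRReg (x : ℕ) : Cmd → Bool
  | .rload y _ _ | .radd y _ _ => x == y
  | .seq c d | .ifLt _ _ c d | .ifRLt _ _ c d => c.wrRReg x || d.wrRReg x
  | .whileLt _ _ c => c.wrRReg x
  | _ => false

/-- `c` may write the integer array `a`. -/
def Cmd.wrMem (a : ℕ) : Cmd → Bool
  | .store b _ _ => a == b
  | .seq c d | .ifLt _ _ c d | .ifRLt _ _ c d => c.wrMem a || d.wrMem a
  | .whileLt _ _ c => c.wrMem a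
  | _ => false

/-- `c` may write the real array `a`. -/
def Cmd.wrRMem (a : ℕ) : Cmd → Bool
  | .rstore b _ _ => a == b
  | .seq c d | .ifLt _ _ c d | .ifRLt _ _ c d => c.wrRMem a || d.wrRMem a
  | .whileLt _ _ c => c.wrRMem a
  | _ => false

/-- `s'` agrees with `s` on everything that `c` cannot write. -/
structure Frame (c : Cmd) (s s' : MState) : Prop where
  reg : ∀ x, c.wrReg x = false → s'.reg x = s.reg x
  rreg : ∀ x, c.wrRReg x = false → s'.rreg x = s.rreg x
  mem : ∀ a, c.wrMem a = false → s'.mem a = s.mem a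
  rmem : ∀ a, c.wrRMem a = false → s'.rmem a = s.rmem a

theorem Frame.refl (c : Cmd) (s : MState) : Frame c s s :=
  ⟨fun _ _ => rfl, fun _ _ => rfl, fun _ _ => rfl, fun _ _ => rfl⟩

theorem Frame.trans {c : Cmd} {s s' s'' : MState} (h : Frame c s s') (h' : Frame c s' s'') :
    Frame c s s'' :=
  ⟨fun x hx => (h'.reg x hx).trans (h.reg x hx), fun x hx => (h'.rreg x hx).trans (h.rreg x hx),
    fun x hx => (h'.mem x hx).trans (h.mem x hx), fun x hx => (h'.rmem x hx).trans (h.rmem x hx)⟩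

/-- Agreement outside the writes of `c` gives agreement outside those of a larger program. -/
theorem Frame.weaken {c d : Cmd} {s s' : MState} (h : Frame c s s')
    (h1 : ∀ x, d.wrReg x = false → c.wrReg x = false)
    (h2 : ∀ x, d.wrRReg x = false → c.wrRReg x = false)
    (h3 : ∀ x, d.wrMem x = false → c.wrMem x = false)
    (h4 : ∀ x, d.wrRMem x = false → c.wrRMem x = false) : Frame d s s' :=
  ⟨fun x hx => h.reg x (h1 x hx), fun x hx => h.rreg x (h2 x hx),
    fun x hx => h.mem x (h3 x hx), fun x hx => h.rmem x (h4 x hx)⟩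

/-- Write sets are Booleans computed from the syntax, so for a concrete program the side conditions
hold by `rfl`. Loop invariants then need to mention only what the loop changes. -/
theorem Exec.frame {ω : ℕ → ℕ → ℕ} {c : Cmd} {s s' : MState} {t : ℕ} (h : Exec ω c s t s') :
    Frame c s s' := by
  induction h with
  | seq _ _ ih1 ih2 =>
    refine (Frame.weaken ih1 ?_ ?_ ?_ ?_).trans (Frame.weaken ih2 ?_ ?_ ?_ ?_) <;>
      simp +contextual [Cmd.wrReg, Cmd.wrRReg, Cmd.wrMem, Cmd.wrRMem]
  | ifLt_true _ _ ih | ifLt_false _ _ ih | ifRLt_true _ _ ih | ifRLt_false _ _ ih =>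
    refine Frame.weaken ih ?_ ?_ ?_ ?_ <;>
      simp +contextual [Cmd.wrReg, Cmd.wrRReg, Cmd.wrMem, Cmd.wrRMem]
  | whileLt_true _ _ _ ih1 ih2 =>
    refine (Frame.weaken ih1 ?_ ?_ ?_ ?_).trans ih2 <;>
      simp [Cmd.wrReg, Cmd.wrRReg, Cmd.wrMem, Cmd.wrRMem]
  | whileLt_false => exact Frame.refl _ _
  | _ =>
    constructor <;> intro x hx <;>
    simp_all [Cmd.wrReg, Cmd.wrRReg, Cmd.wrMem, Cmd.wrRMem, MState.setReg, MState.setRReg,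
      MState.setMem, MState.setRMem]

theorem Wp.withFrame {ω : ℕ → ℕ → ℕ} {c : Cmd} {s : MState} {Q : ℕ → MState → Prop}
    (h : Wp ω c s Q) : Wp ω c s fun t s' => Q t s' ∧ Frame c s s' := by
  obtain ⟨t, s', he, hq⟩ := h
  exact ⟨t, s', he, hq, he.frame⟩

/-! ### Rules for loops. -/

/-- The rule for loops: the invariant `I` records the time used so far. -/
theorem Wp.whileLt {ω : ℕ → ℕ → ℕ} {c : Cmd} {x y : ℕ} (I : ℕ → MState → Prop)
    (μ : MState → ℕ)
    (step : ∀ t s, I t s → s.reg x < s.reg y →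
      Wp ω c s fun t' s' => I (t + t' + 1) s' ∧ μ s' < μ s)
    {t₀ : ℕ} {s : MState} (h0 : I t₀ s) :
    Wp ω (.whileLt x y c) s fun t s' =>
      ∃ t₁, t₀ + t = t₁ + 1 ∧ I t₁ s' ∧ ¬ s'.reg x < s'.reg y := by
  induction hm : μ s using Nat.strong_induction_on generalizing s t₀ with
  | _ m ih =>
    by_cases hc : s.reg x < s.reg y
    · obtain ⟨t', s', he, hI, hlt⟩ := step _ _ h0 hc
      obtain ⟨t'', s'', he', t₁, ht, hI', hn⟩ := ih _ (hm ▸ hlt) hI rfl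
      exact ⟨_, _, .whileLt_true hc he he', t₁, by omega, hI', hn⟩
    · exact ⟨_, _, .whileLt_false hc, t₀, rfl, h0, hc⟩

/-- `for x = 0, …, y - 1 do c`; register `4` holds the constant `1`. -/
def Cmd.forLt (x y : ℕ) (c : Cmd) : Cmd :=
  .seq (.set x 0) (.whileLt x y (.seq c (.add x x 4)))

@[simp] theorem Cmd.wrReg_forLt (x y z : ℕ) (c : Cmd) :
    (Cmd.forLt x y c).wrReg z = (z == x || c.wrReg z) := by
  simp only [Cmd.forLt, Cmd.wrReg]
  cases z == x <;> simp

@[simp] theorem Cmd.wrRReg_forLt (x y z : ℕ) (c : Cmd) :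
    (Cmd.forLt x y c).wrRReg z = c.wrRReg z := by
  simp [Cmd.forLt, Cmd.wrRReg]

@[simp] theorem Cmd.wrMem_forLt (x y z : ℕ) (c : Cmd) :
    (Cmd.forLt x y c).wrMem z = c.wrMem z := by
  simp [Cmd.forLt, Cmd.wrMem]

@[simp] theorem Cmd.wrRMem_forLt (x y z : ℕ) (c : Cmd) :
    (Cmd.forLt x y c).wrRMem z = c.wrRMem z := by
  simp [Cmd.forLt, Cmd.wrRMem]

/-- The rule for `for` loops whose invariant records the number of finished iterations and the
time used so far. -/
theorem Wp.forLt_acc {ω : ℕ → ℕ → ℕ} {c : Cmd} {x y N : ℕ} {s : MState}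
    (I : ℕ → ℕ → MState → Prop)
    (hw : (c.wrReg x || c.wrReg y || c.wrReg 4) = false) (hxy : (x == y || x == 4) = false)
    (hs : s.reg y = N) (h1 : s.reg 4 = 1) (h0 : I 0 0 (s.setReg x 0))
    (step : ∀ k < N, ∀ t s', Frame (Cmd.forLt x y c) s s' → s'.reg x = k → I k t s' →
      Wp ω c s' fun t' s'' => I (k + 1) (t + t' + 2) (s''.setReg x (k + 1))) :
    Wp ω (Cmd.forLt x y c) s fun t s' => ∃ t₁, t = t₁ + 2 ∧ I N t₁ s' := by
  simp only [Bool.or_eq_false_iff, beq_eq_false_iff_ne] at hw hxy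
  obtain ⟨⟨hwx, hwy⟩, hw4⟩ := hw
  have hf0 : Frame (Cmd.forLt x y c) s (s.setReg x 0) :=
    ⟨fun z hz => by
      have : z ≠ x := fun h => by simp [h] at hz
      simp [this], fun _ _ => rfl, fun _ _ => rfl, fun _ _ => rfl⟩
  simp only [Cmd.forLt, wp_seq, wp_set]
  refine Wp.mono (Wp.whileLt (t₀ := 0)
    (fun t s' => Frame (Cmd.forLt x y c) s s' ∧ s'.reg x ≤ N ∧ I (s'.reg x) t s')
    (fun s' => N - s'.reg x) ?_ ⟨hf0, by simp, by simpa using h0⟩) ?_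
  · rintro t s' ⟨hf, hle, hI⟩ hlt
    have hy : s'.reg y = N := by
      rw [hf.reg y (by simpa [hwy] using hxy.1.symm), hs]
    have h4 : s'.reg 4 = 1 := by
      rw [hf.reg 4 (by simpa [hw4] using hxy.2.symm), h1]
    rw [hy] at hlt
    refine wp_seq.2 (Wp.mono (step _ hlt t s' hf rfl hI).withFrame ?_)
    rintro t' s'' ⟨hI', hf'⟩
    have hx' : s''.reg x = s'.reg x := hf'.reg x hwx
    have h4' : s''.reg 4 = 1 := by rw [hf'.reg 4 hw4, h4]
    rw [wp_add, hx', h4']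
    refine ⟨⟨hf.trans ⟨fun z hz => ?_, fun z hz => ?_, fun z hz => ?_, fun z hz => ?_⟩, ?_, ?_⟩, ?_⟩
    · simp only [Cmd.wrReg_forLt, Bool.or_eq_false_iff, beq_eq_false_iff_ne] at hz
      simp [hz.1, hf'.reg z hz.2]
    · exact hf'.rreg z (by simpa using hz)
    · exact hf'.mem z (by simpa using hz)
    · exact hf'.rmem z (by simpa using hz)
    · simpa using hlt
    · simpa [add_assoc] using hI'
    · simp; omega
  · rintro t s' ⟨t₁, ht, ⟨hf, hle, hI⟩, hn⟩
    have hy : s'.reg y = N := by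
      rw [hf.reg y (by simpa [hwy] using hxy.1.symm), hs]
    have : s'.reg x = N := by omega
    exact ⟨t₁, by omega, this ▸ hI⟩

/-- The rule for `for` loops whose iterations take at most `τ` steps each. -/
theorem Wp.forLt {ω : ℕ → ℕ → ℕ} {c : Cmd} {x y N : ℕ} {s : MState} (τ : ℕ)
    (I : ℕ → MState → Prop)
    (hw : (c.wrReg x || c.wrReg y || c.wrReg 4) = false) (hxy : (x == y || x == 4) = false)
    (hs : s.reg y = N) (h1 : s.reg 4 = 1) (h0 : I 0 (s.setReg x 0))
    (step : ∀ k < N, ∀ s', Frame (Cmd.forLt x y c) s s' → s'.reg x = k → I k s' →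
      Wp ω c s' fun t' s'' => t' ≤ τ ∧ I (k + 1) (s''.setReg x (k + 1))) :
    Wp ω (Cmd.forLt x y c) s fun t s' => (t ≤ N * (τ + 2) + 2 ∧ I N s') ∧
      Frame (Cmd.forLt x y c) s s' := by
  -- Besides the body, an iteration pays one step for the test and one for the increment. The final
  -- `+ 2` is the initialization and the failing test.
  refine Wp.withFrame (Wp.mono (Wp.forLt_acc (fun k t s' => t ≤ k * (τ + 2) ∧ I k s')
    hw hxy hs h1 ⟨by simp, h0⟩ ?_) ?_)
  · rintro k hk t s' hf hx ⟨ht, hI⟩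
    refine Wp.mono (step k hk s' hf hx hI) ?_
    rintro t' s'' ⟨ht', hI'⟩
    exact ⟨by rw [add_mul]; omega, hI'⟩
  · rintro t s' ⟨t₁, rfl, ht, hI⟩
    exact ⟨by omega, hI⟩

/-! ### Distances and breadth-first search -/

namespace SimpleGraph

variable {V : Type*} {H : SimpleGraph V}

/-- A vertex other than the root has a neighbour one step closer to the root. -/
theorem Reachable.exists_adj_dist_succ {s x : V} (h : H.Reachable s x) (hne : H.dist s x ≠ 0) :
    ∃ y, H.Adj y x ∧ H.Reachable s y ∧ H.dist s y + 1 = H.dist s x := by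
  obtain ⟨p, hp⟩ := h.exists_walk_length_eq_dist
  have hnil : ¬ p.Nil := fun hn => hne (by rw [← hp]; exact Walk.length_eq_zero_iff.2 hn)
  refine ⟨p.penultimate, p.adj_penultimate hnil, p.dropLast.reachable, le_antisymm ?_ ?_⟩
  · have h1 := dist_le p.dropLast
    have h2 := Walk.length_dropLast_add_one hnil
    omega
  · have h1 := (Walk.reachable p.dropLast).dist_triangle_left (w := x)
    rwa [dist_eq_one_iff_adj.2 (p.adj_penultimate hnil)] at h1

theorem Reachable.dist_le_succ {s x y : V} (h : H.Reachable s x) (hxy : H.Adj x y) :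
    H.dist s y ≤ H.dist s x + 1 := by
  have h1 := h.dist_triangle_left (w := y)
  rwa [dist_eq_one_iff_adj.2 hxy] at h1

/-- The state of a breadth-first search from `s`: the vertices in `p` are finished, those in `w`
are waiting. -/
structure BfsInv (H : SimpleGraph V) (s : V) (p w : List V) : Prop where
  nodup : (p ++ w).Nodup
  start : s ∈ p ++ w
  reach : ∀ x ∈ p ++ w, H.Reachable s x
  sorted : (p ++ w).Pairwise fun x y => H.dist s x ≤ H.dist s y
  near : ∀ x ∈ w, ∀ y ∈ p ++ w, H.dist s y ≤ H.dist s x + 1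
  closed : ∀ x ∈ p, ∀ y, H.Adj x y → y ∈ p ++ w

namespace BfsInv

variable {s v u : V} {p w : List V}

theorem init (H : SimpleGraph V) (s : V) : BfsInv H s [] [s] where
  nodup := by simp
  start := by simp
  reach := by simp
  sorted := by simp
  near := by simp
  closed := by simp

theorem dist_le_of_mem (h : BfsInv H s p (v :: w)) {x : V} (hx : x ∈ v :: w) :
    H.dist s v ≤ H.dist s x := by
  rcases List.mem_cons.1 hx with rfl | hx
  · rfl
  · exact (List.pairwise_cons.1 (List.pairwise_append.1 h.sorted).2.1).1 x hx

/-- Induction on the distance: a predecessor of `x` is closer to `s` than the head `v`, hence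
already finished, because waiting vertices are at least as far as `v`; and finished vertices have
all their neighbours in the queue. -/
theorem mem_of_dist_le (h : BfsInv H s p (v :: w)) {x : V} (hx : H.Reachable s x)
    (hd : H.dist s x ≤ H.dist s v) : x ∈ p ++ v :: w := by
  induction hm : H.dist s x generalizing x with
  | zero =>
    have hsx : s = x := hx.dist_eq_zero_iff.1 hm
    exact hsx ▸ h.start
  | succ d ih =>
    obtain ⟨y, hyx, hy, hyd⟩ := hx.exists_adj_dist_succ (by omega)
    have hmem := ih hy (by omega) (by omega)
    rcases List.mem_append.1 hmem with hp | hw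
    · exact h.closed y hp x hyx
    · have := h.dist_le_of_mem hw
      omega

/-- If `u` were no farther than `v`, it would have been found already. This makes the labels of the
search true distances. -/
theorem dist_new (h : BfsInv H s p (v :: w)) (hvu : H.Adj v u) (hu : u ∉ p ++ v :: w) :
    H.dist s u = H.dist s v + 1 := by
  have hv : H.Reachable s v := h.reach v (by simp)
  refine le_antisymm (hv.dist_le_succ hvu) ?_
  by_contra hlt
  exact hu (h.mem_of_dist_le (hv.trans hvu.reachable) (by omega))

theorem push (h : BfsInv H s p (v :: w)) (hvu : H.Adj v u) (hu : u ∉ p ++ v :: w) :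
    BfsInv H s p (v :: (w ++ [u])) := by
  have hd := h.dist_new hvu hu
  have hv : H.Reachable s v := h.reach v (by simp)
  have e : p ++ v :: (w ++ [u]) = (p ++ v :: w) ++ [u] := by simp
  have hle : ∀ x ∈ p ++ v :: w, H.dist s x ≤ H.dist s u := fun x hx => by
    have := h.near v (by simp) x hx
    omega
  refine ⟨?_, ?_, ?_, ?_, ?_, ?_⟩
  · rw [e]
    exact List.nodup_append.2 ⟨h.nodup, by simp, fun a ha b hb hab => hu (by
      rw [List.mem_singleton.1 hb] at hab; exact hab ▸ ha)⟩
  · rw [e]; exact List.mem_append_left _ h.start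
  · rw [e]; intro x hx
    rcases List.mem_append.1 hx with hx | hx
    · exact h.reach x hx
    · rw [List.mem_singleton.1 hx]; exact hv.trans hvu.reachable
  · rw [e, List.pairwise_append]
    refine ⟨h.sorted, by simp, fun x hx y hy => ?_⟩
    rw [List.mem_singleton.1 hy]; exact hle x hx
  · rw [e]
    have key : ∀ x ∈ v :: (w ++ [u]), H.dist s v ≤ H.dist s x := by
      intro x hx
      rw [← List.cons_append] at hx
      rcases List.mem_append.1 hx with hx | hx
      · exact h.dist_le_of_mem hx
      · rw [List.mem_singleton.1 hx]; omega
    intro x hx y hy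
    have h1 := key x hx
    rcases List.mem_append.1 hy with hy | hy
    · rw [← List.cons_append] at hx
      rcases List.mem_append.1 hx with hx | hx
      · exact h.near x hx y hy
      · rw [List.mem_singleton.1 hx]; have := hle y hy; omega
    · rw [List.mem_singleton.1 hy]; omega
  · rw [e]; intro x hx y hxy
    exact List.mem_append_left _ (h.closed x hx y hxy)

theorem pop (h : BfsInv H s p (v :: w)) (hv : ∀ u, H.Adj v u → u ∈ p ++ v :: w) :
    BfsInv H s (p ++ [v]) w := by
  have e : p ++ [v] ++ w = p ++ v :: w := by simp
  refine ⟨e ▸ h.nodup, e ▸ h.start, e ▸ h.reach, e ▸ h.sorted, ?_, ?_⟩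
  · rw [e]; exact fun x hx => h.near x (List.mem_cons_of_mem _ hx)
  · rw [e]; intro x hx y hxy
    rcases List.mem_append.1 hx with hx | hx
    · exact h.closed x hx y hxy
    · rw [List.mem_singleton.1 hx] at hxy; exact hv y hxy

/-- With an empty queue, `p` contains `s` and is closed under adjacency. -/
theorem mem_iff (h : BfsInv H s p []) (x : V) : x ∈ p ↔ H.Reachable s x := by
  refine ⟨fun hx => h.reach x (by simpa using hx), fun ⟨q⟩ => ?_⟩
  have : ∀ {a b : V} (_ : H.Walk a b), a ∈ p → b ∈ p := by
    intro a b q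
    induction q with
    | nil => exact id
    | cons hab _ ih => exact fun ha => ih (by simpa using h.closed _ ha _ hab)
  exact this q (by simpa using h.start)

end BfsInv

/-! ### Canonical roots of components. -/

/-- The least vertex of the connected component of `v`. -/
noncomputable def rootOf {n : ℕ} (H : SimpleGraph (Fin n)) (v : Fin n) : Fin n :=
  open Classical in
  (Finset.univ.filter fun u => H.Reachable v u).min' ⟨v, by simp⟩

section rootOf

variable {n : ℕ} (H : SimpleGraph (Fin n)) (u v : Fin n)

theorem reachable_rootOf : H.Reachable v (H.rootOf v) := by
  classical
  have := Finset.min'_mem (Finset.univ.filter fun u => H.Reachable v u) ⟨v, by simp⟩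
  exact (Finset.mem_filter.1 this).2

variable {H u v}

theorem Reachable.rootOf_le (h : H.Reachable v u) : H.rootOf v ≤ u := by
  classical
  exact Finset.min'_le _ _ (by simpa using h)

theorem Reachable.rootOf_eq (h : H.Reachable v u) : H.rootOf v = H.rootOf u :=
  le_antisymm (h.trans (H.reachable_rootOf u)).rootOf_le
    (h.symm.trans (H.reachable_rootOf v)).rootOf_le

/-- Lets a component be named by a vertex, which the program can store, instead of an element of the
quotient type. -/
theorem rootOf_eq_iff : H.rootOf v = H.rootOf u ↔ H.Reachable v u :=
  ⟨fun h => (H.reachable_rootOf v).trans (h ▸ (H.reachable_rootOf u).symm), Reachable.rootOf_eq⟩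

theorem rootOf_rootOf : H.rootOf (H.rootOf v) = H.rootOf v :=
  ((H.reachable_rootOf v).rootOf_eq).symm

end rootOf

end SimpleGraph

/-- The rule that picks the least vertex of every component. -/
noncomputable def minRule (n : ℕ) : RootRule (Fin n) where
  pick _ H c := H.rootOf c.out
  pick_mem i H c := by
    have h : H.connectedComponentMk c.out = c := Quot.out_eq c
    rw [SimpleGraph.ConnectedComponent.mem_supp_iff, ← h]
    rw [SimpleGraph.ConnectedComponent.eq, h]
    exact (H.reachable_rootOf _).symm

theorem minRule_pick {n : ℕ} (i : ℕ) (H : SimpleGraph (Fin n)) (v : Fin n) :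
    (minRule n).pick i H (H.connectedComponentMk v) = H.rootOf v := by
  have h : H.connectedComponentMk (H.connectedComponentMk v).out = H.connectedComponentMk v :=
    Quot.out_eq _
  exact (SimpleGraph.ConnectedComponent.eq.1 h).rootOf_eq

/-! ### The breadth-first search program -/

/-- The number `(a - d) mod Λ`, computed by counting down from `a < Λ`. -/
def countdown (Λ a : ℕ) : ℕ → ℕ
  | 0 => a
  | d + 1 => if countdown Λ a d = 0 then Λ - 1 else countdown Λ a d - 1

theorem countdown_lt {Λ a : ℕ} (h : a < Λ) (d : ℕ) : countdown Λ a d < Λ := by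
  induction d with
  | zero => exact h
  | succ d ih => simp only [countdown]; split_ifs <;> omega

/-- The counter is congruent to `a - d` modulo `Λ` and lies in `[0, Λ)`. It vanishes exactly at the
levels to be cut, which lets the machine recognize them without a division. -/
theorem countdown_eq_zero_iff {Λ a : ℕ} (h : a < Λ) (d : ℕ) :
    countdown Λ a d = 0 ↔ ∃ k, d = k * Λ + a := by
  have key : ∃ m : ℤ, (countdown Λ a d : ℤ) = a - d + m * Λ := by
    induction d with
    | zero => exact ⟨0, by simp [countdown]⟩
    | succ d ih =>
      obtain ⟨m, hm⟩ := ih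
      simp only [countdown]
      split_ifs with h0
      · refine ⟨m + 1, ?_⟩
        rw [h0] at hm
        push_cast [Nat.cast_sub (show 1 ≤ Λ by omega)] at hm ⊢
        linarith
      · refine ⟨m, ?_⟩
        push_cast [Nat.cast_sub (show 1 ≤ countdown Λ a d by omega)]
        linarith
  have hlt := countdown_lt h d
  obtain ⟨m, hm⟩ := key
  constructor
  · intro h0
    rw [h0] at hm
    have hm' : (d : ℤ) = m * Λ + a := by push_cast at hm; linarith
    -- A negative `m` would make `d = m * Λ + a` negative, since `a < Λ`.
    have hm0 : 0 ≤ m := by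
      by_contra hneg
      have : m * (Λ : ℤ) ≤ (-1) * Λ :=
        mul_le_mul_of_nonneg_right (by omega) (by positivity)
      omega
    exact ⟨m.toNat, by zify; rw [Int.toNat_of_nonneg hm0]; exact hm'⟩
  · rintro ⟨k, rfl⟩
    have h1 : (countdown Λ a (k * Λ + a) : ℤ) = (m - k) * Λ := by
      rw [hm]; push_cast; ring
    have hdvd : (Λ : ℤ) ∣ (countdown Λ a (k * Λ + a) : ℤ) := ⟨m - k, by rw [h1]; ring⟩
    exact Nat.eq_zero_of_dvd_of_lt (Int.natCast_dvd_natCast.1 hdvd) hlt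

namespace Prog

/-- Treats the neighbour number `[13]` of the vertex `[11]` in a breadth-first search. -/
def visitNbr : Cmd :=
  .seq (.load 14 1 [11, 13]) <| .seq (.load 15 7 [6, 11, 14]) <|
  .ifLt 15 4
    (.seq (.load 15 3 [14]) <|
      .ifLt 15 4
        (.seq (.store 3 [14] 4) <| .seq (.store 4 [10] 14) <| .seq (.add 10 10 4) <|
          .seq (.store 5 [14] 16) (.store 6 [14] 17))
        .skip)
    .skip

/-- Treats the next vertex of the queue. -/
def bfsStep : Cmd :=
  .seq (.load 11 4 [9]) <| .seq (.add 9 9 4) <| .seq (.load 12 0 [11]) <|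
  .seq (.load 16 5 [11]) <| .seq (.add 16 16 4) <| .seq (.load 17 6 [11]) <|
  .seq (.ifLt 17 4 (.sub 17 2 4) (.sub 17 17 4)) <|
  .forLt 13 12 visitNbr

/-- Searches the component with root `[8]`, unless `[8]` has been visited. -/
def bfsRoot : Cmd :=
  .seq (.load 15 3 [8]) <| .seq (.store 8 [8] 10) <|
  .seq (.ifLt 15 4
    (.seq (.store 3 [8] 4) <| .seq (.store 4 [10] 8) <| .seq (.add 10 10 4) <|
      .seq (.store 5 [8] 5) <| .seq (.draw 15 6 8) <| .seq (.store 6 [8] 15) <|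
      .whileLt 9 10 bfsStep)
    .skip) <|
  .store 9 [8] 10

/-- Searches all components of the current graph. -/
def bfsAll : Cmd :=
  .seq (.forLt 8 0 (.store 3 [8] 5)) <| .seq (.set 9 0) <| .seq (.set 10 0) <|
  .forLt 8 0 bfsRoot

end Prog

/-- The arrays `0` and `1` hold adjacency lists. -/
structure HoldsGraph {n : ℕ} (nbr : Fin n → List (Fin n)) (s : MState) : Prop where
  deg : ∀ v : Fin n, s.mem 0 [(v : ℕ)] = (nbr v).length
  adj : ∀ (v : Fin n) (k : ℕ) (u : Fin n), (nbr v)[k]? = some u → s.mem 1 [(v : ℕ), k] = u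

open Classical in
/-- Array `7` marks the edges of `G` that are not in `H`. -/
def HoldsCut {n : ℕ} (G H : SimpleGraph (Fin n)) (i : ℕ) (s : MState) : Prop :=
  ∀ v u, G.Adj v u → s.mem 7 [i, (v : ℕ), (u : ℕ)] = if H.Adj v u then 0 else 1

open Classical in
/-- The queue of the search consists of the vertices in `l`; the search labels are `lv` and
`cn`. -/
structure HoldsQueue {n : ℕ} (lv cn : Fin n → ℕ) (l : List (Fin n)) (s : MState) : Prop where
  tail : s.reg 10 = l.length
  queue : ∀ (j : ℕ) (x : Fin n), l[j]? = some x → s.mem 4 [j] = x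
  vis : ∀ x : Fin n, s.mem 3 [(x : ℕ)] = if x ∈ l then 1 else 0
  lev : ∀ x ∈ l, s.mem 5 [(x : ℕ)] = lv x
  cnt : ∀ x ∈ l, s.mem 6 [(x : ℕ)] = cn x

/-- The registers that stay fixed during the search in round `i`. -/
structure HoldsConsts (n Λ i : ℕ) (s : MState) : Prop where
  n : s.reg 0 = n
  lam : s.reg 2 = Λ
  one : s.reg 4 = 1
  zero : s.reg 5 = 0
  round : s.reg 6 = i

theorem HoldsGraph.congr {n : ℕ} {nbr : Fin n → List (Fin n)} {s s' : MState}
    (h : HoldsGraph nbr s) (h0 : s'.mem 0 = s.mem 0) (h1 : s'.mem 1 = s.mem 1) :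
    HoldsGraph nbr s' :=
  ⟨fun v => h0 ▸ h.deg v, fun v k u hk => h1 ▸ h.adj v k u hk⟩

theorem HoldsCut.congr {n : ℕ} {G H : SimpleGraph (Fin n)} {i : ℕ} {s s' : MState}
    (h : HoldsCut G H i s) (h7 : s'.mem 7 = s.mem 7) : HoldsCut G H i s' :=
  fun v u hvu => h7 ▸ h v u hvu

theorem HoldsConsts.congr {n Λ i : ℕ} {s s' : MState} (h : HoldsConsts n Λ i s)
    (hr : ∀ x, (x = 0 ∨ x = 2 ∨ x = 4 ∨ x = 5 ∨ x = 6) → s'.reg x = s.reg x) :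
    HoldsConsts n Λ i s' :=
  ⟨(hr 0 (by simp)).trans h.n, (hr 2 (by simp)).trans h.lam, (hr 4 (by simp)).trans h.one,
    (hr 5 (by simp)).trans h.zero, (hr 6 (by simp)).trans h.round⟩

theorem HoldsQueue.congr {n : ℕ} {lv cn : Fin n → ℕ} {l : List (Fin n)} {s s' : MState}
    (h : HoldsQueue lv cn l s) (hr : s'.reg 10 = s.reg 10)
    (hm : ∀ a, (a = 3 ∨ a = 4 ∨ a = 5 ∨ a = 6) → s'.mem a = s.mem a) :
    HoldsQueue lv cn l s' :=
  ⟨hr ▸ h.tail, (hm 4 (by simp)) ▸ h.queue, (hm 3 (by simp)) ▸ h.vis, (hm 5 (by simp)) ▸ h.lev,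
    (hm 6 (by simp)) ▸ h.cnt⟩

theorem HoldsQueue.push {n : ℕ} {lv cn : Fin n → ℕ} {l : List (Fin n)} {s s' : MState}
    (h : HoldsQueue lv cn l s) (u : Fin n) (h10 : s'.reg 10 = s.reg 10 + 1)
    (h3 : ∀ x, s'.mem 3 [x] = if x = (u : ℕ) then 1 else s.mem 3 [x])
    (h4 : ∀ x, s'.mem 4 [x] = if x = s.reg 10 then (u : ℕ) else s.mem 4 [x])
    (h5 : ∀ x, s'.mem 5 [x] = if x = (u : ℕ) then lv u else s.mem 5 [x])
    (h6 : ∀ x, s'.mem 6 [x] = if x = (u : ℕ) then cn u else s.mem 6 [x]) :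
    HoldsQueue lv cn (l ++ [u]) s' := by
  refine ⟨by simp [h10, h.tail], fun j x hj => ?_, fun x => ?_, fun x hx => ?_, fun x hx => ?_⟩
  · rw [h4, h.tail]
    rw [List.getElem?_append] at hj
    split_ifs with hjl
    · simp [hjl] at hj; rw [hj]
    · split_ifs at hj with hlt
      · exact h.queue j x hj
      · rw [List.getElem?_eq_none (by simp; omega)] at hj; cases hj
  · rw [h3]
    by_cases hx : x = u
    · simp [hx]
    · simp [hx, Fin.val_inj, h.vis]
  · rw [h5]
    by_cases hxu : x = u
    · simp [hxu]
    · simp only [Fin.val_inj, hxu, if_false]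
      exact h.lev x (by simpa [hxu] using hx)
  · rw [h6]
    by_cases hxu : x = u
    · simp [hxu]
    · simp only [Fin.val_inj, hxu, if_false]
      exact h.cnt x (by simpa [hxu] using hx)

section Search

variable {n Λ i : ℕ} {ω : ℕ → ℕ → ℕ} {G H : SimpleGraph (Fin n)} {nbr : Fin n → List (Fin n)}

open SimpleGraph Prog

/-- The labels that the search gives to the vertices: distance from the root, and the number
counted down from the draw of the root. -/
noncomputable def levelOf (H : SimpleGraph (Fin n)) (v : Fin n) : ℕ := H.dist (H.rootOf v) v

noncomputable def counterOf (Λ : ℕ) (a : ℕ → ℕ) (H : SimpleGraph (Fin n)) (v : Fin n) : ℕ :=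
  countdown Λ (a (H.rootOf v)) (levelOf H v)

/-- The vertices in `l` come from components searched earlier. They have other roots, so no
neighbour of `v` in `H` is among them, and for such a neighbour the mark "visited" means "found in
the present search". -/
theorem wp_visitNbrs (hG : IsAdjacencyList G nbr) (hHG : H ≤ G) {r v : Fin n}
    {l p w : List (Fin n)} {s : MState} (hs : HoldsConsts n Λ i s) (hgr : HoldsGraph nbr s)
    (hcut : HoldsCut G H i s) (hinv : BfsInv H r p (v :: w)) (hr : H.rootOf r = r)
    (hl : ∀ x ∈ l, H.rootOf x ≠ r)
    (hq : HoldsQueue (levelOf H) (counterOf Λ (ω i) H) (l ++ (p ++ v :: w)) s)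
    (h11 : s.reg 11 = v) (h12 : s.reg 12 = (nbr v).length)
    (h16 : s.reg 16 = levelOf H v + 1)
    (h17 : s.reg 17 = countdown Λ (ω i r) (levelOf H v + 1)) :
    Wp ω (.forLt 13 12 visitNbr) s fun t s' =>
      (t ≤ (nbr v).length * 12 + 2 ∧ ∃ w', BfsInv H r p (v :: w') ∧
        HoldsQueue (levelOf H) (counterOf Λ (ω i) H) (l ++ (p ++ v :: w')) s' ∧
        ∀ u, H.Adj v u → u ∈ p ++ v :: w') ∧ Frame (.forLt 13 12 visitNbr) s s' := by
  refine Wp.mono (Wp.forLt 10 (fun k s' => ∃ w', BfsInv H r p (v :: w') ∧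
    HoldsQueue (levelOf H) (counterOf Λ (ω i) H) (l ++ (p ++ v :: w')) s' ∧
    ∀ j < k, ∀ u, (nbr v)[j]? = some u → H.Adj v u → u ∈ p ++ v :: w') rfl rfl h12 hs.one ?_ ?_) ?_
  · exact ⟨w, hinv, hq.congr (by simp) (by simp), by simp⟩
  · rintro k hk s1 hf h13 ⟨w', hinv', hq', hdone⟩
    have h11' : s1.reg 11 = v := (hf.reg 11 rfl).trans h11
    have hs1 : HoldsConsts n Λ i s1 := hs.congr fun x hx => hf.reg x (by
      rcases hx with rfl | rfl | rfl | rfl | rfl <;> rfl)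
    have h16' : s1.reg 16 = levelOf H v + 1 := (hf.reg 16 rfl).trans h16
    have h17' := (hf.reg 17 rfl).trans h17
    obtain ⟨u, hu⟩ : ∃ u, (nbr v)[k]? = some u := ⟨_, List.getElem?_eq_getElem hk⟩
    have hGvu : G.Adj v u := ((hG v).2 u).1 (List.mem_of_getElem? hu)
    have hm1 : s1.mem 1 [(v : ℕ), k] = u := by
      rw [hf.mem 1 rfl]; exact hgr.adj v k u hu
    have hm7 := hcut v u hGvu
    rw [← hf.mem 7 rfl] at hm7
    have hvis := hq'.vis u
    have hnext : ∀ w'', (∀ x ∈ p ++ v :: w', x ∈ p ++ v :: w'') →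
        (H.Adj v u → u ∈ p ++ v :: w'') →
        ∀ j < k + 1, ∀ u, (nbr v)[j]? = some u → H.Adj v u → u ∈ p ++ v :: w'' := by
      intro w'' hsub huw j hj x hx hvx
      rcases Nat.lt_succ_iff_lt_or_eq.1 hj with hj | rfl
      · exact hsub _ (hdone j hj x hx hvx)
      · rw [hu] at hx; cases hx; exact huw hvx
    simp only [visitNbr, wp_seq, wp_load, wp_ifLt, List.map, MState.reg_setReg, MState.mem_setReg,
      h11', h13, hm1, hs1.round, hm7, hs1.one, hvis, Nat.reduceEqDiff, if_true, if_false,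
      wp_store, wp_add, wp_skip]
    by_cases hvu : H.Adj v u
    · have hrv : H.Reachable r v := hinv'.reach v (by simp)
      have hru : H.Reachable r u := hrv.trans hvu.reachable
      have huroot : H.rootOf u = r := by rw [← hru.rootOf_eq, hr]
      have hvroot : H.rootOf v = r := by rw [← hrv.rootOf_eq, hr]
      by_cases hul : u ∈ l ++ (p ++ v :: w')
      · simp only [hvu, hul, if_true, if_false, zero_lt_one, lt_irrefl]
        have hup : u ∈ p ++ v :: w' := by
          rcases List.mem_append.1 hul with h | h
          · exact absurd huroot (hl u h)
          · exact h
        exact ⟨by norm_num, w', hinv', hq'.congr (by simp) (by simp),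
          hnext w' (fun _ => id) (fun _ => hup)⟩
      · simp only [hvu, hul, if_true, if_false, zero_lt_one]
        have hup : u ∉ p ++ v :: w' := fun h => hul (List.mem_append_right _ h)
        have hlevu : levelOf H u = levelOf H v + 1 := by
          simp only [levelOf, huroot, hvroot]
          exact hinv'.dist_new hvu hup
        have hcnt : counterOf Λ (ω i) H u = countdown Λ (ω i r) (levelOf H v + 1) := by
          simp only [counterOf, huroot, hlevu]
        refine ⟨by norm_num, w' ++ [u], hinv'.push hvu hup, ?_,
          hnext _ (fun x hx => ?_) (fun _ => by simp)⟩
        · have e : l ++ (p ++ v :: (w' ++ [u])) = (l ++ (p ++ v :: w')) ++ [u] := by simp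
          rw [e]
          refine hq'.push u ?_ ?_ ?_ ?_ ?_
          · simp [hs1.one]
          · intro x; simp [hs1.one]
          · intro x; simp
          · intro x; simp [hlevu, h16']
          · intro x; simp [hcnt, h17']
        · simp only [List.mem_append, List.mem_cons] at hx ⊢
          tauto
    · simp only [hvu, if_false, lt_irrefl]
      exact ⟨by norm_num, w', hinv', hq'.congr (by simp) (by simp),
        hnext w' (fun _ => id) (fun h => absurd h hvu)⟩
  · rintro t s' ⟨⟨ht, w', hinv', hq', hdone⟩, hf⟩
    refine ⟨⟨ht, w', hinv', hq', fun u hvu => ?_⟩, hf⟩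
    obtain ⟨j, hj, hju⟩ := List.getElem_of_mem (((hG v).2 u).2 (hHG hvu))
    exact hdone j hj u (hju ▸ List.getElem?_eq_getElem hj) hvu

end Search

section Search

variable {n Λ i D : ℕ} {ω : ℕ → ℕ → ℕ} {G H : SimpleGraph (Fin n)} {nbr : Fin n → List (Fin n)}

open SimpleGraph Prog

theorem wp_bfsStep (hG : IsAdjacencyList G nbr) (hHG : H ≤ G) (hD : ∀ v, (nbr v).length ≤ D)
    {r v : Fin n}
    {l p w : List (Fin n)} {s : MState} (hs : HoldsConsts n Λ i s) (hgr : HoldsGraph nbr s)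
    (hcut : HoldsCut G H i s) (hinv : BfsInv H r p (v :: w)) (hr : H.rootOf r = r)
    (hl : ∀ x ∈ l, H.rootOf x ≠ r)
    (hq : HoldsQueue (levelOf H) (counterOf Λ (ω i) H) (l ++ (p ++ v :: w)) s)
    (h9 : s.reg 9 = l.length + p.length) :
    Wp ω bfsStep s fun t s' =>
      (t ≤ 12 * D + 20 ∧ s'.reg 9 = l.length + p.length + 1 ∧ ∃ w', BfsInv H r (p ++ [v]) w' ∧
        HoldsQueue (levelOf H) (counterOf Λ (ω i) H) (l ++ (p ++ [v] ++ w')) s') ∧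
        Frame bfsStep s s' := by
  apply Wp.withFrame
  have hrv : H.Reachable r v := hinv.reach v (by simp)
  have hvroot : H.rootOf v = r := by rw [← hrv.rootOf_eq, hr]
  have hv : s.mem 4 [l.length + p.length] = v :=
    hq.queue _ _ (by rw [List.getElem?_append_right (by omega)]; simp)
  have hmem : v ∈ l ++ (p ++ v :: w) := by simp
  have hlev := hq.lev v hmem
  have hcnt := hq.cnt v hmem
  simp only [bfsStep, wp_seq, wp_load, wp_add, List.map, MState.reg_setReg, MState.mem_setReg,
    h9, hv, hgr.deg, Nat.reduceEqDiff, if_true, if_false, hs.one, hlev, hcnt, wp_ifLt, wp_sub,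
    hs.lam]
  have hfinal : ∀ s1, s1.reg 0 = s.reg 0 → s1.reg 2 = s.reg 2 → s1.reg 4 = s.reg 4 →
      s1.reg 5 = s.reg 5 → s1.reg 6 = s.reg 6 → s1.reg 10 = s.reg 10 → s1.mem = s.mem →
      s1.reg 9 = l.length + p.length + 1 → s1.reg 11 = (v : ℕ) → s1.reg 12 = (nbr v).length →
      s1.reg 16 = levelOf H v + 1 → s1.reg 17 = countdown Λ (ω i r) (levelOf H v + 1) →
      Wp ω (.forLt 13 12 visitNbr) s1 fun t s' =>
        t ≤ 12 * D + 2 ∧ s'.reg 9 = l.length + p.length + 1 ∧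
        ∃ w', BfsInv H r (p ++ [v]) w' ∧
        HoldsQueue (levelOf H) (counterOf Λ (ω i) H) (l ++ (p ++ [v] ++ w')) s' := by
    intro s1 e0 e2 e4 e5 e6 e10 em e9 e11 e12 e16 e17
    refine Wp.mono (wp_visitNbrs hG hHG (s := s1) (hs.congr ?_) (hgr.congr ?_ ?_)
      (hcut.congr ?_) hinv hr hl (hq.congr e10 ?_) e11 e12 e16 e17) ?_
    · rintro x (rfl | rfl | rfl | rfl | rfl) <;> assumption
    · rw [em]
    · rw [em]
    · rw [em]
    · intro a _; rw [em]
    · rintro t s' ⟨⟨ht, w', hinv', hq', hdone⟩, hf⟩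
      refine ⟨?_, (hf.reg 9 rfl).trans e9, w', hinv'.pop hdone, by simpa using hq'⟩
      have := hD v
      omega
  have hcd : counterOf Λ (ω i) H v = countdown Λ (ω i r) (levelOf H v) := by
    simp [counterOf, hvroot]
  split_ifs with h0
  · refine (hfinal _ ?_ ?_ ?_ ?_ ?_ ?_ ?_ ?_ ?_ ?_ ?_ ?_).mono
      fun t s' h => ⟨by omega, h.2⟩ <;> simp
    have h0' : countdown Λ (ω i r) (levelOf H v) = 0 := by rw [← hcd]; omega
    simp [countdown, h0']
  · refine (hfinal _ ?_ ?_ ?_ ?_ ?_ ?_ ?_ ?_ ?_ ?_ ?_ ?_).mono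
      fun t s' h => ⟨by omega, h.2⟩ <;> simp
    have h0' : countdown Λ (ω i r) (levelOf H v) ≠ 0 := by rw [← hcd]; omega
    simp [countdown, h0', hcd]

/-- The cells `[r]` of the arrays `8` and `9` delimit a segment of the list `l` that enumerates
the component of `H` with root `r`; the segment is empty if `r` is not a root. -/
def HoldsSegment (H : SimpleGraph (Fin n)) (l : List (Fin n)) (r : Fin n) (s : MState) : Prop :=
  ∃ b : ℕ, ∃ m : List (Fin n), m.Nodup ∧ (∀ x, x ∈ m ↔ H.rootOf x = r) ∧
    s.mem 8 [(r : ℕ)] = b ∧ s.mem 9 [(r : ℕ)] = b + m.length ∧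
    ∀ (j : ℕ) (x : Fin n), m[j]? = some x → l[b + j]? = some x

theorem HoldsSegment.extend {l l' : List (Fin n)} {r : Fin n} {s s' : MState}
    (h : HoldsSegment H l r s) (h8 : s'.mem 8 [(r : ℕ)] = s.mem 8 [(r : ℕ)])
    (h9 : s'.mem 9 [(r : ℕ)] = s.mem 9 [(r : ℕ)]) : HoldsSegment H (l ++ l') r s' := by
  obtain ⟨b, c, hn, hc, hb, he, hl⟩ := h
  refine ⟨b, c, hn, hc, h8.trans hb, h9.trans he, fun j x hj => ?_⟩
  have := hl j x hj
  rw [List.getElem?_append_left (List.getElem?_eq_some_iff.1 this).1, this]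

/-- The state of the search before the candidate root `k` is treated. -/
structure SearchInv (Λ i : ℕ) (a : ℕ → ℕ) (H : SimpleGraph (Fin n)) (l : List (Fin n)) (k : ℕ)
    (s : MState) : Prop where
  nodup : l.Nodup
  mem_iff : ∀ v, v ∈ l ↔ (H.rootOf v : ℕ) < k
  queue : HoldsQueue (levelOf H) (counterOf Λ a H) l s
  head : s.reg 9 = l.length
  segment : ∀ r : Fin n, (r : ℕ) < k → HoldsSegment H l r s

/-- An amortized bound with the queue length as potential: each new queue entry pays `12 * D + 21`
and each candidate root a constant. Summed over all candidates this is linear in `n * (D + 1)`,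
however the vertices are spread over the components. -/
theorem wp_bfsRoot (hG : IsAdjacencyList G nbr) (hHG : H ≤ G) (hD : ∀ v, (nbr v).length ≤ D)
    {r : Fin n} {l : List (Fin n)} {s : MState} (hs : HoldsConsts n Λ i s)
    (hgr : HoldsGraph nbr s) (hcut : HoldsCut G H i s)
    (hinv : SearchInv Λ i (ω i) H l r s) (h8 : s.reg 8 = r) :
    Wp ω bfsRoot s fun t s' => ∃ l', SearchInv Λ i (ω i) H l' (r + 1) s' ∧
      t + (12 * D + 21) * l.length ≤ (12 * D + 21) * l'.length + 12 := by
  classical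
  have hvis := hinv.queue.vis r
  have h9 : s.reg 9 = l.length := hinv.head
  have h10 : s.reg 10 = l.length := hinv.queue.tail
  simp only [bfsRoot, wp_seq, wp_load, wp_add, List.map, MState.reg_setReg,
    MState.reg_setMem, h8, hvis, hs.one, hs.round, hs.zero, wp_ifLt, wp_store, wp_skip, wp_draw,
    Nat.reduceEqDiff, if_true, if_false, h10]
  by_cases hrl : r ∈ l
  · have hlt := (hinv.mem_iff r).1 hrl
    simp only [hrl, if_true, lt_irrefl, if_false]
    -- A visited candidate has a smaller root, so it is no root itself and gets an empty segment.
    have hroot : ∀ v, H.rootOf v ≠ r := fun v hv => by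
      have := rootOf_rootOf (H := H) (v := v)
      rw [hv] at this; rw [this] at hlt; exact lt_irrefl _ hlt
    refine ⟨l, ⟨hinv.nodup, fun v => ?_, hinv.queue.congr (by simp) ?_, by simp [h9],
      fun x hx => ?_⟩, by omega⟩
    · rw [hinv.mem_iff]
      have : (H.rootOf v : ℕ) ≠ r := fun h => hroot v (Fin.ext h)
      omega
    · rintro a (rfl | rfl | rfl | rfl) <;> ext j <;> simp
    · rcases Nat.lt_succ_iff_lt_or_eq.1 hx with hx | hx
      · have := (hinv.segment x hx).extend (l' := []) (s' := s) rfl rfl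
        obtain ⟨b, c, hn, hc, hb, he, hl⟩ := hinv.segment x hx
        exact ⟨b, c, hn, hc, by simp [hx.ne, hb], by simp [hx.ne, he], hl⟩
      · have hxr : x = r := Fin.ext hx
        subst hxr
        exact ⟨l.length, [], by simp, by simpa using hroot, by simp, by simp, by simp⟩
  -- All components with a root below `r` have been searched, so an unvisited `r` is least in its
  -- component.
  · have hr : H.rootOf r = r := by
      refine le_antisymm (Reachable.refl r).rootOf_le ?_
      by_contra h
      exact hrl ((hinv.mem_iff r).2 (by simpa using h))
    have hl : ∀ x ∈ l, H.rootOf x ≠ r := fun x hx h => by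
      have := (hinv.mem_iff x).1 hx
      rw [h] at this; exact lt_irrefl _ this
    simp only [hrl, if_true, zero_lt_one, if_false]
    set s1 : MState := _ with hs1
    change Wp ω _ s1 _
    have hq1 : HoldsQueue (levelOf H) (counterOf Λ (ω i) H) (l ++ ([] ++ [r])) s1 := by
      have hlev : levelOf H r = 0 := by simp [levelOf, hr]
      refine (hinv.queue.push (s' := s1) r ?_ ?_ ?_ ?_ ?_)
      · simp [hs1, h10]
      · intro x; simp [hs1]
      · intro x; simp [hs1, h10]
      · intro x; simp [hs1, hlev]
      · intro x; simp [hs1, counterOf, hlev, hr, countdown]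
    -- The time is charged to the finished vertices `p`. The head of the queue is at `l.length +
    -- p.length`, and `p` has no repetitions, so `l.length + n` minus the head is a decreasing
    -- measure.
    refine Wp.mono (Wp.whileLt (t₀ := 0) (fun t s' => Frame bfsStep s1 s' ∧ ∃ p w,
        BfsInv H r p w ∧
        HoldsQueue (levelOf H) (counterOf Λ (ω i) H) (l ++ (p ++ w)) s' ∧
        s'.reg 9 = l.length + p.length ∧ t ≤ (12 * D + 21) * p.length)
      (fun s' => l.length + n - s'.reg 9) ?_
      ⟨Frame.refl _ _, [], [r], BfsInv.init H r, hq1, by simp [hs1, h9], by simp⟩) ?_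
    · rintro t s' ⟨hf, p, w, hb, hq, h9', ht⟩ hlt
      rw [h9', hq.tail] at hlt
      obtain - | ⟨v, w⟩ := w
      · simp at hlt
      have hgr' : HoldsGraph nbr s' := hgr.congr
        (by rw [hf.mem 0 rfl]; ext j; simp [hs1]) (by rw [hf.mem 1 rfl]; ext j; simp [hs1])
      have hcut' : HoldsCut G H i s' := hcut.congr (by rw [hf.mem 7 rfl]; ext j; simp [hs1])
      have hs' : HoldsConsts n Λ i s' := hs.congr fun x hx => by
        rcases hx with rfl | rfl | rfl | rfl | rfl <;> rw [hf.reg _ rfl] <;> simp [hs1]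
      refine Wp.mono (wp_bfsStep hG hHG hD hs' hgr' hcut' hb hr hl hq h9') ?_
      rintro t' s'' ⟨⟨ht', h9'', w', hb', hq'⟩, hf'⟩
      refine ⟨⟨hf.trans hf', p ++ [v], w', hb', hq', by simp [h9'']; omega, ?_⟩, ?_⟩
      · simp only [List.length_append, List.length_singleton, mul_add, mul_one]
        omega
      · have := (hb.nodup.length_le_card)
        simp at this
        rw [h9'', h9']; omega
    · rintro t s' ⟨t₁, ht, ⟨hf, p, w, hb, hq, h9', ht₁⟩, hlt⟩
      obtain - | ⟨v, w⟩ := w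
      swap
      · rw [h9', hq.tail] at hlt; simp at hlt
      have hmem : ∀ x, x ∈ p ↔ H.rootOf x = r := fun x => by
        rw [hb.mem_iff, ← hr, rootOf_eq_iff, hr]
        exact ⟨Reachable.symm, Reachable.symm⟩
      have h10' : s'.reg 10 = l.length + p.length := by rw [hq.tail]; simp
      have h8' : s'.reg 8 = r := by rw [hf.reg 8 rfl]; simp [hs1, h8]
      have e8 : ∀ x : ℕ, s'.mem 8 [x] = if x = r then l.length else s.mem 8 [x] := fun x => by
        rw [hf.mem 8 rfl]; simp [hs1]
      have e9 : s'.mem 9 = s.mem 9 := by rw [hf.mem 9 rfl]; ext j; simp [hs1]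
      simp only [List.append_nil] at hq hb
      refine ⟨l ++ p, ⟨?_, fun v => ?_, hq.congr rfl ?_, ?_, fun x hx => ?_⟩, ?_⟩
      · refine List.nodup_append.2 ⟨hinv.nodup, by simpa using hb.nodup, fun a ha b hb hab => ?_⟩
        exact hl a ha ((hmem a).1 (hab ▸ hb))
      · rw [List.mem_append, hinv.mem_iff, hmem, Nat.lt_succ_iff_lt_or_eq, Fin.ext_iff]
      · rintro a (rfl | rfl | rfl | rfl) <;> ext j <;> simp
      · simp [h9']
      · rcases Nat.lt_succ_iff_lt_or_eq.1 hx with hx | hx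
        · refine (hinv.segment x hx).extend ?_ ?_
          · simp [e8, hx.ne]
          · simp [h8', hx.ne, e9]
        · have hxr : x = r := Fin.ext hx
          subst hxr
          refine ⟨l.length, p, by simpa using hb.nodup, hmem, by simp [e8], ?_, fun j y hj => ?_⟩
          · simp [h8', h10']
          · rw [List.getElem?_append_right (by omega)]; simpa using hj
      · simp only [List.length_append, mul_add]
        omega

theorem wp_bfsAll (hG : IsAdjacencyList G nbr) (hHG : H ≤ G) (hD : ∀ v, (nbr v).length ≤ D)
    {s : MState} (hs : HoldsConsts n Λ i s)
    (hgr : HoldsGraph nbr s) (hcut : HoldsCut G H i s) :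
    Wp ω bfsAll s fun t s' => (t ≤ n * (12 * D + 40) + 10 ∧
      ∃ l, SearchInv Λ i (ω i) H l n s') ∧ Frame bfsAll s s' := by
  classical
  apply Wp.withFrame
  simp only [bfsAll, wp_seq, wp_set]
  refine Wp.mono (Wp.forLt 1 (fun k s' => ∀ x < k, s'.mem 3 [x] = 0) rfl rfl hs.n hs.one
    (by simp) ?_) ?_
  · rintro k hk s' hf h8 hI
    have h5 : s'.reg 5 = 0 := (hf.reg 5 rfl).trans hs.zero
    simp only [wp_store, List.map, h8, h5, MState.mem_setReg, MState.mem_setMem]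
    refine ⟨le_rfl, fun x hx => ?_⟩
    by_cases hxk : x = k
    · simp [hxk]
    · simp [hxk, hI x (by omega)]
  · rintro t1 s1 ⟨⟨ht1, h3⟩, hf1⟩
    have hs1 : HoldsConsts n Λ i ((s1.setReg 9 0).setReg 10 0) := hs.congr fun x hx => by
      rcases hx with rfl | rfl | rfl | rfl | rfl <;> simpa using hf1.reg _ rfl
    have hgr1 : HoldsGraph nbr ((s1.setReg 9 0).setReg 10 0) :=
      hgr.congr (hf1.mem 0 rfl) (hf1.mem 1 rfl)
    have hcut1 : HoldsCut G H i ((s1.setReg 9 0).setReg 10 0) := hcut.congr (hf1.mem 7 rfl)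
    refine Wp.mono (Wp.forLt_acc (fun k t s' => ∃ l, SearchInv Λ i (ω i) H l k s' ∧
      t ≤ 14 * k + (12 * D + 21) * l.length) rfl rfl hs1.n hs1.one ?_ ?_) ?_
    · refine ⟨[], ⟨by simp, by simp, ⟨by simp, by simp, fun x => ?_, by simp, by simp⟩, by simp,
        by simp⟩, by simp⟩
      simpa using h3 x x.2
    · rintro k hk t s' hf h8 ⟨l, hI, ht⟩
      have hs' : HoldsConsts n Λ i s' := hs1.congr fun x hx => hf.reg x (by
        rcases hx with rfl | rfl | rfl | rfl | rfl <;> rfl)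
      refine Wp.mono (wp_bfsRoot (r := ⟨k, hk⟩) hG hHG hD hs'
        (hgr1.congr (hf.mem 0 rfl) (hf.mem 1 rfl)) (hcut1.congr (hf.mem 7 rfl)) hI h8) ?_
      rintro t' s'' ⟨l', hI', ht'⟩
      refine ⟨l', ⟨hI'.nodup, hI'.mem_iff, hI'.queue.congr (by simp) (by simp), by
        simpa using hI'.head, hI'.segment⟩, by omega⟩
    · rintro t s' ⟨t₂, rfl, l, hI, ht⟩
      refine ⟨?_, l, hI⟩
      have hlen : l.length ≤ n := by simpa using hI.nodup.length_le_card
      have : (12 * D + 21) * l.length ≤ (12 * D + 21) * n := Nat.mul_le_mul_left _ hlen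
      have e : n * (12 * D + 40) = (12 * D + 21) * n + 19 * n := by ring
      omega

end Search

/-! ### The rounds of the decomposition -/

namespace Prog

/-- Writes the mark for the next round of the edge from `[11]` to its neighbour number `[13]`. -/
def cutNbr : Cmd :=
  .seq (.load 14 1 [11, 13]) <| .seq (.load 15 7 [6, 11, 14]) <|
  .seq (.ifLt 15 4
    (.seq (.load 16 5 [14]) <| .seq (.add 19 17 5) <|
      .seq (.ifLt 16 18 (.load 19 6 [14]) .skip) <|
      .ifLt 19 4 (.add 15 4 5) .skip)
    .skip) <|
  .store 7 [7, 11, 14] 15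

/-- Writes the marks for the next round of the edges at `[11]`. -/
def cutVertex : Cmd :=
  .seq (.load 12 0 [11]) <| .seq (.load 18 5 [11]) <| .seq (.load 17 6 [11]) <|
  .forLt 13 12 cutNbr

/-- The rounds of the decomposition. -/
def rounds : Cmd :=
  .forLt 6 1 (.seq bfsAll (.seq (.add 7 6 4) (.forLt 11 0 cutVertex)))

end Prog

/-- The graph that is left after `i` rounds with the draws `a`. -/
def cutGraph {n Λ : ℕ} (G : SimpleGraph (Fin n)) (ρ : RootRule (Fin n))
    (a : ℕ → Fin n → Fin Λ) : ℕ → SimpleGraph (Fin n)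
  | 0 => G
  | i + 1 => (cutGraph G ρ a i).deleteEdges
      (bfsCut (cutGraph G ρ a i) (ρ.pick i (cutGraph G ρ a i)) (a i))

theorem cutGraph_le {n Λ : ℕ} (G : SimpleGraph (Fin n)) (ρ : RootRule (Fin n))
    (a : ℕ → Fin n → Fin Λ) (i : ℕ) : cutGraph G ρ a i ≤ G := by
  induction i with
  | zero => exact le_rfl
  | succ i ih => exact (SimpleGraph.deleteEdges_le _).trans ih

/-- Passes from a union of cut sets to graphs that shrink round by round. Total sequences of draws
replace families indexed by `Fin r`, so inductions over the rounds need no truncation of the draws.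
-/
theorem deleteEdges_minorE {n Λ : ℕ} (G : SimpleGraph (Fin n)) (ρ : RootRule (Fin n))
    (a : ℕ → Fin n → Fin Λ) (r : ℕ) (L : Draws n r Λ) (h : ∀ i : Fin r, L i = a i) :
    G.deleteEdges (minorE G ρ r L) = cutGraph G ρ a r := by
  induction r with
  | zero => simp [minorE, cutGraph]
  | succ r ih =>
    have ih' := ih (Fin.init L) fun i => h i.castSucc
    rw [minorE, cutGraph, ← SimpleGraph.deleteEdges_deleteEdges, ih', h (Fin.last r)]
    rfl

section Rounds

variable {n Λ i D r : ℕ} {ω : ℕ → ℕ → ℕ} {G H : SimpleGraph (Fin n)}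
  {nbr : Fin n → List (Fin n)}

open SimpleGraph Prog

theorem mem_bfsCut_iff {root : H.ConnectedComponent → Fin n} {L : Fin n → Fin Λ} {v u : Fin n}
    (h : H.Adj v u) : s(v, u) ∈ bfsCut H root L ↔
      ∃ k, min (H.dist (root (H.connectedComponentMk v)) v)
        (H.dist (root (H.connectedComponentMk v)) u) =
        k * Λ + L (root (H.connectedComponentMk v)) := by
  constructor
  · rintro ⟨-, c, hc, k, hk⟩
    have : H.connectedComponentMk v = c := hc v (by simp)
    subst this
    exact ⟨k, hk⟩
  · rintro ⟨k, hk⟩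
    refine ⟨h, H.connectedComponentMk v, fun x hx => ?_, k, hk⟩
    rcases Sym2.mem_iff.1 hx with rfl | rfl
    · rfl
    · exact (ConnectedComponent.eq.2 h.reachable).symm

/-- The cut test as the program performs it: the endpoint nearer to the root determines the level of
the edge, so its counter decides. -/
theorem mem_bfsCut_minRule_iff {L : Fin n → Fin Λ} {a : ℕ → ℕ} (ha : ∀ v : Fin n, a v = L v)
    {v u : Fin n} (h : H.Adj v u) : s(v, u) ∈ bfsCut H ((minRule n).pick i H) L ↔
      (if levelOf H u < levelOf H v then counterOf Λ a H u else counterOf Λ a H v) = 0 := by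
  have hroot : H.rootOf u = H.rootOf v := h.symm.reachable.rootOf_eq
  have hlt : a (H.rootOf v) < Λ := by rw [ha]; exact (L _).2
  rw [mem_bfsCut_iff h, minRule_pick, ← ha]
  simp only [counterOf, levelOf, hroot]
  split_ifs with hc
  · rw [countdown_eq_zero_iff hlt, min_eq_right hc.le]
  · rw [countdown_eq_zero_iff hlt, min_eq_left (not_lt.1 hc)]

theorem wp_cutNbrs (hG : IsAdjacencyList G nbr) {v : Fin n} {a : ℕ → ℕ} {s : MState}
    {L : Fin n → Fin Λ} (ha : ∀ v : Fin n, a v = L v)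
    (hs : HoldsConsts n Λ i s) (hgr : HoldsGraph nbr s)
    (hcut : HoldsCut G H i s) (hlev : ∀ x : Fin n, s.mem 5 [(x : ℕ)] = levelOf H x)
    (hcnt : ∀ x : Fin n, s.mem 6 [(x : ℕ)] = counterOf Λ a H x) (h7 : s.reg 7 = i + 1)
    (h11 : s.reg 11 = v) (h12 : s.reg 12 = (nbr v).length) (h17 : s.reg 17 = counterOf Λ a H v)
    (h18 : s.reg 18 = levelOf H v) :
    Wp ω (.forLt 13 12 cutNbr) s fun t s' =>
      (t ≤ (nbr v).length * 12 + 2 ∧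
        (∀ x y z, (x ≠ i + 1 ∨ y ≠ (v : ℕ)) → s'.mem 7 [x, y, z] = s.mem 7 [x, y, z]) ∧
        open Classical in ∀ u, G.Adj v u → s'.mem 7 [i + 1, (v : ℕ), (u : ℕ)] =
          if (H.deleteEdges (bfsCut H ((minRule n).pick i H) L)).Adj v u then 0 else 1) ∧
        Frame (.forLt 13 12 cutNbr) s s' := by
  classical
  refine Wp.mono (Wp.forLt 10 (fun k s' =>
    (∀ x y z, (x ≠ i + 1 ∨ y ≠ (v : ℕ)) → s'.mem 7 [x, y, z] = s.mem 7 [x, y, z]) ∧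
    ∀ j < k, ∀ u, (nbr v)[j]? = some u → s'.mem 7 [i + 1, (v : ℕ), (u : ℕ)] =
      if (H.deleteEdges (bfsCut H ((minRule n).pick i H) L)).Adj v u then 0 else 1)
    rfl rfl h12 hs.one (by simp) ?_) ?_
  · rintro k hk s1 hf h13 ⟨hI, hdone⟩
    have h11' : s1.reg 11 = v := (hf.reg 11 rfl).trans h11
    have h17' := (hf.reg 17 rfl).trans h17
    have h18' := (hf.reg 18 rfl).trans h18
    have h7' := (hf.reg 7 rfl).trans h7
    have hone : s1.reg 4 = 1 := (hf.reg 4 rfl).trans hs.one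
    have hzero : s1.reg 5 = 0 := (hf.reg 5 rfl).trans hs.zero
    have hround : s1.reg 6 = i := (hf.reg 6 rfl).trans hs.round
    obtain ⟨u, hu⟩ : ∃ u, (nbr v)[k]? = some u := ⟨_, List.getElem?_eq_getElem hk⟩
    have hGvu : G.Adj v u := ((hG v).2 u).1 (List.mem_of_getElem? hu)
    have hm1 : s1.mem 1 [(v : ℕ), k] = u := by
      rw [hf.mem 1 rfl]; exact hgr.adj v k u hu
    have hm7 := hcut v u hGvu
    rw [← hI i v u (by simp)] at hm7
    have h5 := hlev u
    have h6 := hcnt u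
    rw [← hf.mem 5 rfl] at h5
    rw [← hf.mem 6 rfl] at h6
    -- Only a cell of row `i + 1` is written, so the marks of row `i`, which are still to be read,
    -- survive.
    have hpost : ∀ s2 : MState, (∀ x y z, s2.mem 7 [x, y, z] =
        if x = i + 1 ∧ y = v ∧ z = u then
          if (H.deleteEdges (bfsCut H ((minRule n).pick i H) L)).Adj v u then 0 else 1
        else s1.mem 7 [x, y, z]) →
        (∀ x y z, (x ≠ i + 1 ∨ y ≠ (v : ℕ)) → s2.mem 7 [x, y, z] = s.mem 7 [x, y, z]) ∧
        ∀ j < k + 1, ∀ u, (nbr v)[j]? = some u → s2.mem 7 [i + 1, (v : ℕ), (u : ℕ)] =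
          if (H.deleteEdges (bfsCut H ((minRule n).pick i H) L)).Adj v u then 0 else 1 := by
      intro s2 h2
      refine ⟨fun x y z hxy => ?_, fun j hj w hw => ?_⟩
      · rw [h2, if_neg (by tauto), hI x y z hxy]
      · rw [h2]
        by_cases hwu : w = u
        · subst hwu; simp
        · rw [if_neg (by simp [Fin.val_inj, hwu])]
          refine hdone j ?_ w hw
          rcases Nat.lt_succ_iff_lt_or_eq.1 hj with hj | rfl
          · exact hj
          · rw [hu] at hw; cases hw; exact absurd rfl hwu
    simp only [cutNbr, wp_seq, wp_load, wp_ifLt, List.map, MState.reg_setReg, MState.mem_setReg,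
      h11', h13, hm1, hround, hm7, hone, Nat.reduceEqDiff, if_true, if_false,
      wp_store, wp_add, wp_skip, h5, h6, h17', h18', hzero, h7', add_zero]
    by_cases hvu : H.Adj v u
    · have hiff := mem_bfsCut_minRule_iff (i := i) ha hvu
      simp only [hvu, if_true, zero_lt_one]
      by_cases hlt : levelOf H u < levelOf H v
      · simp only [hlt, if_true] at hiff ⊢
        by_cases h0 : counterOf Λ a H u < 1
        · rw [if_pos h0]
          refine ⟨by norm_num, hpost _ fun x y z => ?_⟩
          have : s(v, u) ∈ bfsCut H ((minRule n).pick i H) L := hiff.2 (by omega)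
          simp [deleteEdges_adj, this]
        · rw [if_neg h0]
          refine ⟨by norm_num, hpost _ fun x y z => ?_⟩
          have : s(v, u) ∉ bfsCut H ((minRule n).pick i H) L := fun h => h0 (by
            have := hiff.1 h; omega)
          simp [deleteEdges_adj, this, hvu]
      · simp only [hlt, if_false] at hiff ⊢
        by_cases h0 : counterOf Λ a H v < 1
        · rw [if_pos h0]
          refine ⟨by norm_num, hpost _ fun x y z => ?_⟩
          have : s(v, u) ∈ bfsCut H ((minRule n).pick i H) L := hiff.2 (by omega)
          simp [deleteEdges_adj, this]
        · rw [if_neg h0]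
          refine ⟨by norm_num, hpost _ fun x y z => ?_⟩
          have : s(v, u) ∉ bfsCut H ((minRule n).pick i H) L := fun h => h0 (by
            have := hiff.1 h; omega)
          simp [deleteEdges_adj, this, hvu]
    · simp only [hvu, if_false, lt_irrefl]
      refine ⟨by norm_num, hpost _ fun x y z => ?_⟩
      simp [deleteEdges_adj, hvu]
  · rintro t s' ⟨⟨ht, hI, hdone⟩, hf⟩
    refine ⟨⟨ht, hI, fun u hvu => ?_⟩, hf⟩
    obtain ⟨j, hj, hju⟩ := List.getElem_of_mem (((hG v).2 u).2 hvu)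
    exact hdone j hj u (hju ▸ List.getElem?_eq_getElem hj)

theorem wp_cutVertices (hG : IsAdjacencyList G nbr) (hD : ∀ v, (nbr v).length ≤ D) {a : ℕ → ℕ}
    {s : MState} {L : Fin n → Fin Λ} (ha : ∀ v : Fin n, a v = L v)
    (hs : HoldsConsts n Λ i s) (hgr : HoldsGraph nbr s)
    (hcut : HoldsCut G H i s) (hlev : ∀ x : Fin n, s.mem 5 [(x : ℕ)] = levelOf H x)
    (hcnt : ∀ x : Fin n, s.mem 6 [(x : ℕ)] = counterOf Λ a H x) (h7 : s.reg 7 = i + 1) :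
    Wp ω (.forLt 11 0 cutVertex) s fun t s' =>
      (t ≤ n * (12 * D + 8) + 2 ∧
        HoldsCut G (H.deleteEdges (bfsCut H ((minRule n).pick i H) L)) (i + 1) s') ∧
        Frame (.forLt 11 0 cutVertex) s s' := by
  classical
  refine Wp.mono (Wp.forLt (12 * D + 6) (fun k s' =>
    (∀ y z, s'.mem 7 [i, y, z] = s.mem 7 [i, y, z]) ∧
    ∀ v : Fin n, (v : ℕ) < k → ∀ u, G.Adj v u → s'.mem 7 [i + 1, (v : ℕ), (u : ℕ)] =
      if (H.deleteEdges (bfsCut H ((minRule n).pick i H) L)).Adj v u then 0 else 1)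
    rfl rfl hs.n hs.one (by simp) ?_) ?_
  · rintro k hk s1 hf h11 ⟨hI, hdone⟩
    have h0 : s1.mem 0 [k] = (nbr ⟨k, hk⟩).length := by rw [hf.mem 0 rfl]; exact hgr.deg ⟨k, hk⟩
    have h5 : s1.mem 5 [k] = levelOf H ⟨k, hk⟩ := by rw [hf.mem 5 rfl]; exact hlev ⟨k, hk⟩
    have h6 : s1.mem 6 [k] = counterOf Λ a H ⟨k, hk⟩ := by rw [hf.mem 6 rfl]; exact hcnt ⟨k, hk⟩
    simp only [cutVertex, wp_seq, wp_load, List.map, MState.reg_setReg, MState.mem_setReg,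
      h11, h0, h5, h6, Nat.reduceEqDiff, if_false]
    refine Wp.mono (wp_cutNbrs (v := ⟨k, hk⟩) hG ha (hs.congr fun x hx => ?_)
      (hgr.congr (hf.mem 0 rfl) (hf.mem 1 rfl))
      (fun x y hxy => (hI x y).trans (hcut x y hxy)) (fun x => ?_) (fun x => ?_) ?_ ?_ ?_ ?_ ?_) ?_
    · rcases hx with rfl | rfl | rfl | rfl | rfl <;> simpa using hf.reg _ rfl
    · simpa [hf.mem 5 rfl] using hlev x
    · simpa [hf.mem 6 rfl] using hcnt x
    · simpa [hf.reg 7 rfl] using h7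
    · simp [h11]
    · simp
    · simp
    · simp
    · rintro t s' ⟨⟨ht, hI', hdone'⟩, -⟩
      refine ⟨?_, fun y z => ?_, fun v hv u hvu => ?_⟩
      · have := hD ⟨k, hk⟩; omega
      · rw [hI' i y z (by simp)]; exact hI y z
      · rcases Nat.lt_succ_iff_lt_or_eq.1 hv with hv | rfl
        · rw [hI' _ _ _ (Or.inr hv.ne)]; exact hdone v hv u hvu
        · exact hdone' u hvu
  · rintro t s' ⟨⟨ht, hI, hdone⟩, hf⟩
    exact ⟨⟨ht, fun v u hvu => by convert hdone v v.2 u hvu⟩, hf⟩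

theorem wp_rounds (hG : IsAdjacencyList G nbr) (hD : ∀ v, (nbr v).length ≤ D)
    {a : ℕ → Fin n → Fin Λ} (ha : ∀ i < r, ∀ v : Fin n, ω i v = a i v) {s : MState}
    (h0 : s.reg 0 = n) (h1 : s.reg 1 = r) (h2 : s.reg 2 = Λ) (h4 : s.reg 4 = 1)
    (h5 : s.reg 5 = 0) (hgr : HoldsGraph nbr s) (hcut : HoldsCut G G 0 s) :
    Wp ω rounds s fun t s' => (t ≤ r * (n * (24 * D + 48) + 15) + 2 ∧
      HoldsCut G (cutGraph G (minRule n) a r) r s' ∧ s'.reg 6 = r) ∧ Frame rounds s s' := by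
  refine Wp.mono (Wp.forLt (n * (24 * D + 48) + 13)
    (fun k s' => HoldsCut G (cutGraph G (minRule n) a k) k s' ∧ s'.reg 6 = k)
    rfl rfl h1 h4 ⟨hcut.congr rfl, by simp⟩ ?_) fun t s' h => h
  rintro k hk s1 hf h6 ⟨hI, -⟩
  have hs1 : HoldsConsts n Λ k s1 := ⟨(hf.reg 0 rfl).trans h0, (hf.reg 2 rfl).trans h2,
    (hf.reg 4 rfl).trans h4, (hf.reg 5 rfl).trans h5, h6⟩
  have hgr1 : HoldsGraph nbr s1 := hgr.congr (hf.mem 0 rfl) (hf.mem 1 rfl)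
  refine wp_seq.2 (Wp.mono (wp_bfsAll hG (cutGraph_le G (minRule n) a k) hD hs1 hgr1 hI) ?_)
  rintro t2 s2 ⟨⟨ht2, l, hS⟩, hf2⟩
  simp only [wp_seq, wp_add]
  have hmem : ∀ x, x ∈ l := fun x => (hS.mem_iff x).2 (Fin.is_lt _)
  refine Wp.mono (wp_cutVertices (i := k) (L := a k) (a := ω k) hG hD (ha k hk)
    (hs1.congr fun x hx => ?_) (hgr1.congr (hf2.mem 0 rfl) (hf2.mem 1 rfl))
    (hI.congr (hf2.mem 7 rfl)) (fun x => ?_) (fun x => ?_) ?_) ?_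
  · rcases hx with rfl | rfl | rfl | rfl | rfl <;> simpa using hf2.reg _ rfl
  · simpa using hS.queue.lev x (hmem x)
  · simpa using hS.queue.cnt x (hmem x)
  · simp [hf2.reg 6 rfl, hf2.reg 4 rfl, h6, hs1.one]
  · rintro t3 s3 ⟨⟨ht3, hc3⟩, -⟩
    refine ⟨?_, hc3.congr rfl, by simp⟩
    have e : n * (24 * D + 48) = n * (12 * D + 40) + n * (12 * D + 8) := by ring
    omega

end Rounds

/-! ### Enumeration of all assignments of a component -/

namespace Prog

/-- Puts the `[22]`-th power of `[3]` into `[23]`, and the smaller powers into the array `10`. -/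
def powers : Cmd :=
  .seq (.set 23 1) <| .forLt 24 22 <|
  .seq (.store 10 [24] 23) <| .seq (.set 25 0) <| .seq (.forLt 26 3 (.add 25 25 23)) <|
  .add 23 25 5

/-- Writes the digit number `[24]` of `[30]` in base `[3]` and prepares the next one. -/
def digitStep : Cmd :=
  .seq (.store 11 [24, 30] 29) <| .seq (.add 28 28 4) <|
  .ifLt 28 27 .skip <| .seq (.set 28 0) <| .seq (.add 29 29 4) <|
  .ifLt 29 3 .skip (.set 29 0)

/-- Writes the digit number `[24]` of all numbers below `[23]`. -/
def digitRow : Cmd :=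
  .seq (.load 27 10 [24]) <| .seq (.set 28 0) <| .seq (.set 29 0) <| .forLt 30 23 digitStep

/-- Gives the label number `[24]` of the assignment number `[30]` to its vertex. -/
def assignVertex : Cmd :=
  .seq (.add 31 20 24) <| .seq (.load 11 4 [31]) <| .seq (.load 32 11 [24, 30]) <|
  .store 12 [11] 32

/-- Adds the energy of the edge from `[11]` to its neighbour number `[13]`. -/
def energyNbr : Cmd :=
  .seq (.load 14 1 [11, 13]) <|
  .ifLt 14 11
    (.seq (.load 15 7 [6, 11, 14]) <|
      .ifLt 15 4
        (.seq (.load 33 12 [14]) <| .seq (.rload 3 1 [11, 13, 32, 33]) (.radd 2 2 3))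
        .skip)
    .skip

/-- Adds the energy of the vertex number `[24]` and of the edges to smaller neighbours. -/
def energyVertex : Cmd :=
  .seq (.add 31 20 24) <| .seq (.load 11 4 [31]) <| .seq (.load 12 0 [11]) <|
  .seq (.load 32 12 [11]) <| .seq (.rload 3 0 [11, 32]) <| .seq (.radd 2 2 3) <|
  .forLt 13 12 energyNbr

/-- Copies the label of the vertex number `[24]` to the output. -/
def outputVertex : Cmd :=
  .seq (.add 31 20 24) <| .seq (.load 11 4 [31]) <| .seq (.load 32 12 [11]) <|
  .store 2 [11] 32

/-- Evaluates the assignment number `[30]` and outputs it if it is the best one so far. -/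
def tryAssignment : Cmd :=
  .seq (.forLt 24 22 assignVertex) <| .seq (.radd 2 0 0) <|
  .seq (.forLt 24 22 energyVertex) <|
  .ifRLt 1 2 (.seq (.radd 1 2 0) (.forLt 24 22 outputVertex)) .skip

/-- Finds an optimal assignment of the component with root `[8]`. -/
def mapRoot : Cmd :=
  .seq (.load 20 8 [8]) <| .seq (.load 21 9 [8]) <| .seq (.sub 22 21 20) <|
  .seq powers <| .seq (.forLt 24 22 digitRow) <| .seq (.radd 1 0 0) <|
  .forLt 30 23 tryAssignment

end Prog

section Enumerate

variable {ω : ℕ → ℕ → ℕ} {m q : ℕ} {s : MState}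

open Prog

/-- Each power costs `q` additions because the machine does not multiply; this is the summand `3 *
q`. -/
theorem wp_powers (h22 : s.reg 22 = m) (h3 : s.reg 3 = q) (h4 : s.reg 4 = 1)
    (h5 : s.reg 5 = 0) :
    Wp ω powers s fun t s' => (t ≤ m * (3 * q + 7) + 3 ∧ s'.reg 23 = q ^ m ∧
      ∀ j < m, s'.mem 10 [j] = q ^ j) ∧ Frame powers s s' := by
  apply Wp.withFrame
  simp only [powers, wp_seq, wp_set]
  refine Wp.mono (Wp.forLt (3 * q + 5) (fun k s' => s'.reg 23 = q ^ k ∧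
    ∀ j < k, s'.mem 10 [j] = q ^ j) rfl rfl (by simpa using h22) (by simpa using h4)
    (by simp) ?_) ?_
  · rintro k hk s1 hf h24 ⟨h23, hI⟩
    have h3' : s1.reg 3 = q := by simpa [h3] using hf.reg 3 rfl
    have h4' : s1.reg 4 = 1 := by simpa [h4] using hf.reg 4 rfl
    have h5' : s1.reg 5 = 0 := by simpa [h5] using hf.reg 5 rfl
    simp only [wp_seq, wp_store, List.map, wp_set, h24, h23]
    refine Wp.mono (Wp.forLt 1 (fun k' s' => s'.reg 25 = k' * q ^ k) rfl rfl (by simpa using h3')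
      (by simpa using h4') (by simp) ?_) ?_
    · intro k' hk' s2 hf2 _ h25
      have h23' : s2.reg 23 = q ^ k := by simpa [h23] using hf2.reg 23 rfl
      simp only [wp_add, MState.reg_setReg]
      simp [h25, h23', add_mul]
    · rintro t s2 ⟨⟨ht, h25⟩, hf2⟩
      have h5'' : s2.reg 5 = 0 := by simpa [h5'] using hf2.reg 5 rfl
      simp only [wp_add]
      refine ⟨by omega, by simp [h25, h5'', pow_succ, mul_comm], fun j hj => ?_⟩
      have e : ∀ j, s2.mem 10 [j] = if j = k then q ^ k else s1.mem 10 [j] := by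
        intro j; rw [hf2.mem 10 rfl]; simp
      simp only [MState.mem_setReg, e]
      split_ifs with hjk
      · rw [hjk]
      · exact hI j (by omega)
  · rintro t s' ⟨⟨ht, hI⟩, -⟩
    have e : m * (3 * q + 5 + 2) = m * (3 * q + 7) := rfl
    exact ⟨by omega, hI⟩

/-- Digits of consecutive numbers are found without division: register `28` counts `k` modulo `q ^
j`, and each overflow advances the digit in register `29` modulo `q`. -/
theorem wp_digitRow {j N : ℕ} (hq : 0 < q) (h24 : s.reg 24 = j) (h10 : s.mem 10 [j] = q ^ j)
    (h23 : s.reg 23 = N) (h3 : s.reg 3 = q) (h4 : s.reg 4 = 1) :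
    Wp ω digitRow s fun t s' => (t ≤ N * 9 + 5 ∧
      (∀ k < N, s'.mem 11 [j, k] = k / q ^ j % q) ∧
      ∀ i k, i ≠ j → s'.mem 11 [i, k] = s.mem 11 [i, k]) ∧ Frame digitRow s s' := by
  apply Wp.withFrame
  have hp : 0 < q ^ j := pow_pos hq j
  simp only [digitRow, wp_seq, wp_set, wp_load, List.map, h24, h10]
  refine Wp.mono (Wp.forLt 7 (fun k s' => s'.reg 28 = k % q ^ j ∧ s'.reg 29 = k / q ^ j % q ∧
    (∀ k' < k, s'.mem 11 [j, k'] = k' / q ^ j % q) ∧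
    ∀ i k, i ≠ j → s'.mem 11 [i, k] = s.mem 11 [i, k]) rfl rfl (by simpa using h23)
    (by simpa using h4) (by simp) ?_) ?_
  · rintro k hk s1 hf h30 ⟨h28, h29, hrow, hother⟩
    have h3' : s1.reg 3 = q := by simpa [h3] using hf.reg 3 rfl
    have h4' : s1.reg 4 = 1 := by simpa [h4] using hf.reg 4 rfl
    have h24' : s1.reg 24 = j := by simpa [h24] using hf.reg 24 rfl
    have h27 : s1.reg 27 = q ^ j := by simpa using hf.reg 27 rfl
    have hdm := Nat.div_add_mod k (q ^ j)
    have hml := Nat.mod_lt k hp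
    have hmem : ∀ s2 : MState, (∀ x y, s2.mem 11 [x, y] =
        if x = j ∧ y = k then k / q ^ j % q else s1.mem 11 [x, y]) →
        (∀ k' < k + 1, s2.mem 11 [j, k'] = k' / q ^ j % q) ∧
        ∀ i k, i ≠ j → s2.mem 11 [i, k] = s.mem 11 [i, k] := by
      intro s2 h2
      refine ⟨fun k' hk' => ?_, fun i k' hij => ?_⟩
      · rw [h2]
        by_cases h : k' = k
        · simp [h]
        · simp only [h, and_false, if_false]; exact hrow k' (by omega)
      · rw [h2]; simp [hij, hother i k' hij]
    simp only [digitStep, wp_seq, wp_store, wp_add, wp_ifLt, wp_skip, wp_set, List.map,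
      MState.reg_setReg, MState.reg_setMem, h24', h30, h28, h29, h27, h3', h4', Nat.reduceEqDiff,
      if_true, if_false]
    by_cases hc : k % q ^ j + 1 < q ^ j
    · have hdm' : (k + 1) / q ^ j = k / q ^ j ∧ (k + 1) % q ^ j = k % q ^ j + 1 :=
        (Nat.div_mod_unique hp).2 ⟨by omega, hc⟩
      rw [if_pos hc]
      refine ⟨by norm_num, by simp [hdm'], by simp [hdm'], hmem _ fun x y => ?_⟩
      simp
    · have hdm' : (k + 1) / q ^ j = k / q ^ j + 1 ∧ (k + 1) % q ^ j = 0 :=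
        (Nat.div_mod_unique hp).2 ⟨by rw [mul_add]; omega, hp⟩
      rw [if_neg hc]
      have hml' := Nat.mod_lt (k / q ^ j) hq
      have hdm2 := Nat.div_add_mod (k / q ^ j) q
      by_cases hc' : k / q ^ j % q + 1 < q
      · have e : (k / q ^ j + 1) % q = k / q ^ j % q + 1 :=
          ((Nat.div_mod_unique hq (c := k / q ^ j % q + 1) (d := k / q ^ j / q)).2
            ⟨by omega, hc'⟩).2
        rw [if_pos hc']
        refine ⟨by norm_num, by simp [hdm'], by simp [hdm', e], hmem _ fun x y => ?_⟩
        simp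
      · have e : (k / q ^ j + 1) % q = 0 :=
          ((Nat.div_mod_unique hq (c := 0) (d := k / q ^ j / q + 1)).2
            ⟨by rw [mul_add]; omega, hq⟩).2
        rw [if_neg hc']
        refine ⟨by norm_num, by simp [hdm'], by simp [hdm', e], hmem _ fun x y => ?_⟩
        simp
  · rintro t s' ⟨⟨ht, -, -, h1, h2⟩, -⟩
    exact ⟨by omega, h1, h2⟩

theorem wp_digits {N : ℕ} (hq : 0 < q) (h10 : ∀ j < m, s.mem 10 [j] = q ^ j)
    (h22 : s.reg 22 = m)
    (h23 : s.reg 23 = N) (h3 : s.reg 3 = q) (h4 : s.reg 4 = 1) :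
    Wp ω (.forLt 24 22 digitRow) s fun t s' => (t ≤ m * (N * 9 + 7) + 2 ∧
      ∀ j < m, ∀ k < N, s'.mem 11 [j, k] = k / q ^ j % q) ∧
      Frame (.forLt 24 22 digitRow) s s' := by
  refine Wp.mono (Wp.forLt (N * 9 + 5) (fun j s' => ∀ j' < j, ∀ k < N,
    s'.mem 11 [j', k] = k / q ^ j' % q) rfl rfl h22 h4 (by simp) ?_) fun t s' h => h
  intro j hj s1 hf h24 hI
  refine Wp.mono (wp_digitRow hq h24 ((congrFun (hf.mem 10 rfl) _).trans (h10 j hj))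
    ((hf.reg 23 rfl).trans h23) ((hf.reg 3 rfl).trans h3) ((hf.reg 4 rfl).trans h4)) ?_
  rintro t s2 ⟨⟨ht, hrow, hother⟩, -⟩
  refine ⟨ht, fun j' hj' k hk => ?_⟩
  simp only [MState.mem_setReg]
  rcases Nat.lt_succ_iff_lt_or_eq.1 hj' with h | rfl
  · rw [hother _ _ h.ne]; exact hI j' h k hk
  · exact hrow k hk

end Enumerate

/-! ### Energy of a list of vertices, and the numbering of its labelings. -/

section Energy

variable {n q : ℕ}

open Classical in
/-- The energy of the vertex `v` and of the edges of `H` from `v` to smaller vertices. -/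
noncomputable def vertexEnergy (M : MRF (Fin n) (Fin q)) (H : SimpleGraph (Fin n))
    (y : Fin n → Fin q) (v : Fin n) : ℝ :=
  M.φ v (y v) + ∑ u, if H.Adj v u ∧ u < v then M.ψ v u (y v) (y u) else 0

/-- The energy of the vertices in the list `cs` and of the edges to smaller vertices. -/
noncomputable def listEnergy (M : MRF (Fin n) (Fin q)) (H : SimpleGraph (Fin n))
    (cs : List (Fin n)) (y : Fin n → Fin q) : ℝ :=
  (cs.map (vertexEnergy M H y)).sum

/-- Allows the search for the best labeling to start from the value `0`. -/
theorem listEnergy_nonneg (M : MRF (Fin n) (Fin q)) (H : SimpleGraph (Fin n))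
    (cs : List (Fin n)) (y : Fin n → Fin q) : 0 ≤ listEnergy M H cs y := by
  refine List.sum_nonneg fun e he => ?_
  obtain ⟨v, -, rfl⟩ := List.mem_map.1 he
  refine add_nonneg (M.φ_nonneg _ _) (Finset.sum_nonneg fun u _ => ?_)
  split_ifs
  · exact M.ψ_nonneg _ _ _ _
  · exact le_rfl

/-- As `cs` is closed under adjacency in `H`, no label outside `cs` enters. Hence trying the
labelings of `cs` covers all assignments. -/
theorem listEnergy_congr {M : MRF (Fin n) (Fin q)} {H : SimpleGraph (Fin n)}
    {cs : List (Fin n)} (hcs : ∀ v ∈ cs, ∀ u, H.Adj v u → u ∈ cs) {y z : Fin n → Fin q}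
    (h : ∀ v ∈ cs, y v = z v) : listEnergy M H cs y = listEnergy M H cs z := by
  unfold listEnergy
  congr 1
  refine List.map_congr_left fun v hv => ?_
  unfold vertexEnergy
  rw [h v hv]
  congr 1
  refine Finset.sum_congr rfl fun u _ => ?_
  split_ifs with hu
  · rw [h u (hcs v hv u hu.1)]
  · rfl

/-- The assignment number `k` of the vertices in `cs`: the labels are the base `q` digits. -/
def assignment (hq : 0 < q) (cs : List (Fin n)) (k : ℕ) (v : Fin n) : Fin q :=
  ⟨k / q ^ cs.idxOf v % q, Nat.mod_lt _ hq⟩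

/-- `finFunctionFinEquiv` is the base `q` expansion, so the number it attaches to the labels along
`cs` has these labels as digits. -/
theorem exists_assignment_eq (hq : 0 < q) (cs : List (Fin n)) (z : Fin n → Fin q) :
    ∃ k < q ^ cs.length, ∀ v ∈ cs, assignment hq cs k v = z v := by
  let f : Fin cs.length → Fin q := fun j => z cs[j]
  refine ⟨finFunctionFinEquiv f, Fin.is_lt _, fun v hv => ?_⟩
  have h1 : finFunctionFinEquiv.symm (finFunctionFinEquiv f) ⟨cs.idxOf v, List.idxOf_lt_length_iff.2 hv⟩
      = z v := by
    rw [Equiv.symm_apply_apply]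
    simp [f]
  rw [← h1]
  rfl

end Energy

open Classical in
/-- The data of the enumeration: the field, the graph `H` and the constants. -/
structure HoldsField {n q : ℕ} (M : MRF (Fin n) (Fin q)) (G H : SimpleGraph (Fin n))
    (nbr : Fin n → List (Fin n)) (i : ℕ) (s : MState) : Prop where
  graph : HoldsGraph nbr s
  cut : HoldsCut G H i s
  phi : ∀ (v : Fin n) (x : Fin q), s.rmem 0 [(v : ℕ), (x : ℕ)] = M.φ v x
  psi : ∀ (v : Fin n) (k : ℕ) (u : Fin n) (x y : Fin q), (nbr v)[k]? = some u →
    s.rmem 1 [(v : ℕ), k, (x : ℕ), (y : ℕ)] = M.ψ v u x y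
  one : s.reg 4 = 1
  round : s.reg 6 = i
  zero : s.rreg 0 = 0

/-- The data of one component: its vertices form the segment `cs` of the queue. -/
structure HoldsComp {n : ℕ} (cs : List (Fin n)) (b : ℕ) (s : MState) : Prop where
  start : s.reg 20 = b
  length : s.reg 22 = cs.length
  queue : ∀ (j : ℕ) (x : Fin n), cs[j]? = some x → s.mem 4 [b + j] = x

theorem HoldsField.congr {n q i : ℕ} {M : MRF (Fin n) (Fin q)} {G H : SimpleGraph (Fin n)}
    {nbr : Fin n → List (Fin n)} {s s' : MState} (h : HoldsField M G H nbr i s)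
    (hr : s'.reg 4 = s.reg 4 ∧ s'.reg 6 = s.reg 6 ∧ s'.rreg 0 = s.rreg 0)
    (hm : s'.mem 0 = s.mem 0 ∧ s'.mem 1 = s.mem 1 ∧ s'.mem 7 = s.mem 7)
    (hrm : s'.rmem = s.rmem) : HoldsField M G H nbr i s' :=
  ⟨h.graph.congr hm.1 hm.2.1, h.cut.congr hm.2.2, hrm ▸ h.phi, hrm ▸ h.psi, hr.1.trans h.one,
    hr.2.1.trans h.round, hr.2.2.trans h.zero⟩

theorem HoldsField.frame {n q i : ℕ} {M : MRF (Fin n) (Fin q)} {G H : SimpleGraph (Fin n)}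
    {nbr : Fin n → List (Fin n)} {s s' : MState} {c : Cmd} (h : HoldsField M G H nbr i s)
    (hf : Frame c s s')
    (hw : (c.wrReg 4 || c.wrReg 6 || c.wrRReg 0 || c.wrMem 0 || c.wrMem 1 || c.wrMem 7 ||
      c.wrRMem 0 || c.wrRMem 1) = false) : HoldsField M G H nbr i s' := by
  simp only [Bool.or_eq_false_iff] at hw
  obtain ⟨⟨⟨⟨⟨⟨⟨w1, w2⟩, w3⟩, w4⟩, w5⟩, w6⟩, w7⟩, w8⟩ := hw
  exact ⟨h.graph.congr (hf.mem _ w4) (hf.mem _ w5), h.cut.congr (hf.mem _ w6),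
    (hf.rmem _ w7).symm ▸ h.phi, (hf.rmem _ w8).symm ▸ h.psi, (hf.reg _ w1).trans h.one,
    (hf.reg _ w2).trans h.round, (hf.rreg _ w3).trans h.zero⟩

theorem HoldsComp.frame {n b : ℕ} {cs : List (Fin n)} {s s' : MState} {c : Cmd}
    (h : HoldsComp cs b s) (hf : Frame c s s')
    (hw : (c.wrReg 20 || c.wrReg 22 || c.wrMem 4) = false) : HoldsComp cs b s' := by
  simp only [Bool.or_eq_false_iff] at hw
  exact ⟨(hf.reg _ hw.1.1).trans h.start, (hf.reg _ hw.1.2).trans h.length,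
    (hf.mem _ hw.2).symm ▸ h.queue⟩

section Map

variable {n q i b D : ℕ} {ω : ℕ → ℕ → ℕ} {M : MRF (Fin n) (Fin q)} {G H : SimpleGraph (Fin n)}
  {nbr : Fin n → List (Fin n)} {cs : List (Fin n)} {s : MState} {y : Fin n → Fin q}

open Prog

theorem wp_assign (hq : 0 < q) {k N : ℕ} (hk : k < N) (hcs : cs.Nodup)
    (h4 : s.reg 4 = 1)
    (hc : HoldsComp cs b s) (h30 : s.reg 30 = k)
    (hdig : ∀ j < cs.length, ∀ k < N, s.mem 11 [j, k] = k / q ^ j % q) :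
    Wp ω (.forLt 24 22 assignVertex) s fun t s' => (t ≤ cs.length * 6 + 2 ∧
      ∀ x ∈ cs, s'.mem 12 [(x : ℕ)] = assignment hq cs k x) ∧
      Frame (.forLt 24 22 assignVertex) s s' := by
  refine Wp.mono (Wp.forLt 4 (fun j s' => ∀ x ∈ cs.take j,
    s'.mem 12 [(x : ℕ)] = assignment hq cs k x) rfl rfl hc.length h4 (by simp) ?_) ?_
  · intro j hj s1 hf h24 hI
    have hx : cs[j]? = some cs[j] := List.getElem?_eq_getElem hj
    have h4' : s1.mem 4 [b + j] = cs[j] := by rw [hf.mem 4 rfl]; exact hc.queue _ _ hx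
    have h11 : s1.mem 11 [j, k] = k / q ^ j % q := by rw [hf.mem 11 rfl]; exact hdig j hj k hk
    have h20 : s1.reg 20 = b := (hf.reg 20 rfl).trans hc.start
    have h30' : s1.reg 30 = k := (hf.reg 30 rfl).trans h30
    simp only [assignVertex, wp_seq, wp_add, wp_load, wp_store, List.map, MState.reg_setReg,
      MState.mem_setReg, h20, h24, h30', h4', h11, Nat.reduceEqDiff, if_true, if_false]
    refine ⟨by norm_num, fun x hxm => ?_⟩
    have hjx : (assignment hq cs k cs[j] : ℕ) = k / q ^ j % q := by
      simp [assignment, hcs.idxOf_getElem]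
    by_cases hxj : x = cs[j]
    · simp [hxj, hjx]
    · have hxm' : x ∈ cs.take j := by
        rw [List.take_add_one, hx] at hxm
        rcases List.mem_append.1 hxm with h | h
        · exact h
        · exact absurd (by simpa using h) hxj
      simp [Fin.val_inj, hxj, hI x hxm']
  · rintro t s' ⟨⟨ht, hI⟩, hf⟩
    exact ⟨⟨ht, fun x hx => hI x (by simpa using hx)⟩, hf⟩

theorem wp_output (h4 : s.reg 4 = 1) (hc : HoldsComp cs b s)
    (h12 : ∀ x ∈ cs, s.mem 12 [(x : ℕ)] = y x) :
    Wp ω (.forLt 24 22 outputVertex) s fun t s' => (t ≤ cs.length * 6 + 2 ∧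
      (∀ x ∈ cs, s'.mem 2 [(x : ℕ)] = y x) ∧
      ∀ x : Fin n, x ∉ cs → s'.mem 2 [(x : ℕ)] = s.mem 2 [(x : ℕ)]) ∧
      Frame (.forLt 24 22 outputVertex) s s' := by
  refine Wp.mono (Wp.forLt 4 (fun j s' => (∀ x ∈ cs.take j, s'.mem 2 [(x : ℕ)] = y x) ∧
    ∀ x : Fin n, x ∉ cs → s'.mem 2 [(x : ℕ)] = s.mem 2 [(x : ℕ)])
    rfl rfl hc.length h4 (by simp) ?_) ?_
  · rintro j hj s1 hf h24 ⟨hI, hother⟩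
    have hx : cs[j]? = some cs[j] := List.getElem?_eq_getElem hj
    have h4' : s1.mem 4 [b + j] = cs[j] := by rw [hf.mem 4 rfl]; exact hc.queue _ _ hx
    have h12' : s1.mem 12 [(cs[j] : ℕ)] = y cs[j] := by
      rw [hf.mem 12 rfl]; exact h12 _ (List.getElem_mem hj)
    have h20 : s1.reg 20 = b := (hf.reg 20 rfl).trans hc.start
    simp only [outputVertex, wp_seq, wp_add, wp_load, wp_store, List.map, MState.reg_setReg,
      MState.mem_setReg, h20, h24, h4', h12', Nat.reduceEqDiff, if_true, if_false]
    refine ⟨by norm_num, fun x hxm => ?_, fun x hxm => ?_⟩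
    · by_cases hxj : x = cs[j]
      · simp [hxj]
      · have hxm' : x ∈ cs.take j := by
          rw [List.take_add_one, hx] at hxm
          rcases List.mem_append.1 hxm with h | h
          · exact h
          · exact absurd (by simpa using h) hxj
        simp [Fin.val_inj, hxj, hI x hxm']
    · have hxj : x ≠ cs[j] := fun h => hxm (h ▸ List.getElem_mem hj)
      simp [Fin.val_inj, hxj, hother x hxm]
  · rintro t s' ⟨⟨ht, hI, hother⟩, hf⟩
    exact ⟨⟨ht, fun x hx => hI x (by simpa using hx), hother⟩, hf⟩

theorem wp_energyNbrs (hG : IsAdjacencyList G nbr) (hHG : H ≤ G) {v : Fin n}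
    (hs : HoldsField M G H nbr i s)
    (h12 : ∀ u, H.Adj v u → s.mem 12 [(u : ℕ)] = y u) (h11 : s.reg 11 = v)
    (hdeg : s.reg 12 = (nbr v).length) (h32 : s.reg 32 = y v) :
    Wp ω (.forLt 13 12 energyNbr) s fun t s' => (t ≤ (nbr v).length * 9 + 2 ∧
      open Classical in s'.rreg 2 = s.rreg 2 +
        ∑ u, if H.Adj v u ∧ u < v then M.ψ v u (y v) (y u) else 0) ∧
      Frame (.forLt 13 12 energyNbr) s s' := by
  classical
  set f : Fin n → ℝ := fun u => if H.Adj v u ∧ u < v then M.ψ v u (y v) (y u) else 0 with hfdef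
  refine Wp.mono (Wp.forLt 7 (fun k s' => s'.rreg 2 = s.rreg 2 + (((nbr v).take k).map f).sum)
    rfl rfl hdeg hs.one (by simp) ?_) ?_
  · intro k hk s1 hf h13 hI
    obtain ⟨u, hu⟩ : ∃ u, (nbr v)[k]? = some u := ⟨_, List.getElem?_eq_getElem hk⟩
    have hGvu : G.Adj v u := ((hG v).2 u).1 (List.mem_of_getElem? hu)
    have hs1 := hs.frame hf rfl
    have hm1 := hs1.graph.adj v k u hu
    have hm7 := hs1.cut v u hGvu
    have h11' : s1.reg 11 = v := (hf.reg 11 rfl).trans h11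
    have h32' : s1.reg 32 = y v := (hf.reg 32 rfl).trans h32
    have hsum : (((nbr v).take (k + 1)).map f).sum = (((nbr v).take k).map f).sum + f u := by
      rw [List.take_add_one, hu]; simp
    simp only [energyNbr, wp_seq, wp_load, wp_ifLt, wp_skip, wp_rload, wp_radd, List.map,
      MState.reg_setReg, MState.mem_setReg, h11', h13, hm1, Nat.reduceEqDiff, if_true, if_false,
      hs1.round, hm7, hs1.one, h32', hsum]
    by_cases hlt : u < v
    · rw [if_pos (by exact_mod_cast hlt)]
      by_cases hvu : H.Adj v u
      · have h12' : s1.mem 12 [(u : ℕ)] = y u := by rw [hf.mem 12 rfl]; exact h12 u hvu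
        have hpsi := hs1.psi v k u (y v) (y u) hu
        rw [if_pos (by simp [hvu])]
        refine ⟨by norm_num, ?_⟩
        simp [h12', hpsi, hI, hfdef, hlt, hvu, add_assoc]
      · rw [if_neg (by simp [hvu])]
        refine ⟨by norm_num, ?_⟩
        simp [hI, hfdef, hvu]
    · rw [if_neg (by exact_mod_cast hlt)]
      refine ⟨by norm_num, ?_⟩
      simp [hI, hfdef, hlt]
  · rintro t s' ⟨⟨ht, hI⟩, hf⟩
    refine ⟨⟨ht, ?_⟩, hf⟩
    rw [hI, List.take_length, ← List.sum_toFinset f (hG v).1]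
    congr 1
    refine Finset.sum_subset (Finset.subset_univ _) fun u _ hu => ?_
    have : ¬ H.Adj v u := fun h => hu (List.mem_toFinset.2 (((hG v).2 u).2 (hHG h)))
    simp [this]

theorem wp_energy (hG : IsAdjacencyList G nbr) (hHG : H ≤ G) (hD : ∀ v, (nbr v).length ≤ D)
    (hs : HoldsField M G H nbr i s) (hc : HoldsComp cs b s)
    (hclosed : ∀ v ∈ cs, ∀ u, H.Adj v u → u ∈ cs)
    (h12 : ∀ x ∈ cs, s.mem 12 [(x : ℕ)] = y x) (h2 : s.rreg 2 = 0) :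
    Wp ω (.forLt 24 22 energyVertex) s fun t s' => (t ≤ cs.length * (9 * D + 10) + 2 ∧
      s'.rreg 2 = listEnergy M H cs y) ∧ Frame (.forLt 24 22 energyVertex) s s' := by
  refine Wp.mono (Wp.forLt (9 * D + 8) (fun j s' => s'.rreg 2 = listEnergy M H (cs.take j) y)
    rfl rfl hc.length hs.one (by simp [h2, listEnergy]) ?_) ?_
  · intro j hj s1 hf h24 hI
    have hx : cs[j]? = some cs[j] := List.getElem?_eq_getElem hj
    have hs1 := hs.frame hf rfl
    have hc1 := hc.frame hf rfl
    have h4' := hc1.queue _ _ hx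
    have h12' : ∀ x ∈ cs, s1.mem 12 [(x : ℕ)] = y x := by rw [hf.mem 12 rfl]; exact h12
    have hv := h12' _ (List.getElem_mem hj)
    have hphi := hs1.phi cs[j] (y cs[j])
    simp only [energyVertex, wp_seq, wp_add, wp_load, wp_rload, wp_radd, List.map,
      MState.reg_setReg, MState.mem_setReg, MState.rmem_setReg, MState.rreg_setReg, MState.rreg_setRReg, h24, hc1.start, h4', hs1.graph.deg, hv,
      Nat.reduceEqDiff, if_true, if_false, hphi, hI]
    refine Wp.mono (wp_energyNbrs (v := cs[j]) (y := y) hG hHG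
      (hs1.congr (by simp) (by simp) rfl) (fun u hu => ?_) ?_ ?_ ?_) ?_
    · exact h12' u (hclosed _ (List.getElem_mem hj) u hu)
    · simp
    · simp
    · simp
    · rintro t s2 ⟨⟨ht, h2⟩, -⟩
      refine ⟨by have := hD cs[j]; omega, ?_⟩
      have e : listEnergy M H (cs.take (j + 1)) y =
          listEnergy M H (cs.take j) y + vertexEnergy M H y cs[j] := by
        rw [List.take_add_one, hx, listEnergy, List.map_append, List.sum_append]
        simp [listEnergy]
      rw [h2, e]
      simp [vertexEnergy, add_assoc]
  · rintro t s' ⟨⟨ht, hI⟩, hf⟩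
    exact ⟨⟨ht, by rw [hI, List.take_length]⟩, hf⟩

theorem wp_tryAssignment (hG : IsAdjacencyList G nbr) (hHG : H ≤ G)
    (hD : ∀ v, (nbr v).length ≤ D) (hq : 0 < q) {k N : ℕ} (hk : k < N) (hcs : cs.Nodup)
    (hs : HoldsField M G H nbr i s) (hc : HoldsComp cs b s)
    (hclosed : ∀ v ∈ cs, ∀ u, H.Adj v u → u ∈ cs) (h30 : s.reg 30 = k)
    (hdig : ∀ j < cs.length, ∀ k < N, s.mem 11 [j, k] = k / q ^ j % q) :
    Wp ω tryAssignment s fun t s' => t ≤ cs.length * (9 * D + 22) + 9 ∧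
      s'.rreg 1 = max (s.rreg 1) (listEnergy M H cs (assignment hq cs k)) ∧
      ((s'.rreg 1 = s.rreg 1 ∧ s'.mem 2 = s.mem 2) ∨
        s'.rreg 1 = listEnergy M H cs (assignment hq cs k) ∧
        (∀ x ∈ cs, s'.mem 2 [(x : ℕ)] = assignment hq cs k x) ∧
        ∀ x : Fin n, x ∉ cs → s'.mem 2 [(x : ℕ)] = s.mem 2 [(x : ℕ)]) := by
  refine wp_seq.2 (Wp.mono (wp_assign hq hk hcs hs.one hc h30 hdig) ?_)
  rintro t1 s1 ⟨⟨ht1, h12⟩, hf1⟩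
  have hs1 := hs.frame hf1 rfl
  have hc1 := hc.frame hf1 rfl
  simp only [wp_seq, wp_radd, hs1.zero, add_zero]
  refine Wp.mono (wp_energy (s := s1.setRReg 2 0) (y := assignment hq cs k) hG hHG hD
    (hs1.congr (by simp) (by simp) rfl) ⟨hc1.start, hc1.length, hc1.queue⟩ hclosed h12
    (by simp)) ?_
  rintro t2 s2 ⟨⟨ht2, h2⟩, hf2⟩
  have hs2 : HoldsField M G H nbr i s2 :=
    HoldsField.frame (hs1.congr (s' := s1.setRReg 2 0) (by simp) (by simp) rfl) hf2 rfl
  have hc2 : HoldsComp cs b s2 := HoldsComp.frame (s := s1.setRReg 2 0)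
    ⟨hc1.start, hc1.length, hc1.queue⟩ hf2 rfl
  have e1 : s2.rreg 1 = s.rreg 1 := by
    rw [hf2.rreg 1 rfl, ← hf1.rreg 1 rfl]; simp
  have e2 : s2.mem 2 = s.mem 2 := by
    rw [hf2.mem 2 rfl, ← hf1.mem 2 rfl]; simp
  have e12 : ∀ x ∈ cs, s2.mem 12 [(x : ℕ)] = assignment hq cs k x := by
    rw [hf2.mem 12 rfl]; exact h12
  have etime : cs.length * (9 * D + 22) = cs.length * 6 + cs.length * (9 * D + 10) +
    cs.length * 6 := by ring
  simp only [wp_ifRLt, wp_seq, wp_radd, wp_skip, hs2.zero, add_zero, h2, e1]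
  split_ifs with hlt
  · refine Wp.mono (wp_output (y := assignment hq cs k) (s := s2.setRReg 1 _) (by
      simpa using hs2.one) ⟨hc2.start, hc2.length, hc2.queue⟩ e12) ?_
    rintro t3 s3 ⟨⟨ht3, hin, hout⟩, hf3⟩
    have e3 : s3.rreg 1 = listEnergy M H cs (assignment hq cs k) := by
      rw [hf3.rreg 1 rfl]; simp
    refine ⟨by omega, by rw [e3, max_eq_right hlt.le], Or.inr ⟨e3, hin, fun x hx => ?_⟩⟩
    rw [hout x hx, MState.mem_setRReg, e2]
  · rw [max_eq_left (not_lt.1 hlt)]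
    exact ⟨by omega, rfl, Or.inl ⟨trivial, e2⟩⟩

theorem wp_mapRoot (hG : IsAdjacencyList G nbr) (hHG : H ≤ G)
    (hD : ∀ v, (nbr v).length ≤ D) (hq : 0 < q) (hcs : cs.Nodup) {r : ℕ}
    (hs : HoldsField M G H nbr i s) (h3 : s.reg 3 = q) (h5 : s.reg 5 = 0) (h8 : s.reg 8 = r)
    (hclosed : ∀ v ∈ cs, ∀ u, H.Adj v u → u ∈ cs)
    (hb : s.mem 8 [r] = b) (he : s.mem 9 [r] = b + cs.length)
    (hqueue : ∀ (j : ℕ) (x : Fin n), cs[j]? = some x → s.mem 4 [b + j] = x)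
    (hout : ∀ x ∈ cs, s.mem 2 [(x : ℕ)] = 0) :
    Wp ω mapRoot s fun t s' => (t ≤ 80 * ((D + 1) * (cs.length + 1) * q ^ (cs.length + 1)) ∧
      (∀ x : Fin n, x ∉ cs → s'.mem 2 [(x : ℕ)] = s.mem 2 [(x : ℕ)]) ∧
      ∃ y : Fin n → Fin q, (∀ x ∈ cs, s'.mem 2 [(x : ℕ)] = y x) ∧
        ∀ z, listEnergy M H cs z ≤ listEnergy M H cs y) ∧ Frame mapRoot s s' := by
  apply Wp.withFrame
  simp only [mapRoot, wp_seq, wp_load, wp_sub, List.map, MState.reg_setReg, MState.mem_setReg, h8,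
    hb, he, Nat.reduceEqDiff, if_true, if_false, Nat.add_sub_cancel_left, wp_radd]
  set s1 : MState := ((s.setReg 20 b).setReg 21 (b + cs.length)).setReg 22 cs.length with hs1def
  have hs1 : HoldsField M G H nbr i s1 := hs.congr (by simp [hs1def]) (by simp [hs1def]) rfl
  have hc1 : HoldsComp cs b s1 := ⟨by simp [hs1def], by simp [hs1def], hqueue⟩
  have h3' : s1.reg 3 = q := by simpa [hs1def] using h3
  refine Wp.mono (wp_powers hc1.length h3' hs1.one
    (by simpa [hs1def] using h5)) ?_
  rintro t2 s2 ⟨⟨ht2, h23, h10⟩, hf2⟩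
  have hs2 := hs1.frame hf2 rfl
  have hc2 := hc1.frame hf2 rfl
  have h3'' : s2.reg 3 = q := (hf2.reg 3 rfl).trans h3'
  refine Wp.mono (wp_digits hq h10 hc2.length h23 h3'' hs2.one) ?_
  rintro t3 s3 ⟨⟨ht3, hdig⟩, hf3⟩
  have hs3 := hs2.frame hf3 rfl
  have hc3 := hc2.frame hf3 rfl
  have h23' : s3.reg 23 = q ^ cs.length := (hf3.reg 23 rfl).trans h23
  have e3 : s3.mem 2 = s.mem 2 := by rw [hf3.mem 2 rfl, hf2.mem 2 rfl]; rfl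
  simp only [hs3.zero, add_zero]
  refine Wp.mono (Wp.forLt (cs.length * (9 * D + 22) + 9) (fun k s' =>
    (∀ x : Fin n, x ∉ cs → s'.mem 2 [(x : ℕ)] = s.mem 2 [(x : ℕ)]) ∧
    (∀ k' < k, listEnergy M H cs (assignment hq cs k') ≤ s'.rreg 1) ∧
    ∃ y : Fin n → Fin q, (∀ x ∈ cs, s'.mem 2 [(x : ℕ)] = y x) ∧ s'.rreg 1 ≤ listEnergy M H cs y)
    rfl rfl (by simpa using h23') (by simpa using hs3.one) ?_ ?_) ?_
  -- Before any trial the output cells hold `0` and the best value is `0`, which the constant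
  -- labeling `0` attains or exceeds. If no labeling has positive energy, nothing is ever written
  -- and this labeling is optimal.
  · refine ⟨fun x _ => by simp [e3], by simp, fun _ => ⟨0, hq⟩, fun x hx => ?_, ?_⟩
    · simp [e3, hout x hx]
    · simpa using listEnergy_nonneg _ _ _ _
  · rintro k hk s4 hf4 h30 ⟨hI1, hI2, z, hz, hle⟩
    have hs4 : HoldsField M G H nbr i s4 :=
      HoldsField.frame (hs3.congr (s' := s3.setRReg 1 0) (by simp) (by simp) rfl) hf4 rfl
    have hc4 : HoldsComp cs b s4 := HoldsComp.frame (s := s3.setRReg 1 0)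
      ⟨hc3.start, hc3.length, hc3.queue⟩ hf4 rfl
    refine Wp.mono (wp_tryAssignment hG hHG hD hq hk hcs hs4 hc4 hclosed h30
      (by rw [hf4.mem 11 rfl]; exact hdig)) ?_
    rintro t s5 ⟨ht, hmax, hcase⟩
    refine ⟨ht, fun x hx => ?_, fun k' hk' => ?_, ?_⟩
    · rcases hcase with ⟨-, h⟩ | ⟨-, -, h⟩
      · simp [h, hI1 x hx]
      · simp [h x hx, hI1 x hx]
    · rw [MState.rreg_setReg, hmax]
      rcases Nat.lt_succ_iff_lt_or_eq.1 hk' with hk' | rfl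
      · exact (hI2 k' hk').trans (le_max_left _ _)
      · exact le_max_right _ _
    · rcases hcase with ⟨h1, h2⟩ | ⟨h1, h2, -⟩
      · exact ⟨z, by simpa [h2] using hz, by simpa [h1] using hle⟩
      · exact ⟨_, by simpa using h2, by simp [h1]⟩
  · rintro t s5 ⟨⟨ht, hI1, hI2, z, hz, hle⟩, -⟩
    refine ⟨?_, hI1, z, hz, fun w => ?_⟩
    · have hQ : 1 ≤ q ^ cs.length := Nat.one_le_pow _ _ hq
      rw [pow_succ]
      -- With `q ^ m` abstracted to `Q`, the spare factor `q` of the bound absorbs the `3 * q * m`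
      -- steps for the powers. Once `q` and `Q` are successors, both sides are polynomials with
      -- nonnegative coefficients.
      generalize q ^ cs.length = Q at *
      generalize cs.length = m at *
      obtain ⟨q, rfl⟩ : ∃ q', q = q' + 1 := ⟨q - 1, by omega⟩
      obtain ⟨Q, rfl⟩ : ∃ Q', Q = Q' + 1 := ⟨Q - 1, by omega⟩
      have : t2 + t3 + t + 10 ≤ m * (3 * (q + 1) + 7) + 3 + (m * ((Q + 1) * 9 + 7) + 2) +
        ((Q + 1) * (m * (9 * D + 22) + 9 + 2) + 2) + 10 := by omega
      have h2 : m * (3 * (q + 1) + 7) + 3 + (m * ((Q + 1) * 9 + 7) + 2) +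
        ((Q + 1) * (m * (9 * D + 22) + 9 + 2) + 2) + 10 ≤
          80 * ((D + 1) * (m + 1) * ((Q + 1) * (q + 1))) := by
        ring_nf
        nlinarith [Nat.zero_le (m * q), Nat.zero_le (m * Q), Nat.zero_le (m * q * Q),
          Nat.zero_le (D * m), Nat.zero_le (D * m * Q), Nat.zero_le (D * m * Q * q),
          Nat.zero_le (D * m * q), Nat.zero_le (D * Q), Nat.zero_le (D * q),
          Nat.zero_le (D * Q * q), Nat.zero_le (Q * q)]
      omega
    · obtain ⟨k, hk, hkw⟩ := exists_assignment_eq hq cs w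
      rw [← listEnergy_congr hclosed hkw]
      exact (hI2 k hk).trans hle

end Map

/-! ### The whole program -/

namespace Prog

/-- Finds optimal assignments of all components. -/
def mapAll : Cmd := .forLt 8 0 mapRoot

/-- If every edge is going to be cut, namely if `Λ = 1` and there is a round at all, makes the
adjacency lists empty. -/
def dropEdges : Cmd :=
  .ifLt 5 1 (.ifLt 4 2 .skip (.forLt 8 0 (.store 0 [8] 5))) .skip

/-- The decomposition and the optimization. -/
def decomposeAndSolve : Cmd := .seq rounds (.seq bfsAll mapAll)

/-- The algorithm `Mode` with the decomposition `Minor-e`. -/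
def mode : Cmd := .seq (.set 4 1) (.seq dropEdges decomposeAndSolve)

end Prog

/-! ### Comparison of the computed energies with those in the definition of `Mode`. -/

section CompEnergy

variable {n q : ℕ}

open SimpleGraph

open Classical in
/-- The energy of the component of `H` with root `r`. -/
noncomputable def compEnergy (M : MRF (Fin n) (Fin q)) (H : SimpleGraph (Fin n)) (r : Fin n)
    (y : Fin n → Fin q) : ℝ :=
  ∑ v with H.rootOf v = r, vertexEnergy M H y v

theorem listEnergy_eq_compEnergy (M : MRF (Fin n) (Fin q)) {H : SimpleGraph (Fin n)}
    {cs : List (Fin n)} {r : Fin n} (hn : cs.Nodup) (hcs : ∀ x, x ∈ cs ↔ H.rootOf x = r)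
    (y : Fin n → Fin q) : listEnergy M H cs y = compEnergy M H r y := by
  classical
  rw [listEnergy, compEnergy, ← List.sum_toFinset _ hn]
  exact Finset.sum_congr (by ext x; simp [hcs]) fun _ _ => rfl

theorem compEnergy_congr {M : MRF (Fin n) (Fin q)} {H : SimpleGraph (Fin n)} {r : Fin n}
    {y z : Fin n → Fin q} (h : ∀ v, H.rootOf v = r → y v = z v) :
    compEnergy M H r y = compEnergy M H r z := by
  classical
  unfold compEnergy vertexEnergy
  refine Finset.sum_congr rfl fun v hv => ?_
  have hv : H.rootOf v = r := (Finset.mem_filter.1 hv).2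
  rw [h v hv]
  congr 1
  refine Finset.sum_congr rfl fun u _ => ?_
  split_ifs with hu
  · rw [h u (hu.1.reachable.rootOf_eq ▸ hv)]
  · rfl

/-- An unordered edge corresponds to the ordered pair with the larger vertex first, and adjacency
forces the second vertex into the same component. -/
theorem componentEnergy_eq_compEnergy (M : MRF (Fin n) (Fin q)) (B : Set (Sym2 (Fin n)))
    (v₀ : Fin n) (y : Fin n → Fin q) :
    M.componentEnergy B ((M.graph.deleteEdges B).connectedComponentMk v₀) y =
      compEnergy M (M.graph.deleteEdges B) ((M.graph.deleteEdges B).rootOf v₀) y := by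
  classical
  unfold MRF.componentEnergy compEnergy vertexEnergy
  have hmem : ∀ v, v ∈ ((M.graph.deleteEdges B).connectedComponentMk v₀).supp ↔
      (M.graph.deleteEdges B).rootOf v = (M.graph.deleteEdges B).rootOf v₀ := fun v => by
    rw [ConnectedComponent.mem_supp_iff, ConnectedComponent.eq, rootOf_eq_iff]
  rw [Finset.sum_add_distrib]
  congr 1
  · exact Finset.sum_congr (by ext v; simp only [Finset.mem_filter, hmem]) fun _ _ => rfl
  · rw [← Finset.sum_product']
    refine Eq.trans (Eq.trans ?_ (Finset.sum_filter
      (fun p : Fin n × Fin n => (M.graph.deleteEdges B).Adj p.1 p.2 ∧ p.2 < p.1)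
      (fun p => M.ψ p.1 p.2 (y p.1) (y p.2)))) (Finset.sum_congr rfl fun p _ => by congr)
    symm
    refine Finset.sum_bij (fun p _ => s(p.1, p.2)) ?_ ?_ ?_ ?_
    · rintro ⟨v, u⟩ hp
      simp only [Finset.mem_filter, Finset.mem_product, Finset.mem_univ, true_and] at hp ⊢
      obtain ⟨⟨hv, -⟩, hvu, -⟩ := hp
      refine ⟨hvu, fun x hx => (hmem x).2 ?_⟩
      rcases Sym2.mem_iff.1 hx with rfl | rfl
      · exact hv
      · rw [← hvu.reachable.rootOf_eq, hv]
    · rintro ⟨v, u⟩ hp ⟨v', u'⟩ hp' h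
      simp only [Finset.mem_filter, Finset.mem_product, Finset.mem_univ, true_and] at hp hp'
      rcases Sym2.eq_iff.1 h with ⟨rfl, rfl⟩ | ⟨rfl, rfl⟩
      · rfl
      · exact absurd hp.2.2 (lt_asymm hp'.2.2)
    · intro e he
      induction e using Sym2.ind with
      | _ a b =>
        simp only [Finset.mem_filter, Finset.mem_univ, true_and, mem_edgeSet] at he
        obtain ⟨hab, hc⟩ := he
        have ha := (hmem a).1 (hc a (by simp))
        have hb := (hmem b).1 (hc b (by simp))
        rcases lt_or_gt_of_ne hab.ne with h | h
        · exact ⟨(b, a), by simpa [hb, h] using hab.symm, Sym2.eq_swap⟩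
        · exact ⟨(a, b), by simpa [ha, h] using hab, rfl⟩
    · rintro ⟨v, u⟩ -
      rfl

theorem isModeOutput_of_compEnergy {M : MRF (Fin n) (Fin q)} {B : Set (Sym2 (Fin n))}
    {x : Fin n → Fin q}
    (h : ∀ r y, compEnergy M (M.graph.deleteEdges B) r y ≤
      compEnergy M (M.graph.deleteEdges B) r x) : M.IsModeOutput B x := by
  intro c y
  induction c using ConnectedComponent.ind with
  | _ v => rw [componentEnergy_eq_compEnergy, componentEnergy_eq_compEnergy]; exact h _ _

end CompEnergy

/-! ### Correctness and step count of the whole program. -/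

section Solve

variable {n q i Λ D r K : ℕ} {ω : ℕ → ℕ → ℕ} {M : MRF (Fin n) (Fin q)}
  {G H : SimpleGraph (Fin n)} {nbr : Fin n → List (Fin n)} {s : MState} {a : ℕ → ℕ}

open Prog SimpleGraph

theorem wp_mapAll (hG : IsAdjacencyList G nbr) (hHG : H ≤ G) (hD : ∀ v, (nbr v).length ≤ D)
    (hq : 0 < q) (hs : HoldsField M G H nbr i s) (h0 : s.reg 0 = n) (h3 : s.reg 3 = q)
    (h5 : s.reg 5 = 0) {l : List (Fin n)} (hS : SearchInv Λ i a H l n s)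
    (hK : ∀ r, (Finset.univ.filter fun x => H.rootOf x = r).card ≤ K)
    (hout : ∀ x : Fin n, s.mem 2 [(x : ℕ)] = 0) :
    Wp ω mapAll s fun t s' => t ≤ 160 * (n * (D + 1) * q ^ (K + 1)) + 2 * n + 2 ∧
      ∃ y : Fin n → Fin q, Outputs s' y ∧ ∀ r z, compEnergy M H r z ≤ compEnergy M H r y := by
  classical
  set T : ℕ := 80 * ((D + 1) * q ^ (K + 1)) with hT
  -- Each candidate is charged the size of its component plus one; a vertex that is no root has an
  -- empty segment and pays only for the one. The charges add up to at most `2 * n`, hence `160 = 2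
  -- * 80` at the end.
  refine Wp.mono (Wp.forLt_acc (fun k t s' =>
    (∀ x : Fin n, k ≤ H.rootOf x → s'.mem 2 [(x : ℕ)] = 0) ∧
    (∃ y : Fin n → Fin q, (∀ x : Fin n, (H.rootOf x : ℕ) < k → s'.mem 2 [(x : ℕ)] = y x) ∧
      ∀ r : Fin n, (r : ℕ) < k → ∀ z, compEnergy M H r z ≤ compEnergy M H r y) ∧
    t ≤ T * ((Finset.univ.filter fun x => (H.rootOf x : ℕ) < k).card + k) + 2 * k)
    rfl rfl h0 hs.one ?_ ?_) ?_
  · exact ⟨fun x _ => hout x, ⟨fun _ => ⟨0, hq⟩, by simp, by simp⟩, by simp⟩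
  · rintro k hk t s1 hf h8 ⟨hI1, ⟨y, hy, hopt⟩, ht⟩
    obtain ⟨b, cs, hn, hcs, hb, he, hl⟩ := hS.segment ⟨k, hk⟩ hk
    have hclosed : ∀ v ∈ cs, ∀ u, H.Adj v u → u ∈ cs := fun v hv u hvu => by
      rw [hcs] at hv ⊢; rw [← hvu.reachable.rootOf_eq, hv]
    have hlen : cs.length = (Finset.univ.filter fun x => H.rootOf x = ⟨k, hk⟩).card := by
      rw [← List.toFinset_card_of_nodup hn]
      congr 1; ext x; simp [hcs]
    refine Wp.mono (wp_mapRoot (b := b) hG hHG hD hq hn (hs.frame hf rfl)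
      ((hf.reg 3 rfl).trans h3)
      ((hf.reg 5 rfl).trans h5) h8 hclosed (by rw [hf.mem 8 rfl]; exact hb)
      (by rw [hf.mem 9 rfl]; exact he) (fun j x hj => ?_) (fun x hx => hI1 x ?_)) ?_
    · rw [hf.mem 4 rfl]; exact hS.queue.queue _ _ (hl j x hj)
    · rw [(hcs x).1 hx]
    · rintro t' s2 ⟨⟨ht', hother, y', hy', hopt'⟩, -⟩
      simp only [listEnergy_eq_compEnergy M hn hcs] at hopt'
      refine ⟨fun x hx => ?_, ⟨fun x => if H.rootOf x = ⟨k, hk⟩ then y' x else y x,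
        fun x hx => ?_, fun r hr z => ?_⟩, ?_⟩
      · rw [MState.mem_setReg, hother x fun h => ?_]
        · exact hI1 x (by omega)
        · rw [(hcs x).1 h] at hx; simp at hx
      · dsimp only [MState.mem_setReg]
        split_ifs with h
        · exact hy' x ((hcs x).2 h)
        · have h' : (H.rootOf x : ℕ) ≠ k := fun h' => h (Fin.ext h')
          rw [hother x fun h'' => h ((hcs x).1 h'')]
          exact hy x (by omega)
      · rcases Nat.lt_succ_iff_lt_or_eq.1 hr with hr | hr
        · refine (hopt r hr z).trans (compEnergy_congr fun v hv => ?_).le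
          rw [if_neg]
          rintro h; rw [← hv, h] at hr; simp at hr
        · have hr' : r = ⟨k, hk⟩ := Fin.ext hr
          subst hr'
          refine (hopt' z).trans (compEnergy_congr fun v hv => ?_).le
          rw [if_pos hv]
      · have hcard : (Finset.univ.filter fun x => (H.rootOf x : ℕ) < k + 1).card =
            (Finset.univ.filter fun x => (H.rootOf x : ℕ) < k).card + cs.length := by
          rw [hlen, ← Finset.card_union_of_disjoint]
          · congr 1; ext x; simp [Fin.ext_iff]; omega
          · rw [Finset.disjoint_filter]
            rintro x - hx hx'
            rw [hx'] at hx; simp at hx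
        have hpow : q ^ (cs.length + 1) ≤ q ^ (K + 1) :=
          Nat.pow_le_pow_right hq (by have := hK ⟨k, hk⟩; omega)
        have h1 : 80 * ((D + 1) * (cs.length + 1) * q ^ (cs.length + 1)) ≤
            T * (cs.length + 1) := by
          calc _ ≤ 80 * ((D + 1) * (cs.length + 1) * q ^ (K + 1)) := by gcongr
            _ = T * (cs.length + 1) := by rw [hT]; ring
        rw [hcard]
        have e : T * ((Finset.univ.filter fun x => (H.rootOf x : ℕ) < k).card + cs.length +
          (k + 1)) = T * ((Finset.univ.filter fun x => (H.rootOf x : ℕ) < k).card + k) +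
            T * (cs.length + 1) := by ring
        omega
  · rintro t s' ⟨t₁, rfl, -, ⟨y, hy, hopt⟩, ht⟩
    refine ⟨?_, y, fun x => hy x (Fin.is_lt _), fun r => hopt r r.2⟩
    have hcard : (Finset.univ.filter fun x => (H.rootOf x : ℕ) < n).card ≤ n := by
      simpa only [Finset.card_univ, Fintype.card_fin] using Finset.card_le_univ (Finset.univ.filter fun x => (H.rootOf x : ℕ) < n)
    have : T * ((Finset.univ.filter fun x => (H.rootOf x : ℕ) < n).card + n) ≤ T * (n + n) := by
      gcongr
    have e : T * (n + n) = 160 * (n * (D + 1) * q ^ (K + 1)) := by rw [hT]; ring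
    omega

/-- The tables of the potentials and the adjacency lists of an input. -/
structure HoldsInput (M : MRF (Fin n) (Fin q)) (nbr : Fin n → List (Fin n)) (r Λ : ℕ)
    (s : MState) : Prop where
  size : s.reg 0 = n
  rnds : s.reg 1 = r
  lam : s.reg 2 = Λ
  alph : s.reg 3 = q
  one : s.reg 4 = 1
  zero : s.reg 5 = 0
  rzero : s.rreg 0 = 0
  graph : HoldsGraph nbr s
  uncut : ∀ v u : ℕ, s.mem 7 [0, v, u] = 0
  out : ∀ x : Fin n, s.mem 2 [(x : ℕ)] = 0
  phi : ∀ (v : Fin n) (x : Fin q), s.rmem 0 [(v : ℕ), (x : ℕ)] = M.φ v x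
  psi : ∀ (v : Fin n) (k : ℕ) (u : Fin n) (x y : Fin q), (nbr v)[k]? = some u →
    s.rmem 1 [(v : ℕ), k, (x : ℕ), (y : ℕ)] = M.ψ v u x y

/-- The graph `G` in the adjacency lists need not be the graph of `M`: after `dropEdges` the lists
describe `⊥`. -/
theorem wp_decomposeAndSolve (hn : 0 < n) (hG : IsAdjacencyList G nbr)
    (hD : ∀ v, (nbr v).length ≤ D) (hq : 0 < q) (hs : HoldsInput M nbr r Λ s)
    {a : ℕ → Fin n → Fin Λ} (ha : ∀ i < r, ∀ v : Fin n, ω i v = a i v)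
    (hK : ∀ c, (Finset.univ.filter fun x =>
      (cutGraph G (minRule n) a r).rootOf x = c).card ≤ K) :
    Wp ω decomposeAndSolve s fun t s' => t ≤ 300 * ((r + 1) * n * (D + 1) * q ^ (K + 1)) ∧
      ∃ y : Fin n → Fin q, Outputs s' y ∧ ∀ c z,
        compEnergy M (cutGraph G (minRule n) a r) c z ≤
          compEnergy M (cutGraph G (minRule n) a r) c y := by
  classical
  have hcut0 : HoldsCut G G 0 s := fun v u hvu => by rw [hs.uncut]; simp [hvu]
  refine wp_seq.2 (Wp.mono (wp_rounds hG hD ha hs.size hs.rnds hs.lam hs.one hs.zero hs.graph hcut0) ?_)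
  rintro t1 s1 ⟨⟨ht1, hcut, h6⟩, hf1⟩
  have hc1 : HoldsConsts n Λ r s1 := ⟨(hf1.reg 0 rfl).trans hs.size, (hf1.reg 2 rfl).trans hs.lam,
    (hf1.reg 4 rfl).trans hs.one, (hf1.reg 5 rfl).trans hs.zero, h6⟩
  have hg1 := hs.graph.congr (hf1.mem 0 rfl) (hf1.mem 1 rfl)
  -- This last search serves only to list the components. Its counters come from row `r` of `ω`,
  -- about which nothing is assumed, and they are not read again.
  refine wp_seq.2 (Wp.mono (wp_bfsAll hG (cutGraph_le G (minRule n) a r) hD hc1 hg1 hcut) ?_)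
  rintro t2 s2 ⟨⟨ht2, l, hS⟩, hf2⟩
  have hs2 : HoldsField M G (cutGraph G (minRule n) a r) nbr r s2 :=
    ⟨hg1.congr (hf2.mem 0 rfl) (hf2.mem 1 rfl), hcut.congr (hf2.mem 7 rfl),
      by rw [hf2.rmem 0 rfl, hf1.rmem 0 rfl]; exact hs.phi,
      by rw [hf2.rmem 1 rfl, hf1.rmem 1 rfl]; exact hs.psi,
      (hf2.reg 4 rfl).trans hc1.one, (hf2.reg 6 rfl).trans h6,
      (hf2.rreg 0 rfl).trans ((hf1.rreg 0 rfl).trans hs.rzero)⟩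
  refine Wp.mono (wp_mapAll hG (cutGraph_le G (minRule n) a r) hD hq hs2
    ((hf2.reg 0 rfl).trans hc1.n) ((hf2.reg 3 rfl).trans ((hf1.reg 3 rfl).trans hs.alph))
    ((hf2.reg 5 rfl).trans hc1.zero) hS hK
    (by rw [hf2.mem 2 rfl, hf1.mem 2 rfl]; exact hs.out)) ?_
  rintro t3 s3 ⟨ht3, hy⟩
  refine ⟨?_, hy⟩
  have hQ : 1 ≤ q ^ (K + 1) := Nat.one_le_pow _ _ hq
  set X := n * (D + 1) with hX
  have hX1 : n ≤ X := Nat.le_mul_of_pos_right _ (by omega)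
  have h1 : n * (24 * D + 48) ≤ 48 * X := by rw [hX]; nlinarith [Nat.zero_le (n * D)]
  have h2 : n * (12 * D + 40) ≤ 40 * X := by rw [hX]; nlinarith [Nat.zero_le (n * D)]
  have h3 : r * (n * (24 * D + 48) + 15) ≤ r * (63 * X) := Nat.mul_le_mul_left _ (by omega)
  have h4 : t1 + (t2 + t3) ≤ 63 * (r * X) + 200 * (X * q ^ (K + 1)) + 18 * X := by
    have : X * 1 ≤ X * q ^ (K + 1) := Nat.mul_le_mul_left _ hQ
    have e : r * (63 * X) = 63 * (r * X) := by ring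
    omega
  have h5 : r * X * 1 ≤ r * X * q ^ (K + 1) := Nat.mul_le_mul_left _ hQ
  have h6 : X * 1 ≤ X * q ^ (K + 1) := Nat.mul_le_mul_left _ hQ
  have e : (r + 1) * n * (D + 1) * q ^ (K + 1) = r * X * q ^ (K + 1) + X * q ^ (K + 1) := by
    rw [hX]; ring
  rw [e]
  omega

/-- Modulo `1` every level is a cut level. -/
theorem cutGraph_eq_bot {ρ : RootRule (Fin n)} {a : ℕ → Fin n → Fin Λ} (hΛ : Λ = 1)
    (hr : 0 < r) : cutGraph G ρ a r = ⊥ := by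
  obtain ⟨r, rfl⟩ := Nat.exists_eq_add_of_lt hr
  rw [zero_add, cutGraph, eq_bot_iff]
  intro v u hvu
  rw [deleteEdges_adj] at hvu
  have key : ∀ (m : ℕ) (f : Fin Λ), ∃ k, m = k * Λ + f :=
    fun m f => ⟨m, by have := f.2; subst hΛ; omega⟩
  exact hvu.2 ((mem_bfsCut_iff hvu.1).2 (key _ _))

theorem holdsInput_inputState (M : MRF (Fin n) (Fin q)) (nbr : Fin n → List (Fin n)) (r Λ : ℕ) :
    HoldsInput M nbr r Λ ((inputState M nbr r Λ).setReg 4 1) where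
  size := by simp [inputState]
  rnds := by simp [inputState]
  lam := by simp [inputState]
  alph := by simp [inputState]
  one := by simp
  zero := by simp [inputState]
  rzero := by simp [inputState]
  graph := ⟨fun v => by simp [inputState], fun v k u h => by simp [inputState, nbrAt, h]⟩
  uncut v u := by simp [inputState]
  out x := by simp [inputState]
  phi v x := by simp [inputState]
  psi v k u x y h := by simp [inputState, nbrAt, h]

/-- The factor for the degree must disappear when `Λ = 1`: for huge `ε` the hypothesis of (b) allows
`d*` to be of order `n`, as for a star, and `n * (D + 1)` would be quadratic. -/
theorem wp_mode (hn : 0 < n) (hq : 0 < q) (hΛ : 0 < Λ) {M : MRF (Fin n) (Fin q)}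
    (hG : IsAdjacencyList M.graph nbr) (hD : ∀ v, (nbr v).length ≤ D)
    {a : ℕ → Fin n → Fin Λ} (ha : ∀ i < r, ∀ v : Fin n, ω i v = a i v)
    (hK : ∀ c, (Finset.univ.filter fun x =>
      (cutGraph M.graph (minRule n) a r).rootOf x = c).card ≤ K) :
    Wp ω mode (inputState M nbr r Λ) fun t s' =>
      t ≤ 310 * ((r + 1) * n * ((if 0 < r ∧ Λ = 1 then 0 else D) + 1) * q ^ (K + 1)) ∧
      ∃ y : Fin n → Fin q, Outputs s' y ∧ ∀ c z,
        compEnergy M (cutGraph M.graph (minRule n) a r) c z ≤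
          compEnergy M (cutGraph M.graph (minRule n) a r) c y := by
  classical
  have hs := holdsInput_inputState M nbr r Λ
  have hbound : ∀ d, n ≤ (r + 1) * n * (d + 1) * q ^ (K + 1) := fun d =>
    calc n = 1 * n * 1 * 1 := by ring
      _ ≤ (r + 1) * n * (d + 1) * q ^ (K + 1) := by
        gcongr
        · omega
        · omega
        · exact Nat.one_le_pow _ _ hq
  unfold mode
  simp only [wp_seq, wp_set, dropEdges, wp_ifLt, hs.zero, hs.rnds, hs.one, hs.lam, wp_skip]
  generalize (inputState M nbr r Λ).setReg 4 1 = s at hs ⊢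
  by_cases hr : 0 < r
  · by_cases h1 : Λ = 1
    · simp only [hr, h1, lt_irrefl, if_true, if_false, and_self]
      refine Wp.mono (Wp.forLt 1 (fun k s' => (∀ v < k, s'.mem 0 [v] = 0)) rfl rfl hs.size hs.one
        (by simp) ?_) ?_
      · rintro k hk s' hf h8 hI
        have h5 : s'.reg 5 = 0 := (hf.reg 5 rfl).trans hs.zero
        simp only [wp_store, List.map, h8, h5, MState.mem_setReg, MState.mem_setMem]
        refine ⟨le_rfl, fun x hx => ?_⟩
        by_cases hxk : x = k
        · simp [hxk]
        · simp [hxk, hI x (by omega)]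
      · rintro t1 s1 ⟨⟨ht1, h0⟩, hf1⟩
        have hs1 : HoldsInput M (fun _ => []) r Λ s1 :=
          ⟨(hf1.reg 0 rfl).trans hs.size, (hf1.reg 1 rfl).trans hs.rnds, (hf1.reg 2 rfl).trans hs.lam,
            (hf1.reg 3 rfl).trans hs.alph, (hf1.reg 4 rfl).trans hs.one,
            (hf1.reg 5 rfl).trans hs.zero, (hf1.rreg 0 rfl).trans hs.rzero,
            ⟨fun v => h0 v v.2, by simp⟩, by rw [hf1.mem 7 rfl]; exact hs.uncut,
            by rw [hf1.mem 2 rfl]; exact hs.out, by rw [hf1.rmem 0 rfl]; exact hs.phi, by simp⟩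
        -- The first round leaves no edge, so starting without edges ends in the same graph.
        have hbot : cutGraph (⊥ : SimpleGraph (Fin n)) (minRule n) a r =
            cutGraph M.graph (minRule n) a r := by
          rw [cutGraph_eq_bot h1 hr, cutGraph_eq_bot h1 hr]
        refine Wp.mono (wp_decomposeAndSolve (G := ⊥) (D := 0) (K := K) hn
          (fun v => ⟨List.nodup_nil, by simp⟩) (by simp) hq hs1 ha (by rw [hbot]; exact hK)) ?_
        rintro t s' ⟨ht, hy⟩
        rw [hbot] at hy
        refine ⟨?_, hy⟩
        have := hbound 0
        omega
    · rw [if_pos hr, if_pos (by omega), if_neg (by tauto)]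
      refine Wp.mono (wp_decomposeAndSolve (K := K) hn hG hD hq hs ha hK) ?_
      rintro t s' ⟨ht, hy⟩
      refine ⟨?_, hy⟩
      have := hbound D
      omega
  · rw [if_neg hr, if_neg (by tauto)]
    refine Wp.mono (wp_decomposeAndSolve (K := K) hn hG hD hq hs ha hK) ?_
    rintro t s' ⟨ht, hy⟩
    refine ⟨?_, hy⟩
    have := hbound D
    omega

/-- Draws for all rounds that extend the given ones. -/
def extendDraws (hΛ : 0 < Λ) (L : Draws n r Λ) (i : ℕ) : Fin n → Fin Λ :=
  if h : i < r then L ⟨i, h⟩ else fun _ => ⟨0, hΛ⟩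

theorem drawSource_eq_extendDraws (hΛ : 0 < Λ) (L : Draws n r Λ) :
    ∀ i < r, ∀ v : Fin n, drawSource L i v = extendDraws hΛ L i v := by
  intro i hi v
  simp [drawSource, extendDraws, hi]

theorem deleteEdges_minorE_eq_cutGraph (hΛ : 0 < Λ) (ρ : RootRule (Fin n)) (L : Draws n r Λ) :
    G.deleteEdges (minorE G ρ r L) = cutGraph G ρ (extendDraws hΛ L) r :=
  deleteEdges_minorE G ρ _ r L fun i => by simp [extendDraws]

theorem implementsMode_mode : ImplementsMode mode := by
  intro n q r Λ hn hq hΛ M nbr hG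
  refine ⟨minRule n, fun L => ?_⟩
  -- The step count is discarded here, so the trivial bounds `n` for degrees and component sizes
  -- suffice.
  obtain ⟨t, s, he, -, y, hout, hopt⟩ := wp_mode (ω := drawSource L) (D := n) (K := n) hn hq hΛ hG
    (fun v => by simpa using (hG v).1.length_le_card) (drawSource_eq_extendDraws hΛ L)
    (fun c => by simpa using Finset.card_le_univ (α := Fin n) _)
  refine ⟨t, s, y, he, hout, isModeOutput_of_compEnergy ?_⟩
  rw [deleteEdges_minorE_eq_cutGraph hΛ]
  exact hopt

theorem time_mode_le (hn : 0 < n) (hq : 0 < q) (hΛ : 0 < Λ) {M : MRF (Fin n) (Fin q)}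
    (hG : IsAdjacencyList M.graph nbr) (hD : ∀ v, (nbr v).length ≤ D) {L : Draws n r Λ}
    (hK : ∀ c, (Finset.univ.filter fun x =>
      (cutGraph M.graph (minRule n) (extendDraws hΛ L) r).rootOf x = c).card ≤ K)
    {t : ℕ} {s : MState} (he : Exec (drawSource L) mode (inputState M nbr r Λ) t s) :
    t ≤ 310 * ((r + 1) * n * ((if 0 < r ∧ Λ = 1 then 0 else D) + 1) * q ^ (K + 1)) := by
  obtain ⟨t', s', he', ht, -⟩ := wp_mode hn hq hΛ hG hD (drawSource_eq_extendDraws hΛ L) hK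
  rw [(he.deterministic he').1]
  exact ht

end Solve

/-! ### The approximation guarantee -/

section Approximation

variable {n Λ : ℕ}

-- The condition forces `ℓ v = m % Λ`, so replacing the value at `v` by any of the `Λ` numbers is
-- injective on pairs.
open Classical in
theorem card_draw_eq_le (v : Fin n) (m : ℕ) :
    (Finset.univ.filter fun ℓ : Fin n → Fin Λ => ∃ k, m = k * Λ + ℓ v).card * Λ ≤
      Fintype.card (Fin n → Fin Λ) := by
  rw [← Finset.card_fin Λ, ← Finset.card_product, Finset.card_fin]
  refine Finset.card_le_card_of_injOn (t := Finset.univ)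
    (fun p : (Fin n → Fin Λ) × Fin Λ => Function.update p.1 v p.2) (by simp) ?_
  rintro ⟨ℓ, a⟩ h ⟨ℓ', a'⟩ h' heq
  simp only [Finset.coe_product, Set.mem_prod, Finset.mem_coe, Finset.mem_filter,
    Finset.mem_univ, true_and, and_true] at h h'
  have ha : a = a' := by simpa using congrFun heq v
  have hv : ℓ v = ℓ' v := by
    obtain ⟨k, hk⟩ := h
    obtain ⟨k', hk'⟩ := h'
    have h1 : m % Λ = ℓ v := by rw [hk, Nat.mul_add_mod_of_lt (ℓ v).2]
    have h2 : m % Λ = ℓ' v := by rw [hk', Nat.mul_add_mod_of_lt (ℓ' v).2]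
    exact Fin.ext (h1.symm.trans h2)
  refine Prod.ext (funext fun w => ?_) ha
  by_cases hw : w = v
  · rw [hw]; exact hv
  · simpa [hw] using congrFun heq w

-- Counting form of `P(e ∈ B) ≤ r / Λ`. Splitting off the last round conditions on the earlier draws
-- `L'`: if these already cut `e`, the whole fibre counts; otherwise component and level of `e` are
-- fixed and `card_draw_eq_le` bounds the fibre.
open Classical in
theorem card_minorE_le (G : SimpleGraph (Fin n)) (ρ : RootRule (Fin n)) (e : Sym2 (Fin n))
    (r : ℕ) : (Finset.univ.filter fun L : Draws n r Λ => e ∈ minorE G ρ r L).card * Λ ≤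
      r * Fintype.card (Draws n r Λ) := by
  induction r with
  | zero => simp [minorE]
  | succ r ih =>
    set X := Fintype.card (Fin n → Fin Λ) with hX
    have hcard : Fintype.card (Draws n (r + 1) Λ) = X * Fintype.card (Draws n r Λ) := by
      rw [hX, ← Fintype.card_prod]
      exact (Fintype.card_congr (Fin.snocEquiv fun _ : Fin (r + 1) => Fin n → Fin Λ)).symm
    have hsum : (Finset.univ.filter fun L : Draws n (r + 1) Λ => e ∈ minorE G ρ (r + 1) L).card =
        ∑ L' : Draws n r Λ, (Finset.univ.filter fun ℓ : Fin n → Fin Λ =>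
          e ∈ minorE G ρ r L' ∨ e ∈ bfsCut (G.deleteEdges (minorE G ρ r L'))
            (ρ.pick r (G.deleteEdges (minorE G ρ r L'))) ℓ).card := by
      simp only [Finset.card_filter]
      rw [← Equiv.sum_comp (Fin.snocEquiv fun _ : Fin (r + 1) => Fin n → Fin Λ),
        Fintype.sum_prod_type_right]
      refine Finset.sum_congr rfl fun L' _ => Finset.sum_congr rfl fun ℓ _ => ?_
      refine if_congr ?_ rfl rfl
      change e ∈ minorE G ρ (r + 1) (Fin.snoc (α := fun _ => Fin n → Fin Λ) L' ℓ) ↔ _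
      rw [minorE, Fin.init_snoc, Fin.snoc_last]
      rfl
    have hstep : ∀ L' : Draws n r Λ, (Finset.univ.filter fun ℓ : Fin n → Fin Λ =>
          e ∈ minorE G ρ r L' ∨ e ∈ bfsCut (G.deleteEdges (minorE G ρ r L'))
            (ρ.pick r (G.deleteEdges (minorE G ρ r L'))) ℓ).card * Λ ≤
        (if e ∈ minorE G ρ r L' then 1 else 0) * (X * Λ) + X := by
      intro L'
      split_ifs with h
      · refine le_add_right ?_
        rw [one_mul]
        exact Nat.mul_le_mul_right _ (Finset.card_le_univ _)
      · simp only [h, false_or, zero_mul, zero_add]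
        induction e using Sym2.ind with
        | _ v u =>
          by_cases hvu : (G.deleteEdges (minorE G ρ r L')).Adj v u
          · simp only [mem_bfsCut_iff hvu]
            exact card_draw_eq_le _ _
          · have : ∀ ℓ : Fin n → Fin Λ, s(v, u) ∉ bfsCut (G.deleteEdges (minorE G ρ r L'))
                (ρ.pick r (G.deleteEdges (minorE G ρ r L'))) ℓ := fun ℓ hℓ => hvu hℓ.1
            simp [this]
    rw [hsum, Finset.sum_mul, hcard]
    refine (Finset.sum_le_sum fun L' _ => hstep L').trans ?_
    rw [Finset.sum_add_distrib, ← Finset.sum_mul, ← Finset.card_filter, Finset.sum_const,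
      Finset.card_univ, smul_eq_mul]
    have := Nat.mul_le_mul_right X ih
    nlinarith

/-- The energies of the components add up to the energy without the removed edges. -/
theorem sum_componentEnergy {q : ℕ} (M : MRF (Fin n) (Fin q)) (B : Set (Sym2 (Fin n)))
    (x : Fin n → Fin q) :
    open Classical in ∑ c, M.componentEnergy B c x + ∑ e with e ∈ M.graph.edgeSet ∧ e ∈ B,
      M.edgeTerm x e = M.energy x := by
  classical
  unfold MRF.componentEnergy MRF.energy
  rw [Finset.sum_add_distrib, add_assoc]
  congr 1
  · simp only [SimpleGraph.ConnectedComponent.mem_supp_iff]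
    exact Finset.sum_fiberwise _ _ _
  · have h1 : ∑ c : (M.graph.deleteEdges B).ConnectedComponent, ∑ e with
        e ∈ (M.graph.deleteEdges B).edgeSet ∧ ∀ v ∈ e, v ∈ c.supp, M.edgeTerm x e =
        ∑ e with e ∈ M.graph.edgeSet ∧ e ∉ B, M.edgeTerm x e := by
      simp only [Finset.sum_filter]
      rw [Finset.sum_comm]
      refine Finset.sum_congr rfl fun e _ => ?_
      have he : e ∈ (M.graph.deleteEdges B).edgeSet ↔ e ∈ M.graph.edgeSet ∧ e ∉ B := by
        simp
      simp only [he]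
      by_cases heB : e ∈ M.graph.edgeSet ∧ e ∉ B
      · simp only [heB, not_false_eq_true, true_and, and_self, if_true]
        induction e using Sym2.ind with
        | _ v u =>
          have hvu : (M.graph.deleteEdges B).Adj v u := he.2 heB
          have : ∀ c : (M.graph.deleteEdges B).ConnectedComponent,
              (∀ w ∈ s(v, u), w ∈ c.supp) ↔ (M.graph.deleteEdges B).connectedComponentMk v = c := by
            intro c
            constructor
            · intro h; exact h v (by simp)
            · rintro rfl w hw
              rcases Sym2.mem_iff.1 hw with rfl | rfl
              · rfl
              · exact (SimpleGraph.ConnectedComponent.eq.2 hvu.reachable).symm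
          simp only [this, Finset.sum_ite_eq, Finset.mem_univ, if_true]
      · simp only [heB, false_and, if_false, Finset.sum_const_zero]
    refine (congrArg (· + _) (Eq.trans (by congr!) h1)).trans ?_
    rw [← Finset.sum_union]
    · refine Finset.sum_congr ?_ fun _ _ => rfl
      ext e; simp only [Finset.mem_union, Finset.mem_filter, Finset.mem_univ, true_and]; tauto
    · rw [Finset.disjoint_filter]
      tauto

theorem edgeTerm_nonneg {q : ℕ} (M : MRF (Fin n) (Fin q)) (x : Fin n → Fin q)
    (e : Sym2 (Fin n)) : 0 ≤ M.edgeTerm x e := by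
  induction e using Sym2.ind with
  | _ v u => exact M.ψ_nonneg _ _ _ _

/-- Within the components `x` is at least as good as `y`, and the terms of `x` on removed edges are
nonnegative. -/
theorem energy_sub_le {q : ℕ} {M : MRF (Fin n) (Fin q)} {B : Set (Sym2 (Fin n))}
    {x : Fin n → Fin q} (hx : M.IsModeOutput B x) (y : Fin n → Fin q) :
    open Classical in M.energy y - M.energy x ≤
      ∑ e with e ∈ M.graph.edgeSet, if e ∈ B then M.edgeTerm y e else 0 := by
  classical
  have h1 := sum_componentEnergy M B x
  have h2 := sum_componentEnergy M B y
  have h3 : ∑ c, M.componentEnergy B c y ≤ ∑ c, M.componentEnergy B c x :=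
    Finset.sum_le_sum fun c _ => hx c y
  have h4 : 0 ≤ ∑ e with e ∈ M.graph.edgeSet ∧ e ∈ B, M.edgeTerm x e :=
    Finset.sum_nonneg fun e _ => edgeTerm_nonneg M x e
  rw [← Finset.sum_filter, Finset.filter_filter]
  linarith

theorem expect_energy_sub_le {q r : ℕ} {M : MRF (Fin n) (Fin q)} (hΛ : 0 < Λ)
    {ρ : RootRule (Fin n)} {x : Draws n r Λ → Fin n → Fin q}
    (hx : ∀ L, M.IsModeOutput (minorE M.graph ρ r L) (x L)) (y : Fin n → Fin q) :
    (𝔼 L, (M.energy y - M.energy (x L))) ≤ r / Λ * M.energy y := by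
  classical
  have : NeZero Λ := ⟨hΛ.ne'⟩
  have hΛ' : (0 : ℝ) < Λ := by exact_mod_cast hΛ
  have hN : (0 : ℝ) < Fintype.card (Draws n r Λ) := by exact_mod_cast Fintype.card_pos
  refine (Finset.expect_le_expect fun L _ => energy_sub_le (hx L) y).trans ?_
  rw [Finset.expect_sum_comm]
  have hterm : ∀ e, (𝔼 L : Draws n r Λ, if e ∈ minorE M.graph ρ r L then M.edgeTerm y e else 0) ≤
      r / Λ * M.edgeTerm y e := by
    intro e
    rw [Fintype.expect_eq_sum_div_card, ← Finset.sum_filter, Finset.sum_const, nsmul_eq_mul,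
      mul_div_right_comm]
    refine mul_le_mul_of_nonneg_right ?_ (edgeTerm_nonneg M y e)
    rw [div_le_div_iff₀ hN hΛ']
    exact_mod_cast card_minorE_le M.graph ρ e r
  refine (Finset.sum_le_sum fun e _ => hterm e).trans ?_
  rw [← Finset.mul_sum]
  refine mul_le_mul_of_nonneg_left ?_ (by positivity)
  unfold MRF.energy
  exact le_add_of_nonneg_left (Finset.sum_nonneg fun v _ => M.φ_nonneg _ _)

theorem energy_nonneg {q : ℕ} (M : MRF (Fin n) (Fin q)) (x : Fin n → Fin q) : 0 ≤ M.energy x := by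
  classical
  exact add_nonneg (Finset.sum_nonneg fun v _ => M.φ_nonneg _ _)
    (Finset.sum_nonneg fun e _ => edgeTerm_nonneg M x e)

/-- `K_{0,0}` has no vertices and is a minor of every graph. -/
theorem ExcludesKrr.pos {V : Type*} {G : SimpleGraph V} {r : ℕ} (h : ExcludesKrr G r) : 0 < r := by
  rcases Nat.eq_zero_or_pos r with rfl | hr
  · refine absurd ⟨fun _ => Set.univ, fun w => ?_, fun w => ?_, fun w => ?_⟩ h <;>
      exact (Sum.elim Fin.elim0 Fin.elim0 w)
  · exact hr

theorem lam_pos {q r : ℕ} {M : MRF (Fin n) (Fin q)} {ε : ℝ} (hε : 0 < ε) (hr : 0 < r) :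
    0 < lam M r ε := by
  unfold lam
  rw [Nat.ceil_pos]
  positivity

theorem approximation {q r : ℕ} {M : MRF (Fin n) (Fin q)} {ε : ℝ} (hε : 0 < ε) (hr : 0 < r)
    {ρ : RootRule (Fin n)} {x : Draws n r (lam M r ε) → Fin n → Fin q}
    (hx : ∀ L, M.IsModeOutput (minorE M.graph ρ r L) (x L)) (y : Fin n → Fin q) :
    (𝔼 L, (M.energy y - M.energy (x L))) ≤ ε * M.energy y := by
  refine (expect_energy_sub_le (lam_pos hε hr) hx y).trans
    (mul_le_mul_of_nonneg_right ?_ (energy_nonneg M y))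
  have h1 : (r : ℝ) * ((M.maxDeg : ℝ) + 1) / ε ≤ lam M r ε := Nat.le_ceil _
  have hΛ : (0 : ℝ) < lam M r ε := by exact_mod_cast lam_pos hε hr
  rw [div_le_iff₀ hΛ]
  rw [div_le_iff₀ hε] at h1
  -- Already `Λ ≥ r / ε` suffices; the summand with `d*` is slack.
  have : (0 : ℝ) ≤ r * M.maxDeg := by positivity
  nlinarith

end Approximation

/-! ### Components of the decomposition have small weak diameter -/

namespace SimpleGraph

section Chain

variable {V : Type*} {G H : SimpleGraph V}

theorem connected_induce_chain {p : ℕ → V} {a b : ℕ} (hab : a ≤ b)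
    (h : ∀ j, a ≤ j → j < b → G.Adj (p j) (p (j + 1))) :
    (G.induce (p '' Set.Icc a b)).Connected := by
  induction b, hab using Nat.le_induction with
  | base =>
    rw [Set.Icc_self, Set.image_singleton]
    exact ⟨fun u v => by rw [Subsingleton.elim u v]⟩
  | succ b hab ih =>
    have h1 := ih fun j hj hjb => h j hj (by omega)
    have h2 := induce_pair_connected_of_adj (h b hab (by omega))
    have h3 := induce_union_connected h1.preconnected h2.preconnected
      ⟨p b, ⟨b, ⟨hab, le_rfl⟩, rfl⟩, by simp⟩
    have e : p '' Set.Icc a (b + 1) = p '' Set.Icc a b ∪ {p b, p (b + 1)} := by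
      ext v
      simp only [Set.mem_image, Set.mem_Icc, Set.mem_union, Set.mem_insert_iff,
        Set.mem_singleton_iff]
      constructor
      · rintro ⟨j, ⟨hj1, hj2⟩, rfl⟩
        rcases Nat.lt_or_ge b j with hj | hj
        · have : j = b + 1 := by omega
          exact Or.inr (Or.inr (by rw [this]))
        · exact Or.inl ⟨j, ⟨hj1, hj⟩, rfl⟩
      · rintro (⟨j, ⟨hj1, hj2⟩, rfl⟩ | rfl | rfl)
        · exact ⟨j, ⟨hj1, by omega⟩, rfl⟩
        · exact ⟨b, ⟨hab, by omega⟩, rfl⟩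
        · exact ⟨b + 1, ⟨by omega, le_rfl⟩, rfl⟩
    rw [e]
    exact h3

theorem reachable_chain {p : ℕ → V} {a b : ℕ} (hab : a ≤ b)
    (h : ∀ j, a ≤ j → j < b → H.Adj (p j) (p (j + 1))) :
    H.Reachable (p b) (p a) ∧ H.dist (p b) (p a) ≤ b - a := by
  induction b, hab using Nat.le_induction with
  | base => simp
  | succ b hab ih =>
    obtain ⟨h1, h2⟩ := ih fun j hj hjb => h j hj (by omega)
    have hadj := (h b hab (by omega)).symm
    refine ⟨hadj.reachable.trans h1, ?_⟩
    have h3 := hadj.reachable.dist_triangle_left (w := p a)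
    rw [dist_eq_one_iff_adj.2 hadj] at h3
    omega

/-- A shortest path, as a sequence indexed by the distance from its start. -/
theorem Reachable.exists_geodesic {s v : V} (h : H.Reachable s v) :
    ∃ p : ℕ → V, p (H.dist s v) = v ∧
      (∀ j ≤ H.dist s v, H.Reachable s (p j) ∧ H.dist s (p j) = j) ∧
      ∀ j < H.dist s v, H.Adj (p j) (p (j + 1)) := by
  induction hd : H.dist s v generalizing v with
  | zero =>
    refine ⟨fun _ => v, rfl, fun j hj => ?_, by simp⟩
    obtain rfl : j = 0 := by omega
    exact ⟨h, hd⟩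
  | succ d ih =>
    obtain ⟨y, hyv, hy, hyd⟩ := h.exists_adj_dist_succ (by omega)
    obtain ⟨p, hp, hp1, hp2⟩ := ih hy (by omega)
    refine ⟨Function.update p (d + 1) v, by simp, fun j hj => ?_, fun j hj => ?_⟩
    · rcases Nat.lt_or_ge d j with hj' | hj'
      · obtain rfl : j = d + 1 := by omega
        simpa using ⟨h, hd⟩
      · rw [Function.update_of_ne (by omega)]
        exact hp1 j hj'
    · rw [Function.update_of_ne (show j ≠ d + 1 by omega)]
      rcases Nat.lt_or_ge j d with hj' | hj'
      · rw [Function.update_of_ne (by omega)]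
        exact hp2 j hj'
      · obtain rfl : j = d := by omega
        rw [Function.update_self, hp]
        exact hyv

/-- A shortest path from `s` stays inside the ball. -/
theorem connected_induce_levels (hHG : H ≤ G) (s : V) {e : ℕ} (he : 0 < e) :
    (G.induce {v | H.Reachable s v ∧ H.dist s v < e}).Connected := by
  have hs : s ∈ {v | H.Reachable s v ∧ H.dist s v < e} := by simpa using he
  refine induce_connected_of_patches s hs ?_
  rintro v ⟨hv, hve⟩
  obtain ⟨p, hp, hp1, hp2⟩ := hv.exists_geodesic
  have h0 : p 0 = s := by
    obtain ⟨h1, h2⟩ := hp1 0 (Nat.zero_le _)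
    exact (h1.dist_eq_zero_iff.1 h2).symm
  refine ⟨p '' Set.Icc 0 (H.dist s v), ?_, ⟨0, by simp, h0⟩, ⟨_, by simp, hp⟩, ?_⟩
  · rintro _ ⟨j, ⟨-, hj⟩, rfl⟩
    exact ⟨(hp1 j hj).1, by rw [(hp1 j hj).2]; omega⟩
  · exact (connected_induce_chain (Nat.zero_le _)
      fun j _ hj => hHG (hp2 j hj)).preconnected _ _

end Chain

end SimpleGraph

open SimpleGraph

/-- A minor of `G`, with all of its `m` left branch sets `A l` adjacent to all right branch sets
`B t`. The right branch sets are near the points `x t`; they contain points `u t` of the component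
of `w` in `H` such that the balls in `H` around these points avoid the left branch sets. -/
structure BandMinor {V T : Type*} (G H : SimpleGraph V) (w : V) (Λ : ℕ) (x : T → V) (m K : ℕ)
    (A : ℕ → Set V) (B : T → Set V) (u : T → V) : Prop where
  connA : ∀ l < m, (G.induce (A l)).Connected
  connB : ∀ t, (G.induce (B t)).Connected
  subA : ∀ l < m, ∀ v ∈ A l, H.Reachable w v
  subB : ∀ t, ∀ v ∈ B t, H.Reachable w v
  mem : ∀ t, u t ∈ B t
  disjA : ∀ l < m, ∀ l' < m, l ≠ l' → Disjoint (A l) (A l')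
  disjAB : ∀ l < m, ∀ t, Disjoint (A l) (B t)
  adj : ∀ l < m, ∀ t, ∃ a ∈ A l, ∃ b ∈ B t, G.Adj a b
  near : ∀ t, ∀ v ∈ B t, G.Reachable (x t) v ∧ G.dist (x t) v ≤ K
  safe : ∀ t, ∀ l < m, ∀ v, H.Reachable (u t) v → H.dist (u t) v ≤ Λ → v ∉ A l

/-- If `H'` arises from `H` by breadth-first search cuts, the levels of a component of `H'` lie in
a band `[a, a + Λ)`, and this band is not near the root, the minor can be extended. -/
theorem BandMinor.extend {V T : Type*} {G H H' : SimpleGraph V} {w r₀ : V} {Λ : ℕ} {x : T → V}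
    {m K a : ℕ} {A : ℕ → Set V} {B : T → Set V} {u : T → V} (hHG : H ≤ G) (hH' : H' ≤ H)
    (hr : H.Reachable r₀ w)
    (hband : ∀ v, H'.Reachable w v → a ≤ H.dist r₀ v ∧ H.dist r₀ v < a + Λ)
    (huncut : ∀ y v, H.Reachable r₀ y → H.Adj y v → a ≤ H.dist r₀ y →
      H.dist r₀ v = H.dist r₀ y + 1 → H.dist r₀ v < a + Λ → H'.Adj y v)
    (ha : 2 * Λ + 2 ≤ a) (hM : BandMinor G H' w Λ x m K A B u) :
    ∃ A' B' u', BandMinor G H w Λ x (m + 1) (K + 3 * Λ) A' B' u' := by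
  -- The levels below `e` become the new left branch set. The `2 * Λ + 1` levels from `e` to `a - 1`
  -- are a buffer whose middle level `e + Λ` will carry the new points `u t`.
  obtain ⟨e, rfl⟩ : ∃ e, a = e + 2 * Λ + 1 := ⟨a - 2 * Λ - 1, by omega⟩
  have he : 1 ≤ e := by omega
  have hu : ∀ t, H'.Reachable w (u t) := fun t => hM.subB t _ (hM.mem t)
  have hur : ∀ t, H.Reachable r₀ (u t) := fun t => hr.trans ((hu t).mono hH')
  choose p hp hp1 hp2 using fun t => (hur t).exists_geodesic
  have hlev : ∀ t, e + 2 * Λ + 1 ≤ H.dist r₀ (u t) ∧ H.dist r₀ (u t) < e + 2 * Λ + 1 + Λ :=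
    fun t => hband _ (hu t)
  have hΛ : ∀ t : T, 0 < Λ := fun t => by have := hlev t; omega
  set P : T → Set V := fun t => p t '' Set.Icc e (H.dist r₀ (u t)) with hP
  set N : Set V := {v | H.Reachable r₀ v ∧ H.dist r₀ v < e} with hN
  have hPlev : ∀ t, ∀ v ∈ P t, e ≤ H.dist r₀ v ∧ H.Reachable r₀ v := by
    rintro t _ ⟨j, ⟨hj1, hj2⟩, rfl⟩
    exact ⟨by rw [(hp1 t j hj2).2]; exact hj1, (hp1 t j hj2).1⟩
  have hNH' : ∀ v ∈ N, ¬ H'.Reachable w v := fun v hv h => by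
    have := (hband v h).1
    have := hv.2
    omega
  have hNP : ∀ t, ∀ v ∈ N, v ∉ P t := fun t v hv h => by
    have := (hPlev t v h).1
    have := hv.2
    omega
  -- Below level `a` the path is outside the band, which contains the old left sets. Inside the band
  -- its edges are uncut, so it stays within distance `Λ` of `u t` in `H'`, where `safe` applies.
  have hAP : ∀ l < m, ∀ t, ∀ v ∈ P t, v ∉ A l := by
    rintro l hl t _ ⟨j, ⟨hj1, hj2⟩, rfl⟩ hA
    have hlj := (hp1 t j hj2).2
    rcases Nat.lt_or_ge j (e + 2 * Λ + 1) with hj | hj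
    · have := (hband _ (hM.subA l hl _ hA)).1
      omega
    · have hch := reachable_chain (H := H') (p := p t) hj2 fun i hi1 hi2 => by
        have h1 := hp1 t i (by omega)
        have h2 := hp1 t (i + 1) (by omega)
        refine huncut _ _ h1.1 (hp2 t i hi2) (by omega) (by omega) ?_
        have := hlev t
        omega
      rw [hp t] at hch
      refine hM.safe t l hl _ hch.1 ?_ hA
      have := hlev t
      omega
  have hold : ∀ l < m, Function.update A m N l = A l := fun l hl => by
    rw [Function.update_of_ne hl.ne]
  have hcmem : ∀ t, p t (e + Λ) ∈ P t := fun t =>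
    ⟨e + Λ, ⟨by omega, by have := hlev t; omega⟩, rfl⟩
  refine ⟨Function.update A m N, fun t => B t ∪ P t, fun t => p t (e + Λ), ?_⟩
  constructor
  · intro l hl
    rcases Nat.lt_succ_iff_lt_or_eq.1 hl with hl | rfl
    · rw [hold l hl]; exact hM.connA l hl
    · rw [Function.update_self]; exact connected_induce_levels hHG r₀ he
  · intro t
    refine induce_union_connected (hM.connB t).preconnected
      (connected_induce_chain (by have := hlev t; omega)
        fun j _ hj => hHG (hp2 t j hj)).preconnected ⟨u t, hM.mem t, ?_⟩
    exact ⟨_, ⟨by have := hlev t; omega, le_rfl⟩, hp t⟩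
  · intro l hl v hv
    rcases Nat.lt_succ_iff_lt_or_eq.1 hl with hl | rfl
    · rw [hold l hl] at hv; exact (hM.subA l hl v hv).mono hH'
    · rw [Function.update_self] at hv; exact hr.symm.trans hv.1
  · rintro t v (hv | hv)
    · exact (hM.subB t v hv).mono hH'
    · exact hr.symm.trans (hPlev t v hv).2
  · exact fun t => Or.inr (hcmem t)
  · intro l hl l' hl' hne
    rcases Nat.lt_succ_iff_lt_or_eq.1 hl with hl | rfl <;>
      rcases Nat.lt_succ_iff_lt_or_eq.1 hl' with hl' | rfl
    · rw [hold l hl, hold l' hl']; exact hM.disjA l hl l' hl' hne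
    · rw [hold l hl, Function.update_self]
      exact Set.disjoint_left.2 fun v hv hv' => hNH' v hv' (hM.subA l hl v hv)
    · rw [hold l' hl', Function.update_self]
      exact Set.disjoint_left.2 fun v hv' hv => hNH' v hv' (hM.subA l' hl' v hv)
    · exact absurd rfl hne
  · intro l hl t
    rcases Nat.lt_succ_iff_lt_or_eq.1 hl with hl | rfl
    · rw [hold l hl]
      refine Set.disjoint_union_right.2 ⟨hM.disjAB l hl t, ?_⟩
      exact Set.disjoint_right.2 fun v hv => hAP l hl t v hv
    · rw [Function.update_self]
      refine Set.disjoint_union_right.2 ⟨?_, ?_⟩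
      · exact Set.disjoint_left.2 fun v hv hv' => hNH' v hv (hM.subB t v hv')
      · exact Set.disjoint_left.2 fun v hv => hNP t v hv
  · intro l hl t
    rcases Nat.lt_succ_iff_lt_or_eq.1 hl with hl | rfl
    · rw [hold l hl]
      obtain ⟨a, ha, b, hb, hab⟩ := hM.adj l hl t
      exact ⟨a, ha, b, Or.inl hb, hab⟩
    -- The edge of the geodesic from level `e - 1` to level `e` joins the new left set to the path;
    -- this needs `1 ≤ e`.
    · rw [Function.update_self]
      have hl := hlev t
      obtain ⟨h1, h2⟩ := hp1 t (e - 1) (by omega)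
      refine ⟨p t (e - 1), ⟨h1, by omega⟩, p t e, Or.inr ⟨e, ⟨le_rfl, by omega⟩, rfl⟩, ?_⟩
      have := hp2 t (e - 1) (by omega)
      rw [Nat.sub_add_cancel he] at this
      exact hHG this
  · rintro t v (hv | hv)
    · exact ⟨(hM.near t v hv).1, (hM.near t v hv).2.trans (by omega)⟩
    -- The path descends from a level at most `e + 3 * Λ` to level `e`, so it has at most `3 * Λ`
    -- edges.
    · obtain ⟨j, ⟨hj1, hj2⟩, rfl⟩ := hv
      have hch := reachable_chain (H := G) (p := p t) hj2 fun i hi1 hi2 => hHG (hp2 t i hi2)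
      rw [hp t] at hch
      obtain ⟨h1, h2⟩ := hM.near t _ (hM.mem t)
      refine ⟨h1.trans hch.1, ?_⟩
      have := h1.dist_triangle_left (w := p t j)
      have := hlev t
      omega
  -- The ball of radius `Λ` around level `e + Λ` occupies levels `e` to `e + 2 * Λ`: above the band
  -- with the old left sets, and below the ball `N`.
  · intro t l hl v hv hvd
    have hl' := hlev t
    obtain ⟨h1, h2⟩ := hp1 t (e + Λ) (by omega)
    have h3 := h1.dist_triangle_left (w := v)
    have h4 := (h1.trans hv).dist_triangle_left (w := p t (e + Λ))
    rw [H.dist_comm (u := v)] at h4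
    rcases Nat.lt_succ_iff_lt_or_eq.1 hl with hl | rfl
    · rw [hold l hl]
      intro hA
      have := (hband v (hM.subA l hl v hA)).1
      omega
    · rw [Function.update_self]
      intro hA
      have := hA.2
      omega

open SimpleGraph

/-! ### Bands of levels between consecutive cuts. -/

section Band

variable {n Λ : ℕ} {H : SimpleGraph (Fin n)}

/-- The shift by `Λ - 1 - L` makes the quotient jump exactly between the levels `k * Λ + L` and `k *
Λ + L + 1`, and an edge that joins these two levels has been cut. -/
theorem band_index_eq {root : H.ConnectedComponent → Fin n} {L : Fin n → Fin Λ} {w y v : Fin n}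
    (hr : H.Reachable (root (H.connectedComponentMk w)) w) (hy : H.Reachable w y)
    (h : (H.deleteEdges (bfsCut H root L)).Adj y v)
    (hle : H.dist (root (H.connectedComponentMk w)) y ≤
      H.dist (root (H.connectedComponentMk w)) v) :
    (H.dist (root (H.connectedComponentMk w)) y + (Λ - 1 - L (root (H.connectedComponentMk w)))) /
        Λ =
      (H.dist (root (H.connectedComponentMk w)) v +
        (Λ - 1 - L (root (H.connectedComponentMk w)))) / Λ := by
  obtain ⟨hadj, hcut⟩ := deleteEdges_adj.1 h
  rw [mem_bfsCut_iff hadj, ← ConnectedComponent.eq.2 hy, min_eq_left hle] at hcut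
  have h1 := (hr.trans hy).dist_le_succ hadj
  have hL := (L (root (H.connectedComponentMk w))).2
  generalize H.dist (root (H.connectedComponentMk w)) y = d at *
  generalize H.dist (root (H.connectedComponentMk w)) v = d' at *
  generalize (L (root (H.connectedComponentMk w)) : ℕ) = l at *
  rcases Nat.lt_or_ge d d' with hd | hd
  · obtain rfl : d' = d + 1 := by omega
    rw [show d + 1 + (Λ - 1 - l) = d + (Λ - 1 - l) + 1 by omega, Nat.succ_div, if_neg, add_zero]
    rintro ⟨m, hm⟩
    rcases m with _ | m
    · omega
    · refine hcut ⟨m, ?_⟩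
      rw [Nat.mul_succ, mul_comm] at hm
      omega
  · rw [le_antisymm hle hd]

/-- After a round of breadth-first search cuts, the levels of each component lie in a band, and
no edges inside the band have been cut. -/
theorem exists_band {root : H.ConnectedComponent → Fin n} (L : Fin n → Fin Λ) {w r₀ : Fin n}
    (hr₀ : root (H.connectedComponentMk w) = r₀) (hr : H.Reachable r₀ w) :
    ∃ a, (∀ v, (H.deleteEdges (bfsCut H root L)).Reachable w v → H.dist r₀ v < a + Λ) ∧
      (0 < a → (∀ v, (H.deleteEdges (bfsCut H root L)).Reachable w v → a ≤ H.dist r₀ v) ∧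
        ∀ y v, H.Reachable r₀ y → H.Adj y v → a ≤ H.dist r₀ y →
          H.dist r₀ v = H.dist r₀ y + 1 → H.dist r₀ v < a + Λ →
            (H.deleteEdges (bfsCut H root L)).Adj y v) := by
  have hL := (L r₀).2
  have hΛ : 0 < Λ := by omega
  have key : ∀ v, (H.deleteEdges (bfsCut H root L)).Reachable w v →
      (H.dist r₀ v + (Λ - 1 - L r₀)) / Λ = (H.dist r₀ w + (Λ - 1 - L r₀)) / Λ := by
    rintro v ⟨p⟩
    have : ∀ {y z} (_ : (H.deleteEdges (bfsCut H root L)).Walk y z), H.Reachable w y →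
        (H.dist r₀ z + (Λ - 1 - L r₀)) / Λ = (H.dist r₀ y + (Λ - 1 - L r₀)) / Λ := by
      intro y z p
      induction p with
      | nil => exact fun _ => rfl
      | @cons y x z h _ ih =>
        intro hy
        have hx : H.Reachable w x := hy.trans (H.deleteEdges_le _ h).reachable
        rw [ih hx]
        subst hr₀
        rcases le_total (H.dist (root (H.connectedComponentMk w)) y)
          (H.dist (root (H.connectedComponentMk w)) x) with hle | hle
        · exact (band_index_eq hr hy h hle).symm
        · exact band_index_eq hr hx h.symm hle
    exact this p (Reachable.refl w)
  generalize (H.dist r₀ w + (Λ - 1 - L r₀)) / Λ = k at key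
  rcases k with _ | k
  -- The band at the root consists of the levels `0` to `L` and may be shorter than `Λ`. Then `[0,
  -- Λ)` contains the cut level `L`, so nothing about uncut edges is claimed for `a = 0`.
  · refine ⟨0, fun v hv => ?_, fun h => absurd h (lt_irrefl 0)⟩
    have := (Nat.div_eq_zero_iff_lt hΛ).1 (key v hv)
    omega
  · have hk : ∀ v, (H.deleteEdges (bfsCut H root L)).Reachable w v →
        k * Λ + Λ ≤ H.dist r₀ v + (Λ - 1 - L r₀) ∧
          H.dist r₀ v + (Λ - 1 - L r₀) < k * Λ + Λ + Λ := fun v hv => by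
      have := (Nat.div_eq_iff hΛ).1 (key v hv)
      rw [Nat.succ_mul] at this
      omega
    refine ⟨k * Λ + L r₀ + 1, fun v hv => ?_, fun _ => ⟨fun v hv => ?_, ?_⟩⟩
    · have := hk v hv
      omega
    · have := hk v hv
      omega
    · intro y v hy hyv hay hd hlt
      refine deleteEdges_adj.2 ⟨hyv, fun hmem => ?_⟩
      rw [mem_bfsCut_iff hyv, ← ConnectedComponent.eq.2 (hr.symm.trans hy), hr₀,
        min_eq_left (by omega)] at hmem
      obtain ⟨j, hj⟩ := hmem
      -- A cut edge inside the band would need a multiple of `Λ` strictly between `k * Λ` and `(k +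
      -- 1) * Λ`.
      have h1 : k * Λ < j * Λ := by omega
      have h2 : j * Λ < (k + 1) * Λ := by rw [Nat.succ_mul]; omega
      have h3 := Nat.lt_of_mul_lt_mul_right h1
      have h4 := Nat.lt_of_mul_lt_mul_right h2
      omega

end Band

namespace SimpleGraph

/-- A discrete intermediate value theorem: along a path of `H ≤ G`, the distance from `w` in `G`
grows by at most `1` per edge. -/
theorem Reachable.exists_dist_eq {V : Type*} {G H : SimpleGraph V} (hHG : H ≤ G) {w v : V}
    (h : H.Reachable w v) {k : ℕ} (hk : k ≤ G.dist w v) :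
    ∃ x, H.Reachable w x ∧ G.dist w x = k := by
  induction hd : H.dist w v generalizing v with
  | zero =>
    obtain rfl := h.dist_eq_zero_iff.1 hd
    exact ⟨w, h, by simpa using hk.antisymm' (by simp)⟩
  | succ d ih =>
    obtain ⟨y, hyv, hy, hyd⟩ := h.exists_adj_dist_succ (by omega)
    rcases le_or_gt k (G.dist w y) with hky | hky
    · exact ih hy hky (by omega)
    · have := (hy.mono hHG).dist_le_succ (hHG hyv)
      exact ⟨v, h, by omega⟩

end SimpleGraph

/-! ### Weak diameter of the components. -/

section WeakDiameter

variable {n Λ r : ℕ} {G : SimpleGraph (Fin n)}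

/-- Distant points in a component of the decomposition give a minor of `G`. -/
theorem exists_bandMinor {T : Type*} {ρ : RootRule (Fin n)} {a : ℕ → Fin n → Fin Λ} {w : Fin n}
    {x : T → Fin n} (hx : ∀ t, (cutGraph G ρ a r).Reachable w (x t)) {t₀ t₁ : T}
    (hfar : 6 * Λ * r + 6 * Λ + 2 < G.dist (x t₀) (x t₁)) {m i : ℕ} (hmi : m + i = r) :
    ∃ A B u, BandMinor G (cutGraph G ρ a i) w Λ x m (3 * Λ * m) A B u := by
  induction m generalizing i with
  | zero =>
    obtain rfl : i = r := by omega
    refine ⟨fun _ => ∅, fun t => {x t}, x, ⟨by simp, fun t => ?_, by simp, ?_, by simp, by simp,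
      by simp, by simp, ?_, by simp⟩⟩
    · exact ⟨fun u v => by rw [Subsingleton.elim u v]⟩
    · rintro t v rfl; exact hx t
    · rintro t v rfl; simp
  | succ m ih =>
    obtain ⟨A, B, u, hM⟩ := ih (i := i + 1) (by omega)
    have hHG := cutGraph_le G ρ a i
    obtain ⟨r₀, hr₀⟩ : ∃ r₀, ρ.pick i _ ((cutGraph G ρ a i).connectedComponentMk w) = r₀ :=
      ⟨_, rfl⟩
    have hr : (cutGraph G ρ a i).Reachable r₀ w := by
      rw [← ConnectedComponent.eq, ← hr₀]
      exact ρ.pick_mem i _ _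
    obtain ⟨b, hb1, hb2⟩ := exists_band (a i) hr₀ hr
    rcases le_or_gt (2 * Λ + 2) b with hb | hb
    · obtain ⟨A', B', u', h⟩ := hM.extend hHG (SimpleGraph.deleteEdges_le _) hr
        (fun v hv => ⟨(hb2 (by omega)).1 v hv, hb1 v hv⟩) (hb2 (by omega)).2 hb
      exact ⟨A', B', u', h⟩
    -- If the band begins near the root, every `u t` is within `3 * Λ + 1` of `r₀` in `G`, and `x t`
    -- is within `3 * Λ * m` of `u t`. So `x t₀` and `x t₁` are too close.
    · exfalso
      have hu : ∀ t, (cutGraph G ρ a (i + 1)).Reachable w (u t) :=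
        fun t => hM.subB t _ (hM.mem t)
      have hu' : ∀ t, G.Reachable r₀ (u t) ∧ G.dist r₀ (u t) < b + Λ := fun t => by
        have h1 := hr.trans ((hu t).mono (SimpleGraph.deleteEdges_le _))
        exact ⟨h1.mono hHG, (h1.dist_anti hHG).trans_lt (hb1 _ (hu t))⟩
      have hn := fun t => hM.near t _ (hM.mem t)
      have h1 := (hn t₀).1.dist_triangle_left (w := x t₁)
      have h2 := (hu' t₀).1.symm.dist_triangle_left (w := x t₁)
      have h3 := (hu' t₁).1.dist_triangle_left (w := x t₁)
      rw [G.dist_comm (u := u t₀) (v := r₀)] at h2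
      rw [G.dist_comm (u := u t₁)] at h3
      have h4 := (hn t₀).2
      have h5 := (hn t₁).2
      have h6 := (hu' t₀).2
      have h7 := (hu' t₁).2
      have h8 : 6 * Λ * r = 2 * (3 * Λ * m) + 6 * Λ * (i + 1) := by rw [← hmi]; ring
      omega

/-- The components that are left by `Minor-e` have small weak diameter if `G` excludes
`K_{r,r}` as a minor. -/
theorem ExcludesKrr.dist_lt (hG : ExcludesKrr G r) (hΛ : 0 < Λ) {ρ : RootRule (Fin n)}
    {a : ℕ → Fin n → Fin Λ} {w v : Fin n} (h : (cutGraph G ρ a r).Reachable w v) :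
    G.dist w v < 15 * r ^ 2 * Λ := by
  have hr := hG.pos
  by_contra! hlt
  -- The spacing just exceeds what `exists_bandMinor` needs. As `r` and `Λ` are at least `1`, it is
  -- at most `15 * Λ * r`, and `r` such gaps fit into `15 * r ^ 2 * Λ`.
  set K := 6 * Λ * r + 6 * Λ + 3 with hK
  have hKr : r * K ≤ 15 * r ^ 2 * Λ := by
    have h1 : 6 * Λ ≤ 6 * Λ * r := Nat.le_mul_of_pos_right _ hr
    have h2 : 3 ≤ 3 * Λ * r := Nat.mul_le_mul (Nat.le_mul_of_pos_right 3 hΛ) hr |>.trans' (by simp)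
    calc r * K ≤ r * (15 * Λ * r) := Nat.mul_le_mul_left _ (by
          have : 15 * Λ * r = 6 * Λ * r + 6 * Λ * r + 3 * Λ * r := by ring
          omega)
      _ = 15 * r ^ 2 * Λ := by ring
  have hHG := cutGraph_le G ρ a r
  -- The minor uses only `r` of these `r + 1` points, but two distant points are needed even for `r
  -- = 1`.
  have hex : ∀ t : Fin (r + 1), ∃ x, (cutGraph G ρ a r).Reachable w x ∧ G.dist w x = t * K :=
    fun t => h.exists_dist_eq hHG ((Nat.mul_le_mul_right _ (Nat.lt_succ_iff.1 t.2)).trans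
      (hKr.trans hlt))
  choose x hx hxd using hex
  have hfar : ∀ t t' : Fin (r + 1), t < t' → K ≤ G.dist (x t) (x t') := fun t t' htt => by
    have h1 := ((hx t).mono hHG).dist_triangle_left (w := x t')
    rw [hxd, hxd] at h1
    have h2 : ((t : ℕ) + 1) * K ≤ t' * K := Nat.mul_le_mul_right _ htt
    rw [Nat.succ_mul] at h2
    omega
  have hfar' : ∀ t t' : Fin (r + 1), t ≠ t' → K ≤ G.dist (x t) (x t') := fun t t' hne => by
    rcases lt_or_gt_of_ne hne with hlt | hlt
    · exact hfar t t' hlt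
    · rw [G.dist_comm]; exact hfar t' t hlt
  obtain ⟨A, B, u, hM⟩ := exists_bandMinor (m := r) (i := 0) hx
    (t₀ := 0) (t₁ := Fin.last r)
    (by have := hfar 0 (Fin.last r) (by simpa [Fin.lt_def] using hr); omega) (by omega)
  -- Each right set stays within `3 * Λ * r` of its own point, and the points are more than `6 * Λ *
  -- r` apart.
  have hB : ∀ t t', t ≠ t' → Disjoint (B t) (B t') := fun t t' hne => by
    refine Set.disjoint_left.2 fun v hv hv' => ?_
    have h1 := hM.near t v hv
    have h2 := hM.near t' v hv'
    have h3 := h1.1.dist_triangle_left (w := x t')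
    rw [G.dist_comm (u := v)] at h3
    have h4 := hfar' t t' hne
    have h5 : 6 * Λ * r = 2 * (3 * Λ * r) := by ring
    omega
  refine hG ⟨Sum.elim (fun l => A l) (fun t => B t.castSucc), ?_, ?_, ?_⟩
  · rintro (l | t)
    · exact hM.connA l l.2
    · exact hM.connB _
  · rintro (l | t) (l' | t') hne
    · exact hM.disjA l l.2 l' l'.2 fun h => hne (by rw [Fin.ext h])
    · exact hM.disjAB l l.2 _
    · exact (hM.disjAB l' l'.2 _).symm
    · exact hB _ _ fun h => hne (by rw [Fin.castSucc_injective r h])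
  · rintro (l | t) (l' | t') hadj
    · simp at hadj
    · exact hM.adj l l.2 _
    · obtain ⟨a, ha, b, hb, hab⟩ := hM.adj l' l'.2 t.castSucc
      exact ⟨b, hb, a, ha, hab.symm⟩
    · simp at hadj

end WeakDiameter

/-! ### Sizes of balls. -/

section Counting

variable {n : ℕ} {G : SimpleGraph (Fin n)}

-- A ball of the next radius lies in `w` together with the neighbourhoods of the smaller ball. The
-- strict form `S.card + 1 ≤ D ^ R` gives `S.card * D + 1 ≤ D ^ (R + 1) - D + 1`, which closes the
-- induction as `2 ≤ D`.
open Classical in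
theorem card_ball_lt {D : ℕ} (hD : 2 ≤ D) (hdeg : ∀ v, G.degree v ≤ D) (w : Fin n) (R : ℕ) :
    (Finset.univ.filter fun v => G.Reachable w v ∧ G.dist w v < R).card < D ^ R := by
  induction R with
  | zero => simp
  | succ R ih =>
    set S := Finset.univ.filter fun v => G.Reachable w v ∧ G.dist w v < R with hS
    have hsub : (Finset.univ.filter fun v => G.Reachable w v ∧ G.dist w v < R + 1) ⊆
        insert w (S.biUnion fun y => G.neighborFinset y) := by
      intro v hv
      obtain ⟨hv, hvd⟩ := (Finset.mem_filter.1 hv).2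
      rcases Nat.eq_zero_or_pos (G.dist w v) with h0 | h0
      · rw [hv.dist_eq_zero_iff.1 h0]; simp
      · obtain ⟨y, hyv, hy, hyd⟩ := hv.exists_adj_dist_succ h0.ne'
        refine Finset.mem_insert_of_mem (Finset.mem_biUnion.2 ⟨y, ?_, by simpa using hyv⟩)
        exact Finset.mem_filter.2 ⟨Finset.mem_univ _, hy, by omega⟩
    have h1 := Finset.card_le_card hsub
    have h2 := Finset.card_insert_le w (S.biUnion fun y => G.neighborFinset y)
    have h3 := Finset.card_biUnion_le_card_mul S (fun y => G.neighborFinset y) D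
      fun y _ => by simpa using hdeg y
    have h4 : (S.card + 1) * D ≤ D ^ R * D := Nat.mul_le_mul_right _ ih
    rw [pow_succ]
    rw [Nat.succ_mul] at h4
    omega

-- With degrees at most `1`, the set of `w` and its neighbour, if any, is closed under adjacency.
open Classical in
theorem card_reachable_le_two (hdeg : ∀ v, G.degree v ≤ 1) (w : Fin n) :
    (Finset.univ.filter fun v => G.Reachable w v).card ≤ 2 := by
  have hsub : (Finset.univ.filter fun v => G.Reachable w v) ⊆ insert w (G.neighborFinset w) := by
    intro v hv
    obtain ⟨p⟩ := (Finset.mem_filter.1 hv).2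
    have : ∀ {y z} (_ : G.Walk y z), y ∈ insert w (G.neighborFinset w) →
        z ∈ insert w (G.neighborFinset w) := by
      intro y z p
      induction p with
      | nil => exact id
      | @cons y x z h _ ih =>
        intro hy
        refine ih ?_
        rcases Finset.mem_insert.1 hy with rfl | hy
        · simp [h]
        · have hw : w ∈ G.neighborFinset y := by simpa using ((mem_neighborFinset _ _ _).1 hy).symm
          have hx : x ∈ G.neighborFinset y := by simpa using h
          rw [Finset.card_le_one.1 (hdeg y) x hx w hw]
          simp
    exact this p (by simp)
  refine (Finset.card_le_card hsub).trans ((Finset.card_insert_le _ _).trans ?_)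
  have := hdeg w
  rw [← card_neighborFinset_eq_degree] at this
  omega

end Counting

/-- The lengths of adjacency lists are at most the maximum degree. -/
theorem IsAdjacencyList.length_le {n q : ℕ} {M : MRF (Fin n) (Fin q)}
    {nbr : Fin n → List (Fin n)} (h : IsAdjacencyList M.graph nbr) (v : Fin n) :
    (nbr v).length ≤ M.maxDeg := by
  classical
  rw [MRF.maxDeg, ← List.toFinset_card_of_nodup (h v).1]
  refine le_trans (le_of_eq ?_) (M.graph.degree_le_maxDegree v)
  rw [← card_neighborFinset_eq_degree]
  congr 1
  ext u
  simp [(h v).2 u]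

/-! ### The running time -/

section RunningTime

open SimpleGraph Prog

variable {n q r Λ : ℕ} {M : MRF (Fin n) (Fin q)} {nbr : Fin n → List (Fin n)}
  {L : Draws n r Λ} {t : ℕ} {s : MState}

open Classical in
theorem MRF.degree_le (M : MRF (Fin n) (Fin q)) (v : Fin n) : M.graph.degree v ≤ M.maxDeg :=
  M.graph.degree_le_maxDegree v

theorem time_le_of_excludesKrr (hn : 0 < n) (hq : 0 < q) (hΛ : 0 < Λ)
    (hex : ExcludesKrr M.graph r) (hG : IsAdjacencyList M.graph nbr)
    (he : Exec (drawSource L) mode (inputState M nbr r Λ) t s) :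
    t ≤ 310 * ((r + 1) * n * (M.maxDeg + 1) * q ^ max 2 M.maxDeg ^ (15 * r ^ 2 * Λ)) := by
  classical
  have hpos : 0 < max 2 M.maxDeg ^ (15 * r ^ 2 * Λ) := by positivity
  -- The ball bound is strict, so the `K + 1` in the exponent of the time bound costs nothing.
  have h := time_mode_le (K := max 2 M.maxDeg ^ (15 * r ^ 2 * Λ) - 1) hn hq hΛ hG
    hG.length_le (fun c => ?_) he
  · rw [Nat.sub_add_cancel hpos] at h
    refine h.trans ?_
    gcongr
    split_ifs
    · exact Nat.zero_le _
    · exact le_rfl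
  · refine Nat.le_sub_one_of_lt (lt_of_le_of_lt (Finset.card_le_card fun x hx => ?_)
      (card_ball_lt (le_max_left 2 M.maxDeg)
        (fun v => (M.degree_le v).trans (le_max_right _ _)) c (15 * r ^ 2 * Λ)))
    obtain rfl := (Finset.mem_filter.1 hx).2
    have hreach := ((cutGraph M.graph (minRule n) (extendDraws hΛ L) r).reachable_rootOf x).symm
    simp only [Finset.mem_filter, Finset.mem_univ, true_and]
    exact ⟨hreach.mono (cutGraph_le _ _ _ _), hex.dist_lt hΛ hreach⟩

theorem time_le_of_lam_eq_one (hn : 0 < n) (hq : 0 < q) (hr : 0 < r) (hΛ : Λ = 1)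
    (hG : IsAdjacencyList M.graph nbr)
    (he : Exec (drawSource L) mode (inputState M nbr r Λ) t s) :
    t ≤ 310 * ((r + 1) * n * q ^ 2) := by
  have hΛ' : 0 < Λ := by omega
  have h := time_mode_le (K := 1) hn hq hΛ' hG hG.length_le (fun c => ?_) he
  · rw [if_pos ⟨hr, hΛ⟩] at h
    simpa using h
  · rw [cutGraph_eq_bot hΛ hr]
    refine Finset.card_le_one.2 fun x hx y hy => ?_
    have hxy := (Finset.mem_filter.1 hx).2.trans (Finset.mem_filter.1 hy).2.symm
    exact reachable_bot.1 (rootOf_eq_iff.1 hxy)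

theorem time_le_of_maxDeg_le_one (hn : 0 < n) (hq : 0 < q) (hΛ : 0 < Λ) (hd : M.maxDeg ≤ 1)
    (hG : IsAdjacencyList M.graph nbr)
    (he : Exec (drawSource L) mode (inputState M nbr r Λ) t s) :
    t ≤ 310 * ((r + 1) * n * 2 * q ^ 3) := by
  classical
  have h := time_mode_le (K := 2) (D := 1) hn hq hΛ hG (fun v => (hG.length_le v).trans hd)
    (fun c => ?_) he
  · refine h.trans ?_
    gcongr
    split_ifs <;> simp
  · refine (Finset.card_le_card fun x hx => ?_).trans
      (card_reachable_le_two (fun v => (M.degree_le v).trans hd) c)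
    obtain rfl := (Finset.mem_filter.1 hx).2
    have hreach := ((cutGraph M.graph (minRule n) (extendDraws hΛ L) r).reachable_rootOf x).symm
    simp only [Finset.mem_filter, Finset.mem_univ, true_and]
    exact hreach.mono (cutGraph_le _ _ _ _)

/-- The constant is a sum because one `C` must dominate both the leading factor and the coefficient
in the exponent. -/
theorem time_le (hn : 0 < n) (hq : 0 < q) (hΛ : 0 < Λ) (hex : ExcludesKrr M.graph r)
    (hG : IsAdjacencyList M.graph nbr)
    (he : Exec (drawSource L) mode (inputState M nbr r Λ) t s) :
    t ≤ (620 * (r + 1) + 15 * r ^ 2) * n * max 2 M.maxDeg *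
      q ^ max 2 M.maxDeg ^ ((620 * (r + 1) + 15 * r ^ 2) * Λ) := by
  refine (time_le_of_excludesKrr hn hq hΛ hex hG he).trans ?_
  have h1 : M.maxDeg + 1 ≤ 2 * max 2 M.maxDeg := by omega
  calc 310 * ((r + 1) * n * (M.maxDeg + 1) * q ^ max 2 M.maxDeg ^ (15 * r ^ 2 * Λ))
      ≤ 310 * ((r + 1) * n * (2 * max 2 M.maxDeg) * q ^ max 2 M.maxDeg ^ (15 * r ^ 2 * Λ)) := by
        gcongr
    _ = 620 * (r + 1) * n * max 2 M.maxDeg * q ^ max 2 M.maxDeg ^ (15 * r ^ 2 * Λ) := by ring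
    _ ≤ _ := by
        have h2 : 1 ≤ max 2 M.maxDeg := by omega
        gcongr
        · omega
        · omega

/-- The parameter of the decomposition is at most a constant times `d / ε`, unless it is `1`. -/
theorem lam_le {ε : ℝ} (hε : 0 < ε) (hd : 1 ≤ M.maxDeg) (hΛ : lam M r ε ≠ 1) :
    (lam M r ε : ℝ) ≤ 4 * r * (ε⁻¹ * M.maxDeg) := by
  have hd' : (1 : ℝ) ≤ M.maxDeg := by exact_mod_cast hd
  have h0 : 0 ≤ (r : ℝ) * ((M.maxDeg : ℝ) + 1) / ε := by positivity
  have h2 : (r : ℝ) * ((M.maxDeg : ℝ) + 1) / ε ≤ 2 * r * (ε⁻¹ * M.maxDeg) := by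
    rw [div_eq_mul_inv]
    have : (0 : ℝ) ≤ r * ε⁻¹ := by positivity
    nlinarith
  -- A ceiling above `1` is less than twice its argument; a ceiling equal to `1` has no such bound.
  rcases Nat.lt_or_ge 1 (lam M r ε) with h | h
  · have h1 : 1 < (r : ℝ) * ((M.maxDeg : ℝ) + 1) / ε := by
      simpa [lam] using Nat.lt_ceil.1 h
    have h3 : (lam M r ε : ℝ) < (r : ℝ) * ((M.maxDeg : ℝ) + 1) / ε + 1 := Nat.ceil_lt_add_one h0
    linarith
  · have : lam M r ε = 0 := by omega
    rw [this, Nat.cast_zero]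
    positivity

/-- With `y = √(log m)` one has `m ^ δ = exp (δ * y ^ 2)`, and `δ * y ^ 2 - b * y` tends to
infinity. -/
theorem isLittleO_exp_sqrt_log (b : ℝ) {δ : ℝ} (hδ : 0 < δ) :
    (fun m : ℕ => (m : ℝ) * Real.exp (b * √(Real.log m))) =o[atTop]
      fun m : ℕ => (m : ℝ) ^ (1 + δ) := by
  have hy : Tendsto (fun m : ℕ => √(Real.log m)) atTop atTop :=
    Real.tendsto_sqrt_atTop.comp (Real.tendsto_log_atTop.comp tendsto_natCast_atTop_atTop)
  have h1 : Tendsto (fun y : ℝ => δ * y ^ 2 - b * y) atTop atTop := by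
    have : Tendsto (fun y : ℝ => y * (δ * y + -b)) atTop atTop :=
      tendsto_id.atTop_mul_atTop₀ (tendsto_atTop_add_const_right _ _
        (tendsto_id.const_mul_atTop hδ))
    exact this.congr fun y => by ring
  have h2 : (fun m : ℕ => Real.exp (b * √(Real.log m))) =o[atTop]
      fun m : ℕ => Real.exp (δ * √(Real.log m) ^ 2) :=
    Real.isLittleO_exp_comp_exp_comp.2 (h1.comp hy)
  refine ((isBigO_refl (fun m : ℕ => (m : ℝ)) atTop).mul_isLittleO h2).congr' .rfl ?_
  filter_upwards [eventually_gt_atTop 0] with m hm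
  have hm' : (0 : ℝ) < m := by exact_mod_cast hm
  rw [Real.sq_sqrt (Real.log_natCast_nonneg m), Real.rpow_add hm', Real.rpow_one,
    Real.rpow_def_of_pos hm', mul_comm δ]

/-- The time bound when `d log d / ε` is at most a small multiple of `log log n`. -/
theorem time_le_exp {ε : ℝ} {L : Draws n r (lam M r ε)} (hn : 1 < Real.log n) (hq : 0 < q)
    (hε : 0 < ε) (hex : ExcludesKrr M.graph r) (hG : IsAdjacencyList M.graph nbr)
    (hsmall : 120 * r ^ 3 * (ε⁻¹ * (M.maxDeg * Real.log M.maxDeg)) ≤ Real.log (Real.log n))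
    (he : Exec (drawSource L) mode (inputState M nbr r (lam M r ε)) t s) :
    (t : ℝ) ≤ 620 * (r + 1) * q ^ 3 * (n * Real.exp ((Real.log q + 1) * √(Real.log n))) := by
  have hr := hex.pos
  have hΛ : 0 < lam M r ε := lam_pos hε hr
  have hn0 : 0 < n := by
    rcases Nat.eq_zero_or_pos n with rfl | h
    · norm_num at hn
    · exact h
  have hq1 : (1 : ℝ) ≤ q := by exact_mod_cast hq
  have hlq : 0 ≤ Real.log q := Real.log_nonneg hq1
  have hexp : 1 ≤ Real.exp ((Real.log q + 1) * √(Real.log n)) :=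
    Real.one_le_exp (by positivity)
  have hconst : t ≤ 620 * (r + 1) * q ^ 3 * n →
      (t : ℝ) ≤ 620 * (r + 1) * q ^ 3 * (n * Real.exp ((Real.log q + 1) * √(Real.log n))) := by
    intro h
    have h' : (t : ℝ) ≤ 620 * (r + 1) * q ^ 3 * n := by exact_mod_cast h
    refine h'.trans ?_
    rw [← mul_assoc]
    exact le_mul_of_one_le_right (by positivity) hexp
  by_cases hΛ1 : lam M r ε = 1
  · refine hconst ((time_le_of_lam_eq_one hn0 hq hr hΛ1 hG he).trans ?_)
    calc 310 * ((r + 1) * n * q ^ 2) ≤ 620 * ((r + 1) * n * q ^ 3) := by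
          gcongr
          · norm_num
          · norm_num
      _ = 620 * (r + 1) * q ^ 3 * n := by ring
  rcases Nat.lt_or_ge 1 M.maxDeg with hd | hd
  · have hd1 : (1 : ℝ) < M.maxDeg := by exact_mod_cast hd
    have hld : 0 ≤ Real.log M.maxDeg := Real.log_nonneg hd1.le
    set y := √(Real.log n) with hy
    -- Taking logarithms twice, this is `30 * r ^ 2 * Λ * log d ≤ log (log n)`, doubled because of
    -- the square root. With `Λ ≤ 4 * r * d / ε` the constant becomes `120 * r ^ 3`.
    have hpow : (M.maxDeg : ℝ) ^ (15 * r ^ 2 * lam M r ε) ≤ y := by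
      rw [← Real.rpow_natCast, Real.rpow_def_of_pos (by linarith), hy,
        Real.le_sqrt' (Real.exp_pos _), ← Real.exp_nat_mul,
        ← Real.le_log_iff_exp_le (by linarith)]
      refine le_trans ?_ hsmall
      have := mul_le_mul_of_nonneg_left (lam_le (r := r) hε hd.le hΛ1)
        (show (0 : ℝ) ≤ 30 * r ^ 2 * Real.log M.maxDeg by positivity)
      push_cast
      linarith
    have hd2 : (M.maxDeg : ℝ) ≤ y := by
      refine le_trans ?_ hpow
      exact le_self_pow₀ hd1.le (by positivity)
    have ht := time_le_of_excludesKrr hn0 hq hΛ hex hG he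
    rw [max_eq_right hd] at ht
    have ht' : (t : ℝ) ≤ 310 * ((r + 1) * n * (M.maxDeg + 1) *
        (q : ℝ) ^ M.maxDeg ^ (15 * r ^ 2 * lam M r ε)) := by exact_mod_cast ht
    have h1 : (q : ℝ) ^ M.maxDeg ^ (15 * r ^ 2 * lam M r ε) ≤ Real.exp (Real.log q * y) := by
      rw [← Real.rpow_natCast, Real.rpow_def_of_pos (by linarith)]
      push_cast
      gcongr
    -- The degree factor goes into the exponential too; this is the `+ 1` in `Real.log q + 1`.
    have h2 : (M.maxDeg : ℝ) + 1 ≤ Real.exp y :=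
      (add_le_add_left hd2 1).trans (Real.add_one_le_exp y)
    calc (t : ℝ) ≤ 310 * ((r + 1) * n * Real.exp y * Real.exp (Real.log q * y)) := by
          refine ht'.trans ?_
          gcongr
      _ = 310 * (r + 1) * 1 * (n * Real.exp ((Real.log q + 1) * y)) := by
          rw [add_mul (Real.log q), one_mul, Real.exp_add]; ring
      _ ≤ _ := by
          gcongr
          · norm_num
          · exact one_le_pow₀ hq1
  · refine hconst ((time_le_of_maxDeg_le_one hn0 hq hΛ hd hG he).trans (le_of_eq ?_))
    ring

end RunningTime

/-! ### The main theorem. -/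

theorem mainTheorem4 :
    -- The approximation guarantee, for all choices of roots and of exact MAP assignments.
    (∀ (n q r : ℕ) (M : MRF (Fin n) (Fin q)) (ε : ℝ), 0 < ε → ExcludesKrr M.graph r →
      ∀ (ρ : RootRule (Fin n)) (xhat : Draws n r (lam M r ε) → Fin n → Fin q),
        (∀ L, M.IsModeOutput (minorE M.graph ρ r L) (xhat L)) →
        ∀ xstar : Fin n → Fin q, M.IsMAP xstar →
          (𝔼 L, (M.energy xstar - M.energy (xhat L))) ≤ ε * M.energy xstar) ∧
    -- The running time.
    ∃ P : Cmd, ImplementsMode P ∧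
      (∀ r : ℕ, ∃ C : ℕ, ∀ (n q : ℕ) (M : MRF (Fin n) (Fin q)) (ε : ℝ),
        0 < n → 0 < q → 0 < ε → ExcludesKrr M.graph r →
        ∀ nbr : Fin n → List (Fin n), IsAdjacencyList M.graph nbr →
        ∀ (L : Draws n r (lam M r ε)) (t : ℕ) (s : MState),
          Exec (drawSource L) P (inputState M nbr r (lam M r ε)) t s →
          t ≤ C * n * max 2 M.maxDeg * q ^ (max 2 M.maxDeg) ^ (C * lam M r ε)) ∧
      (∀ (r q : ℕ) (n : ℕ → ℕ) (M : ∀ k, MRF (Fin (n k)) (Fin q)) (ε : ℕ → ℝ),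
        0 < q → (∀ k, 0 < n k) → Tendsto n atTop atTop → (∀ k, 0 < ε k) →
        (∀ k, ExcludesKrr (M k).graph r) →
        (fun k => (ε k)⁻¹ * (((M k).maxDeg : ℝ) * Real.log ((M k).maxDeg : ℝ)))
          =o[atTop] (fun k => Real.log (Real.log (n k : ℝ))) →
        ∀ nbr : ∀ k, Fin (n k) → List (Fin (n k)), (∀ k, IsAdjacencyList (M k).graph (nbr k)) →
        ∀ (L : ∀ k, Draws (n k) r (lam (M k) r (ε k))) (t : ℕ → ℕ) (s : ℕ → MState),
          (∀ k, Exec (drawSource (L k)) P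
            (inputState (M k) (nbr k) r (lam (M k) r (ε k))) (t k) (s k)) →
          ∀ δ : ℝ, 0 < δ →
            (fun k => (t k : ℝ)) =o[atTop] (fun k => (n k : ℝ) ^ (1 + δ))) := by
  refine ⟨fun n q r M ε hε hex ρ xhat hx xstar _ => approximation hε hex.pos hx xstar, Prog.mode,
    implementsMode_mode, fun r => ⟨620 * (r + 1) + 15 * r ^ 2, ?_⟩, ?_⟩
  · intro n q M ε hn hq hε hex nbr hG L t s he
    exact time_le hn hq (lam_pos hε hex.pos) hex hG he
  · intro r q n M ε hq _ hn hε hex hsmall nbr hG L t s he δ hδ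
    have hn' : Tendsto (fun k => Real.log (n k)) atTop atTop :=
      Real.tendsto_log_atTop.comp (tendsto_natCast_atTop_atTop.comp hn)
    refine IsBigO.trans_isLittleO (IsBigO.of_bound (620 * (r + 1) * q ^ 3) ?_)
      ((isLittleO_exp_sqrt_log (Real.log q + 1) hδ).comp_tendsto hn)
    have hr : (0 : ℝ) < r := by exact_mod_cast (hex 0).pos
    -- The little-o hypothesis is used with the single constant `1 / (120 * r ^ 3)`.
    filter_upwards [hn'.eventually_gt_atTop 1,
      hsmall.def (c := (120 * (r : ℝ) ^ 3)⁻¹) (by positivity)] with k hk hb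
    rw [Real.norm_natCast, Function.comp_apply, Real.norm_of_nonneg (by positivity)]
    refine time_le_exp hk hq (hε k) (hex k) (hG k) ?_ (he k)
    rw [Real.norm_of_nonneg (Real.log_nonneg hk.le), Real.norm_eq_abs] at hb
    exact (le_inv_mul_iff₀ (by positivity)).1 ((le_abs_self _).trans hb)
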